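/- **Setting.** Let $T,\epsilon_1,\epsilon_2,R>0$, $q\neq 0$, let $c_1,c_2$ be real continuous functions on $[0,1]$, and let $Q_1,Q_2,P_{f1},P_{f2}$ be continuous symmetric kernels on $[0,1]^2$ whose integral operators $K(f)(x)=\int_0^1K(x,y)f(y)\,dy$ are positive semidefinite on $L^2([0,1])$. For $s\in[0,T)$ and $u_0,v_0\in L^2([0,1])$, a trajectory on $[s,T]$ from $(u_0,v_0)$ is a triple $(u,v,U)$ with $U\in L^2(s,T)$ and $(u,v)\in C([s,T];L^2([0,1])^2)$ the weak solution of $$u_t=-\epsilon_1u_x+c_1(x)v,\quad v_t=\epsilon_2v_x+c_2(x)u,\quad u(0,t)=qv(0,t),\quad v(1,t)=U(t),$$ $$u(\cdot,s)=u_0,\quad v(\cdot,s)=v_0.$$ It is optimal if it minimizes, among all trajectories on $[s,T]$ from $(u_0,v_0)$, $$J=\tfrac12\int_s^T\big[\langle u,Q_1(u)\rangle+\langle v,Q_2(v)\rangle+RU(t)^2\big]dt+\tfrac12\langle u(\cdot,T),P_{f1}(u(\cdot,T))\rangle+\tfrac12\langle v(\cdot,T),P_{f2}(v(\cdot,T))\rangle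 .$$ The co-states of $(u,v)$ on $[s,T]$ are the solutions $\lambda_1,\lambda_2$ ($C^1$ on $[0,1]\times[s,T]$) of $$-\lambda_{1t}=\epsilon_1\lambda_{1x}+c_2(x)\lambda_2+Q_1(u),\qquad -\lambda_{2t}=-\epsilon_2\lambda_{2x}+c_1(x)\lambda_1+Q_2(v),$$ $$\lambda_1(1,t)=0,\quad \lambda_2(0,t)=q\tfrac{\epsilon_1}{\epsilon_2}\lambda_1(0,t),\quad \lambda_1(\cdot,T)=P_{f1}(u(\cdot,T)),\quad \lambda_2(\cdot,T)=P_{f2}(v(\cdot,T)).$$ **Theorem.** Let $P_1,P_2$ be real kernels that are $C^1$ on $[0,1]^2\times[0,T]$. (1) The following are equivalent. (a) From every state $(u_0,v_0)\in L^2([0,1])^2$ at every time $s\in[0,T)$ there is an optimal trajectory, and every optimal trajectory $(u^*,v^*,U^*)$ has the co-states $$\lambda_1(x,t)=\int_0^1P_1(x,y,t)u^*(y,t)\,dy,\qquad \lambda_2(x,t)=\int_0^1P_2(x,y,t)v^*(y,t)\,dy .$$ (b) $(P_1,P_2)$ solves the differential algebraic Riccati equations $$-P_{2t}=-\frac{\epsilon_2^2}{R}P_2(x,1,t)P_2(1,y,t)-\epsilon_2P_{2y}-\epsilon_2P_{2x}+Q_2,\qquad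 -P_{1t}=\epsilon_1P_{1y}+\epsilon_1P_{1x}+Q_1,$$ $$c_1(y)P_1(x,y,t)+c_2(x)P_2(x,y,t)=0,\qquad c_1(x)P_1(x,y,t)+c_2(y)P_2(x,y,t)=0,$$ with boundary conditions $P_2(x,0,t)=P_2(0,y,t)=0$ and $P_1(x,1,t)=P_1(x,0,t)=P_1(1,y,t)=P_1(0,y,t)=0$, and final conditions $P_1(x,y,T)=P_{f1}(x,y)$, $P_2(x,y,T)=P_{f2}(x,y)$. (2) If $(P_1,P_2)$ solves the system in (b), then, for all $s\in[0,T)$ and $u_0,v_0\in L^2([0,1])$, a trajectory $(u^*,v^*,U^*)$ on $[s,T]$ from $(u_0,v_0)$ is optimal if and only if, for almost every $t\in[s,T]$, $$U^*(t)=-\frac{\epsilon_2}{R}\int_0^1P_2(1,y,t)\,v^*(y,t)\,dy .$$ -/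

import Mathlib

open MeasureTheory Set

noncomputable section

namespace HyperbolicLQR

/-- Lebesgue measure on the spatial domain `[0,1]`. -/
abbrev unitMeasure : Measure ℝ := volume.restrict (Icc (0 : ℝ) 1)

/-- The space `L²([0,1])` of real-valued functions. -/
abbrev L2 : Type := Lp ℝ 2 unitMeasure

/-- The integral operator with kernel `K`, `(K f)(x) = ∫₀¹ K(x,y) f(y) dy`. -/
def kernelOp (K : ℝ → ℝ → ℝ) (f : L2) (x : ℝ) : ℝ :=
  ∫ y, K x y * f y ∂unitMeasure

/-- The quadratic form `⟨f, K f⟩ = ∫₀¹ f(x) (K f)(x) dx`. -/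
def quadForm (K : ℝ → ℝ → ℝ) (f : L2) : ℝ :=
  ∫ x, f x * kernelOp K f x ∂unitMeasure

/-- A weighting kernel `K ≥ 0`: continuous and symmetric on `[0,1]²`, with a positive semidefinite
integral operator on `L²([0,1])`. -/
structure IsWeight (K : ℝ → ℝ → ℝ) : Prop where
  continuousOn : ContinuousOn (fun p : ℝ × ℝ => K p.1 p.2) (Icc (0 : ℝ) 1 ×ˢ Icc (0 : ℝ) 1)
  symm : ∀ x ∈ Icc (0 : ℝ) 1, ∀ y ∈ Icc (0 : ℝ) 1, K x y = K y x
  nonneg : ∀ f : L2, 0 ≤ quadForm K f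

/-- The data of the boundary control problem
`u_t = -ε₁ u_x + c₁ v`, `v_t = ε₂ v_x + c₂ u`, `u(0,t) = q v(0,t)`, `v(1,t) = U(t)`
with its quadratic cost, together with the standing assumptions on these data. -/
structure Problem where
  /-- the horizon -/
  T : ℝ
  ε₁ : ℝ
  ε₂ : ℝ
  q : ℝ
  c₁ : ℝ → ℝ
  c₂ : ℝ → ℝ
  /-- the weight of the control -/
  R : ℝ
  Q₁ : ℝ → ℝ → ℝ
  Q₂ : ℝ → ℝ → ℝ
  /-- the weights of the terminal states -/
  Pf₁ : ℝ → ℝ → ℝ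
  Pf₂ : ℝ → ℝ → ℝ
  T_pos : 0 < T
  ε₁_pos : 0 < ε₁
  ε₂_pos : 0 < ε₂
  q_ne_zero : q ≠ 0
  c₁_cont : ContinuousOn c₁ (Icc 0 1)
  c₂_cont : ContinuousOn c₂ (Icc 0 1)
  R_pos : 0 < R
  Q₁_weight : IsWeight Q₁
  Q₂_weight : IsWeight Q₂
  Pf₁_weight : IsWeight Pf₁
  Pf₂_weight : IsWeight Pf₂

/-- Test functions on `[0,1] × [s,T]` for the state equation: pairs of functions, `C¹` up to the
boundary, with the boundary conditions that remove the unknown traces `u(1,t)` and `v(0,t)`. -/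
structure IsTestPair (S : Problem) (s : ℝ) (φ ψ : ℝ → ℝ → ℝ) : Prop where
  contDiff_fst : ContDiffOn ℝ 1 (fun p : ℝ × ℝ => φ p.1 p.2) (Icc (0 : ℝ) 1 ×ˢ Icc s S.T)
  contDiff_snd : ContDiffOn ℝ 1 (fun p : ℝ × ℝ => ψ p.1 p.2) (Icc (0 : ℝ) 1 ×ˢ Icc s S.T)
  at_one : ∀ t ∈ Icc s S.T, φ 1 t = 0
  at_zero : ∀ t ∈ Icc s S.T, S.ε₂ * ψ 0 t = S.q * S.ε₁ * φ 0 t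

/-- `(u,v,U)` is a trajectory on `[s,T]` from the state `(u₀,v₀)` at time `s`: the control `U` is in
`L²(s,T)`, and `(u,v) ∈ C([s,T]; L²([0,1])²)` is the weak (`L²`) solution of
`u_t = -ε₁ u_x + c₁ v`, `v_t = ε₂ v_x + c₂ u`, `u(0,t) = q v(0,t)`, `v(1,t) = U(t)`,
`u(·,s) = u₀`, `v(·,s) = v₀`. -/
structure IsTrajectory (S : Problem) (s : ℝ) (u₀ v₀ : L2) (u v : ℝ → L2) (U : ℝ → ℝ) : Prop where
  control : MemLp U 2 (volume.restrict (Icc s S.T))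
  cont_u : ContinuousOn u (Icc s S.T)
  cont_v : ContinuousOn v (Icc s S.T)
  init_u : u s = u₀
  init_v : v s = v₀
  weak : ∀ φ ψ : ℝ → ℝ → ℝ, IsTestPair S s φ ψ → ∀ τ ∈ Icc s S.T,
    (∫ x, (u τ x * φ x τ + v τ x * ψ x τ) ∂unitMeasure)
        - (∫ x, (u₀ x * φ x s + v₀ x * ψ x s) ∂unitMeasure)
      = (∫ t in s..τ, ∫ x,
          (u t x * (deriv (fun t' => φ x t') t + S.ε₁ * deriv (fun x' => φ x' t) x
              + S.c₂ x * ψ x t)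
            + v t x * (deriv (fun t' => ψ x t') t - S.ε₂ * deriv (fun x' => ψ x' t) x
              + S.c₁ x * φ x t)) ∂unitMeasure)
        + ∫ t in s..τ, S.ε₂ * ψ 1 t * U t

/-- The quadratic cost on the horizon `[s,T]`. -/
def cost (S : Problem) (s : ℝ) (u v : ℝ → L2) (U : ℝ → ℝ) : ℝ :=
  1 / 2 * (∫ t in s..S.T, (quadForm S.Q₁ (u t) + quadForm S.Q₂ (v t) + S.R * U t ^ 2))
    + 1 / 2 * quadForm S.Pf₁ (u S.T) + 1 / 2 * quadForm S.Pf₂ (v S.T)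

/-- `(u,v,U)` is a trajectory on `[s,T]` from `(u₀,v₀)` of least cost. -/
def IsOptimal (S : Problem) (s : ℝ) (u₀ v₀ : L2) (u v : ℝ → L2) (U : ℝ → ℝ) : Prop :=
  IsTrajectory S s u₀ v₀ u v U ∧
    ∀ (u' v' : ℝ → L2) (U' : ℝ → ℝ), IsTrajectory S s u₀ v₀ u' v' U' →
      cost S s u v U ≤ cost S s u' v' U'

/-- `(l₁,l₂)`, as functions of `(x,t)`, are the co-states of the states `(u,v)` on `[s,T]`: the
solution, `C¹` up to the boundary, of the adjoint system
`-l₁_t = ε₁ l₁_x + c₂ l₂ + Q₁ u`, `-l₂_t = -ε₂ l₂_x + c₁ l₁ + Q₂ v`, `l₁(1,t) = 0`,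
`l₂(0,t) = q (ε₁/ε₂) l₁(0,t)`, `l₁(·,T) = Pf₁ u(T)`, `l₂(·,T) = Pf₂ v(T)`.
(The continuity of the `t`-derivatives is a consequence of the equations.) -/
structure IsCostate (S : Problem) (s : ℝ) (u v : ℝ → L2) (l₁ l₂ : ℝ → ℝ → ℝ) : Prop where
  cont₁ : ContinuousOn (fun p : ℝ × ℝ => l₁ p.1 p.2) (Icc (0 : ℝ) 1 ×ˢ Icc s S.T)
  cont₂ : ContinuousOn (fun p : ℝ × ℝ => l₂ p.1 p.2) (Icc (0 : ℝ) 1 ×ˢ Icc s S.T)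
  diff₁ : ∀ t ∈ Icc s S.T, DifferentiableOn ℝ (fun x => l₁ x t) (Icc 0 1)
  diff₂ : ∀ t ∈ Icc s S.T, DifferentiableOn ℝ (fun x => l₂ x t) (Icc 0 1)
  cont_dx₁ : ContinuousOn (fun p : ℝ × ℝ => derivWithin (fun x => l₁ x p.2) (Icc 0 1) p.1)
    (Icc (0 : ℝ) 1 ×ˢ Icc s S.T)
  cont_dx₂ : ContinuousOn (fun p : ℝ × ℝ => derivWithin (fun x => l₂ x p.2) (Icc 0 1) p.1)
    (Icc (0 : ℝ) 1 ×ˢ Icc s S.T)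
  eq₁ : ∀ x ∈ Icc (0 : ℝ) 1, ∀ t ∈ Icc s S.T,
    HasDerivWithinAt (fun t' => l₁ x t')
      (-(S.ε₁ * derivWithin (fun x' => l₁ x' t) (Icc 0 1) x + S.c₂ x * l₂ x t
        + kernelOp S.Q₁ (u t) x)) (Icc s S.T) t
  eq₂ : ∀ x ∈ Icc (0 : ℝ) 1, ∀ t ∈ Icc s S.T,
    HasDerivWithinAt (fun t' => l₂ x t')
      (-(-S.ε₂ * derivWithin (fun x' => l₂ x' t) (Icc 0 1) x + S.c₁ x * l₁ x t
        + kernelOp S.Q₂ (v t) x)) (Icc s S.T) t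
  at_one : ∀ t ∈ Icc s S.T, l₁ 1 t = 0
  at_zero : ∀ t ∈ Icc s S.T, l₂ 0 t = S.q * (S.ε₁ / S.ε₂) * l₁ 0 t
  final₁ : ∀ x ∈ Icc (0 : ℝ) 1, l₁ x S.T = kernelOp S.Pf₁ (u S.T) x
  final₂ : ∀ x ∈ Icc (0 : ℝ) 1, l₂ x S.T = kernelOp S.Pf₂ (v S.T) x

/-- The function `(x,t) ↦ ∫₀¹ P(x,y,t) w(y,t) dy` produced by a time-varying kernel `P`. -/
def applyKernel (P : ℝ → ℝ → ℝ → ℝ) (w : ℝ → L2) (x t : ℝ) : ℝ :=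
  kernelOp (fun x' y => P x' y t) (w t) x

/-- A time-varying kernel on `[0,1]² × [0,T]` that is `C¹` up to the boundary. -/
def IsC1Kernel (S : Problem) (P : ℝ → ℝ → ℝ → ℝ) : Prop :=
  ContDiffOn ℝ 1 (fun p : ℝ × ℝ × ℝ => P p.1 p.2.1 p.2.2)
    (Icc (0 : ℝ) 1 ×ˢ Icc (0 : ℝ) 1 ×ˢ Icc 0 S.T)

/-- `(P₁,P₂)` solves the system of differential algebraic Riccati equations. -/
structure IsRiccatiSolution (S : Problem) (P₁ P₂ : ℝ → ℝ → ℝ → ℝ) : Prop where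
  eq₂ : ∀ x ∈ Ioo (0 : ℝ) 1, ∀ y ∈ Ioo (0 : ℝ) 1, ∀ t ∈ Ioo 0 S.T,
    -deriv (fun t' => P₂ x y t') t
      = -(S.ε₂ ^ 2 / S.R) * P₂ x 1 t * P₂ 1 y t
        - S.ε₂ * deriv (fun y' => P₂ x y' t) y - S.ε₂ * deriv (fun x' => P₂ x' y t) x + S.Q₂ x y
  eq₁ : ∀ x ∈ Ioo (0 : ℝ) 1, ∀ y ∈ Ioo (0 : ℝ) 1, ∀ t ∈ Ioo 0 S.T,
    -deriv (fun t' => P₁ x y t') t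
      = S.ε₁ * deriv (fun y' => P₁ x y' t) y + S.ε₁ * deriv (fun x' => P₁ x' y t) x + S.Q₁ x y
  /-- kernel form of the operator identity `P₁ ∘ c₁ + c₂ ∘ P₂ = 0` -/
  algebraic : ∀ x ∈ Icc (0 : ℝ) 1, ∀ y ∈ Icc (0 : ℝ) 1, ∀ t ∈ Icc 0 S.T,
    S.c₁ y * P₁ x y t + S.c₂ x * P₂ x y t = 0
  /-- kernel form of the operator identity `c₁ ∘ P₁ + P₂ ∘ c₂ = 0` -/
  algebraic' : ∀ x ∈ Icc (0 : ℝ) 1, ∀ y ∈ Icc (0 : ℝ) 1, ∀ t ∈ Icc 0 S.T,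
    S.c₁ x * P₁ x y t + S.c₂ y * P₂ x y t = 0
  P₂_right_zero : ∀ x ∈ Icc (0 : ℝ) 1, ∀ t ∈ Icc 0 S.T, P₂ x 0 t = 0
  P₁_right_one : ∀ x ∈ Icc (0 : ℝ) 1, ∀ t ∈ Icc 0 S.T, P₁ x 1 t = 0
  P₁_right_zero : ∀ x ∈ Icc (0 : ℝ) 1, ∀ t ∈ Icc 0 S.T, P₁ x 0 t = 0
  P₁_left_one : ∀ y ∈ Icc (0 : ℝ) 1, ∀ t ∈ Icc 0 S.T, P₁ 1 y t = 0
  P₁_left_zero : ∀ y ∈ Icc (0 : ℝ) 1, ∀ t ∈ Icc 0 S.T, P₁ 0 y t = 0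
  P₂_left_zero : ∀ y ∈ Icc (0 : ℝ) 1, ∀ t ∈ Icc 0 S.T, P₂ 0 y t = 0
  final₁ : ∀ x ∈ Icc (0 : ℝ) 1, ∀ y ∈ Icc (0 : ℝ) 1, P₁ x y S.T = S.Pf₁ x y
  final₂ : ∀ x ∈ Icc (0 : ℝ) 1, ∀ y ∈ Icc (0 : ℝ) 1, P₂ x y S.T = S.Pf₂ x y

/-- The co-states are the integral operators `P₁`, `P₂` applied to the optimal states: from every
state at every time `s < T` there is an optimal trajectory, and every optimal trajectory
`(u,v,U)` has the co-states `P₁ u` and `P₂ v`. -/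
def RepresentsCostates (S : Problem) (P₁ P₂ : ℝ → ℝ → ℝ → ℝ) : Prop :=
  ∀ s ∈ Ico 0 S.T, ∀ u₀ v₀ : L2,
    (∃ (u v : ℝ → L2) (U : ℝ → ℝ), IsOptimal S s u₀ v₀ u v U) ∧
    ∀ (u v : ℝ → L2) (U : ℝ → ℝ), IsOptimal S s u₀ v₀ u v U →
      IsCostate S s u v (applyKernel P₁ u) (applyKernel P₂ v)

end HyperbolicLQR

end

open HyperbolicLQR

/-!
The proof is a linear-quadratic argument in the weak formulation. The cost is half of the diagonal of
a symmetric bilinear form `crossCost` on trajectories, and the co-states are an admissible pair of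
test functions, so that Green's formula `IsCostate.crossCost_eq` expresses the derivative of the cost
in the direction of a trajectory by the initial co-states and by `R U + ε₂ λ₂(1,·)`. As the remainder
is at least `R/2 ∫ (U' - U)²`, the extremal control `U = -(ε₂/R) λ₂(1,·)` is optimal and the only
optimal one (`IsCostate.cost_add_le`, `IsCostate.control_unique`); conversely an optimal control is
extremal (`IsOptimal.isExtremalControl`).

If `(P₁, P₂)` solves the Riccati equations, the slices `P₁(x,·,·)` and `P₂(x,·,·)` are admissible test
functions thanks to the boundary conditions in `y`. Testing with them gives the time derivatives of
`P₁ u` and `P₂ v` along a trajectory with the feedback control, and the Riccati equations turn these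
derivatives into the co-state equations (`IsRiccatiSolution.isCostate`). The closed loop has a solution
(`exists_closed_loop`), which is therefore optimal, and uniqueness of the optimal control and of the
state identifies the optimal trajectories (`IsRiccatiSolution.isOptimal_iff`).

If `(P₁, P₂)` represents the co-states, then at the initial time `s` the state is arbitrary in
`L²([0,1])²`, so that each relation between co-states at that time becomes an identity of kernels. The
boundary conditions of the co-states give those of the kernels in `x`
(`RepresentsCostates.left_zero`); the symmetry of `crossCost` makes the kernels symmetric
(`RepresentsCostates.kernel_symm`), hence the boundary conditions hold in `y` as well, the time
derivatives of `P₁ u` and `P₂ v` can be computed as before, and comparison with the co-state equations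
gives the differential and the algebraic equations. The final conditions follow from trajectories that
start shortly before `T`, whose final states converge weakly to the initial state
(`inner_eq_zero_of_terminal`).

All this rests on the well-posedness of the state equation. Uniqueness and uniform bounds come from an
energy estimate by duality with explicit solutions of the uncoupled adjoint equation and Gronwall's
inequality (`exists_energy_estimate`). For existence (`exists_trajectory`), the two components are
placed on one line in a travel time coordinate, which uses `q ≠ 0`; without coupling the evolution is
then the translation of `L²(ℝ)`, with the control written on the line upstream of the state, and the
coupling and a linear feedback are added by a fixed point argument of Volterra type.
-/

noncomputable section

namespace HyperbolicLQR

open Filter Topology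

/-! ### Continuous functions on `[0,1]` as elements of `L²([0,1])` -/

open Classical in
/-- The class in `L²([0,1])` of a square integrable function on `[0,1]`; the value is `0` when the
function is not square integrable. -/
def toL2 (g : ℝ → ℝ) : L2 := if h : MemLp g 2 unitMeasure then h.toLp g else 0

instance : IsProbabilityMeasure unitMeasure := ⟨by simp⟩

lemma ae_unitMeasure_mem : ∀ᵐ x ∂unitMeasure, x ∈ Icc (0 : ℝ) 1 :=
  ae_restrict_mem measurableSet_Icc

lemma ae_unitMeasure_mem_Ioo : ∀ᵐ x ∂unitMeasure, x ∈ Ioo (0 : ℝ) 1 := by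
  rw [unitMeasure, Measure.restrict_congr_set Ioo_ae_eq_Icc.symm]
  exact ae_restrict_mem measurableSet_Ioo

lemma memLp_of_continuousOn {g : ℝ → ℝ} (hg : ContinuousOn g (Icc 0 1)) :
    MemLp g 2 unitMeasure := by
  obtain ⟨C, hC⟩ := isCompact_Icc.exists_bound_of_continuousOn hg
  refine MemLp.of_bound (hg.aestronglyMeasurable measurableSet_Icc) C ?_
  filter_upwards [ae_unitMeasure_mem] with x hx using hC x hx

lemma coeFn_toL2 {g : ℝ → ℝ} (hg : ContinuousOn g (Icc 0 1)) : toL2 g =ᵐ[unitMeasure] g := by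
  rw [toL2, dif_pos (memLp_of_continuousOn hg)]
  exact MemLp.coeFn_toLp _

lemma inner_eq_integral (f g : L2) : inner ℝ f g = ∫ x, f x * g x ∂unitMeasure := by
  rw [L2.inner_def]; simp [mul_comm]

lemma inner_toL2 {g : ℝ → ℝ} (hg : ContinuousOn g (Icc 0 1)) (w : L2) :
    inner ℝ (toL2 g) w = ∫ x, g x * w x ∂unitMeasure := by
  rw [inner_eq_integral]
  refine integral_congr_ae ?_
  filter_upwards [coeFn_toL2 hg] with x hx
  rw [hx]

lemma integrable_mul_coeFn {g : ℝ → ℝ} (hg : ContinuousOn g (Icc 0 1)) (w : L2) :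
    Integrable (fun x => w x * g x) unitMeasure :=
  MemLp.integrable_mul (p := 2) (q := 2) (Lp.memLp w) (memLp_of_continuousOn hg)

lemma norm_le_of_ae_bound {f : L2} {C : ℝ} (hC : 0 ≤ C) (h : ∀ᵐ x ∂unitMeasure, ‖f x‖ ≤ C) :
    ‖f‖ ≤ C := by
  have := Lp.norm_le_of_ae_bound hC h
  simpa [measureUnivNNReal] using this

lemma norm_toL2_le {g : ℝ → ℝ} (hg : ContinuousOn g (Icc 0 1)) {C : ℝ} (hC : 0 ≤ C)
    (h : ∀ x ∈ Icc (0 : ℝ) 1, |g x| ≤ C) : ‖toL2 g‖ ≤ C := by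
  refine norm_le_of_ae_bound hC ?_
  filter_upwards [coeFn_toL2 hg, ae_unitMeasure_mem] with x hx hx'
  rw [hx]; exact h x hx'

lemma norm_toL2_sq {g : ℝ → ℝ} (hg : ContinuousOn g (Icc 0 1)) :
    ‖toL2 g‖ ^ 2 = ∫ x in Icc (0 : ℝ) 1, g x ^ 2 := by
  rw [← real_inner_self_eq_norm_sq, inner_toL2 hg]
  refine integral_congr_ae ?_
  filter_upwards [coeFn_toL2 hg] with x hx
  rw [hx, sq]

lemma toL2_congr {f g : ℝ → ℝ} (h : EqOn f g (Icc 0 1)) : toL2 f = toL2 g := by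
  have h' : f =ᵐ[unitMeasure] g := by
    filter_upwards [ae_unitMeasure_mem] with x hx using h hx
  by_cases hf : MemLp f 2 unitMeasure
  · rw [toL2, toL2, dif_pos hf, dif_pos ((memLp_congr_ae h').1 hf)]
    exact (MemLp.toLp_eq_toLp_iff _ _).2 h'
  · rw [toL2, toL2, dif_neg hf, dif_neg (fun hg => hf ((memLp_congr_ae h').2 hg))]

lemma toL2_add {f g : ℝ → ℝ} (hf : ContinuousOn f (Icc 0 1)) (hg : ContinuousOn g (Icc 0 1)) :
    toL2 (fun x => f x + g x) = toL2 f + toL2 g := by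
  apply Lp.ext
  filter_upwards [coeFn_toL2 (hf.add hg), coeFn_toL2 hf, coeFn_toL2 hg,
    Lp.coeFn_add (toL2 f) (toL2 g)] with x h1 h2 h3 h4
  rw [h4, Pi.add_apply, h2, h3]; exact h1

lemma toL2_const_mul {g : ℝ → ℝ} (c : ℝ) (hg : ContinuousOn g (Icc 0 1)) :
    toL2 (fun x => c * g x) = c • toL2 g := by
  apply Lp.ext
  filter_upwards [coeFn_toL2 (g := fun x => c * g x) (continuousOn_const.mul hg),
    coeFn_toL2 hg, Lp.coeFn_smul c (toL2 g)] with x h1 h2 h3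
  rw [h3, Pi.smul_apply, h2, h1, smul_eq_mul]

lemma toL2_zero : toL2 (fun _ => (0 : ℝ)) = 0 := by
  have := toL2_const_mul (g := fun _ => 0) 0 continuousOn_const
  simpa using this

lemma toL2_sub {f g : ℝ → ℝ} (hf : ContinuousOn f (Icc 0 1)) (hg : ContinuousOn g (Icc 0 1)) :
    toL2 (fun x => f x - g x) = toL2 f - toL2 g := by
  have h := toL2_add (g := fun x => (-1 : ℝ) * g x) hf (continuousOn_const.mul hg)
  rw [toL2_const_mul (-1) hg] at h
  rw [sub_eq_add_neg, ← neg_one_smul ℝ (toL2 g), ← h]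
  exact toL2_congr fun _ _ => by ring

lemma eqOn_zero_of_toL2_eq_zero {g : ℝ → ℝ} (hg : ContinuousOn g (Icc 0 1)) (h : toL2 g = 0) :
    ∀ x ∈ Icc (0 : ℝ) 1, g x = 0 := by
  have h0 : g =ᵐ[volume.restrict (Icc (0 : ℝ) 1)] fun _ => 0 := by
    filter_upwards [coeFn_toL2 hg, Lp.coeFn_zero ℝ 2 unitMeasure] with x h1 h2
    rw [← h1, h, h2]; rfl
  exact Measure.eqOn_Icc_of_ae_eq volume zero_ne_one h0 hg continuousOn_const

lemma eqOn_zero_of_inner_eq_zero {g : ℝ → ℝ} (hg : ContinuousOn g (Icc 0 1))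
    (h : ∀ w : L2, inner ℝ (toL2 g) w = 0) : ∀ x ∈ Icc (0 : ℝ) 1, g x = 0 :=
  eqOn_zero_of_toL2_eq_zero hg (inner_self_eq_zero.1 (h (toL2 g)))

/-- A jointly continuous family of functions is continuous as a family in `L²([0,1])`, as it is
locally uniformly continuous in the parameter. -/
lemma continuousOn_toL2 {X : Type*} [TopologicalSpace X] {K : X → ℝ → ℝ} {s : Set X}
    (hK : ContinuousOn (Function.uncurry K) (s ×ˢ Icc (0 : ℝ) 1)) :
    ContinuousOn (fun p => toL2 (K p)) s := by
  have hK' : ∀ p ∈ s, ContinuousOn (K p) (Icc 0 1) := fun p hp =>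
    hK.comp (Continuous.prodMk_right p).continuousOn fun y hy => ⟨hp, hy⟩
  intro q hq
  rw [ContinuousWithinAt, Metric.tendsto_nhds]
  intro ε hε
  obtain ⟨v, hv, hv'⟩ := isCompact_Icc.mem_uniformity_of_prod hK hq
    (Metric.dist_mem_uniformity (half_pos hε))
  filter_upwards [hv, self_mem_nhdsWithin] with p hp hps
  rw [dist_eq_norm, ← toL2_sub (hK' p hps) (hK' q hq)]
  refine (norm_toL2_le ((hK' p hps).sub (hK' q hq)) (half_pos hε).le fun x hx => ?_).trans_lt
    (half_lt_self hε)
  exact (hv' p hp x hx).le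

/-- Smooth functions with compact support in `(0,1)` are dense in `L²([0,1])`. -/
lemma dense_toL2_contDiff : Dense {h : L2 | ∃ g : ℝ → ℝ, ContDiff ℝ (⊤ : ℕ∞) g ∧
    HasCompactSupport g ∧ tsupport g ⊆ Ioo (0 : ℝ) 1 ∧ h = toL2 g} := by
  let V : Submodule ℝ L2 :=
    { carrier := {h | ∃ g : ℝ → ℝ, ContDiff ℝ (⊤ : ℕ∞) g ∧ HasCompactSupport g ∧
        tsupport g ⊆ Ioo (0 : ℝ) 1 ∧ h = toL2 g}
      zero_mem' := by
        refine ⟨fun _ => 0, contDiff_const, HasCompactSupport.zero, ?_, ?_⟩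
        · rw [show (fun _ : ℝ => (0 : ℝ)) = 0 from rfl, tsupport_eq_empty_iff.2 rfl]
          exact empty_subset _
        · exact toL2_zero.symm
      add_mem' := by
        rintro _ _ ⟨g, hg, hc, hs, rfl⟩ ⟨g', hg', hc', hs', rfl⟩
        refine ⟨fun x => g x + g' x, hg.add hg', hc.add hc', ?_, ?_⟩
        · exact (tsupport_add g g').trans (union_subset hs hs')
        · exact (toL2_add hg.continuous.continuousOn hg'.continuous.continuousOn).symm
      smul_mem' := by
        rintro c _ ⟨g, hg, hc, hs, rfl⟩
        refine ⟨fun x => c * g x, contDiff_const.mul hg, hc.mul_left, ?_, ?_⟩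
        · exact (tsupport_mul_subset_right (f := fun _ => c) (g := g)).trans hs
        · exact (toL2_const_mul c hg.continuous.continuousOn).symm }
  -- an element orthogonal to all these functions vanishes as a distribution on `(0,1)`
  have hV : Vᗮ = ⊥ := by
    rw [eq_bot_iff]
    intro w hw
    rw [Submodule.mem_orthogonal] at hw
    have hloc : LocallyIntegrable (w : ℝ → ℝ) unitMeasure :=
      ((Lp.memLp w).integrable one_le_two).locallyIntegrable
    have := IsOpen.ae_eq_zero_of_integral_contDiff_smul_eq_zero (U := Ioo (0 : ℝ) 1)
      (μ := unitMeasure) (f := w) isOpen_Ioo (hloc.locallyIntegrableOn _) fun g hg hc hs => by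
        have h := hw _ ⟨g, hg, hc, hs, rfl⟩
        rwa [inner_toL2 hg.continuous.continuousOn] at h
    refine (Submodule.mem_bot ℝ).2 ((Lp.eq_zero_iff_ae_eq_zero).2 ?_)
    filter_upwards [this, ae_unitMeasure_mem_Ioo] with x h1 h2 using h1 h2
  have hd := (Submodule.topologicalClosure_eq_top_iff (K := V)).2 hV
  exact (Submodule.dense_iff_topologicalClosure_eq_top (s := V)).2 hd

/-! ### Integral operators and multiplication operators on `L²([0,1])` -/

lemma kernel_slice {K : ℝ → ℝ → ℝ}
    (hK : ContinuousOn (fun p : ℝ × ℝ => K p.1 p.2) (Icc (0 : ℝ) 1 ×ˢ Icc (0 : ℝ) 1))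
    {x : ℝ} (hx : x ∈ Icc (0 : ℝ) 1) : ContinuousOn (K x) (Icc 0 1) :=
  hK.comp (Continuous.prodMk_right x).continuousOn fun _ hy => ⟨hx, hy⟩

lemma kernelOp_eq_inner {K : ℝ → ℝ → ℝ} {x : ℝ} (hK : ContinuousOn (K x) (Icc 0 1)) (f : L2) :
    kernelOp K f x = inner ℝ (toL2 (K x)) f :=
  (inner_toL2 hK f).symm

lemma continuousOn_kernelOp {K : ℝ → ℝ → ℝ}
    (hK : ContinuousOn (fun p : ℝ × ℝ => K p.1 p.2) (Icc (0 : ℝ) 1 ×ˢ Icc (0 : ℝ) 1)) (f : L2) :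
    ContinuousOn (kernelOp K f) (Icc 0 1) :=
  ((continuousOn_toL2 hK).inner continuousOn_const).congr fun _ hx =>
    kernelOp_eq_inner (kernel_slice hK hx) f

lemma exists_kernel_bound {K : ℝ → ℝ → ℝ}
    (hK : ContinuousOn (fun p : ℝ × ℝ => K p.1 p.2) (Icc (0 : ℝ) 1 ×ˢ Icc (0 : ℝ) 1)) :
    ∃ C, 0 ≤ C ∧ ∀ (f : L2), ∀ x ∈ Icc (0 : ℝ) 1, |kernelOp K f x| ≤ C * ‖f‖ := by
  obtain ⟨C, hC⟩ := isCompact_Icc.exists_bound_of_continuousOn (continuousOn_toL2 hK)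
  refine ⟨C, (norm_nonneg _).trans (hC 0 (by simp)), fun f x hx => ?_⟩
  rw [kernelOp_eq_inner (kernel_slice hK hx)]
  exact (abs_real_inner_le_norm _ _).trans
    (mul_le_mul_of_nonneg_right (hC x hx) (norm_nonneg _))

/-- The integral operator with a continuous kernel, as a bounded operator on `L²([0,1])`. -/
def kerL2 (K : ℝ → ℝ → ℝ)
    (hK : ContinuousOn (fun p : ℝ × ℝ => K p.1 p.2) (Icc (0 : ℝ) 1 ×ˢ Icc (0 : ℝ) 1)) :
    L2 →L[ℝ] L2 :=
  LinearMap.mkContinuousOfExistsBound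
    { toFun := fun f => toL2 (kernelOp K f)
      map_add' := fun f g => by
        rw [← toL2_add (continuousOn_kernelOp hK f) (continuousOn_kernelOp hK g)]
        refine toL2_congr fun x hx => ?_
        simp only [kernelOp_eq_inner (kernel_slice hK hx), inner_add_right]
      map_smul' := fun c f => by
        rw [RingHom.id_apply, ← toL2_const_mul c (continuousOn_kernelOp hK f)]
        refine toL2_congr fun x hx => ?_
        simp only [kernelOp_eq_inner (kernel_slice hK hx), inner_smul_right] }
    (by
      obtain ⟨C, hC, h⟩ := exists_kernel_bound hK
      exact ⟨C, fun f => norm_toL2_le (continuousOn_kernelOp hK f) (by positivity) (h f)⟩)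

lemma kerL2_apply {K : ℝ → ℝ → ℝ}
    (hK : ContinuousOn (fun p : ℝ × ℝ => K p.1 p.2) (Icc (0 : ℝ) 1 ×ˢ Icc (0 : ℝ) 1)) (f : L2) :
    kerL2 K hK f = toL2 (kernelOp K f) := rfl

lemma quadForm_eq_inner {K : ℝ → ℝ → ℝ}
    (hK : ContinuousOn (fun p : ℝ × ℝ => K p.1 p.2) (Icc (0 : ℝ) 1 ×ˢ Icc (0 : ℝ) 1)) (f : L2) :
    quadForm K f = inner ℝ (kerL2 K hK f) f := by
  rw [kerL2_apply, inner_toL2 (continuousOn_kernelOp hK f), quadForm]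
  simp only [mul_comm]

lemma inner_kerL2_transpose {K : ℝ → ℝ → ℝ}
    (hK : ContinuousOn (fun p : ℝ × ℝ => K p.1 p.2) (Icc (0 : ℝ) 1 ×ˢ Icc (0 : ℝ) 1))
    (hK' : ContinuousOn (fun p : ℝ × ℝ => K p.2 p.1) (Icc (0 : ℝ) 1 ×ˢ Icc (0 : ℝ) 1))
    (f g : L2) : inner ℝ (kerL2 K hK f) g = inner ℝ (kerL2 (fun x y => K y x) hK' g) f := by
  rw [kerL2_apply, kerL2_apply, inner_toL2 (continuousOn_kernelOp hK f),
    inner_toL2 (continuousOn_kernelOp hK' g)]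
  simp only [kernelOp, ← integral_mul_const]
  rw [integral_integral_swap]
  · refine integral_congr_ae (.of_forall fun _ => ?_)
    exact integral_congr_ae (.of_forall fun _ => by ring)
  · obtain ⟨C, hC⟩ := (isCompact_Icc.prod isCompact_Icc).exists_bound_of_continuousOn hK
    have h1 : Integrable (fun p : ℝ × ℝ => g p.1 * f p.2) (unitMeasure.prod unitMeasure) :=
      ((Lp.memLp g).integrable one_le_two).mul_prod ((Lp.memLp f).integrable one_le_two)
    have hm : unitMeasure.prod unitMeasure
        = (volume.prod volume).restrict (Icc (0 : ℝ) 1 ×ˢ Icc (0 : ℝ) 1) :=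
      Measure.prod_restrict _ _
    have h2 : AEStronglyMeasurable (fun p : ℝ × ℝ => K p.1 p.2) (unitMeasure.prod unitMeasure) := by
      rw [hm]
      exact hK.aestronglyMeasurable (measurableSet_Icc.prod measurableSet_Icc)
    have h3 := h1.bdd_mul h2 (c := C) (by
      rw [hm]
      filter_upwards [ae_restrict_mem (measurableSet_Icc.prod measurableSet_Icc)] with p hp
      exact hC p hp)
    exact h3.congr (.of_forall fun p => by simp only [Function.uncurry]; ring)

lemma memLp_continuousOn_mul {c : ℝ → ℝ} (hc : ContinuousOn c (Icc 0 1)) (f : L2) :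
    MemLp (fun x => c x * f x) 2 unitMeasure := by
  obtain ⟨C, hC⟩ := isCompact_Icc.exists_bound_of_continuousOn hc
  refine (Lp.memLp f).of_le_mul (c := C)
    ((hc.aestronglyMeasurable measurableSet_Icc).mul (Lp.aestronglyMeasurable f)) ?_
  filter_upwards [ae_unitMeasure_mem] with x hx
  rw [norm_mul]
  exact mul_le_mul_of_nonneg_right (hC x hx) (norm_nonneg _)

/-- Multiplication by a continuous function, as a bounded operator on `L²([0,1])`. -/
def mulL2 (c : ℝ → ℝ) (hc : ContinuousOn c (Icc 0 1)) : L2 →L[ℝ] L2 :=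
  LinearMap.mkContinuousOfExistsBound
    { toFun := fun f => (memLp_continuousOn_mul hc f).toLp _
      map_add' := fun f g => by
        rw [← MemLp.toLp_add, MemLp.toLp_eq_toLp_iff]
        filter_upwards [Lp.coeFn_add f g] with x hx
        rw [hx]; simp [mul_add]
      map_smul' := fun a f => by
        rw [RingHom.id_apply, ← MemLp.toLp_const_smul, MemLp.toLp_eq_toLp_iff]
        filter_upwards [Lp.coeFn_smul a f] with x hx
        rw [hx]; simp only [Pi.smul_apply, smul_eq_mul]; ring }
    (by
      obtain ⟨C, hC⟩ := isCompact_Icc.exists_bound_of_continuousOn hc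
      refine ⟨C, fun f => Lp.norm_le_mul_norm_of_ae_le_mul ?_⟩
      filter_upwards [(memLp_continuousOn_mul hc f).coeFn_toLp, ae_unitMeasure_mem] with x hx hx'
      simp only [LinearMap.coe_mk, AddHom.coe_mk, hx, norm_mul]
      exact mul_le_mul_of_nonneg_right (hC x hx') (norm_nonneg _))

lemma coeFn_mulL2 {c : ℝ → ℝ} (hc : ContinuousOn c (Icc 0 1)) (f : L2) :
    mulL2 c hc f =ᵐ[unitMeasure] fun x => c x * f x :=
  (memLp_continuousOn_mul hc f).coeFn_toLp

lemma inner_mulL2 {c g : ℝ → ℝ} (hc : ContinuousOn c (Icc 0 1)) (hg : ContinuousOn g (Icc 0 1))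
    (f : L2) : inner ℝ (mulL2 c hc f) (toL2 g) = inner ℝ f (toL2 fun x => c x * g x) := by
  rw [inner_eq_integral, inner_eq_integral]
  refine integral_congr_ae ?_
  filter_upwards [coeFn_mulL2 hc f, coeFn_toL2 hg,
    coeFn_toL2 (g := fun x => c x * g x) (hc.mul hg)] with x h1 h2 h3
  rw [h1, h2, h3]; ring

/-! ### Functions of class `C¹` on closed rectangles and cubes -/

/-- `f` is `C¹` up to the boundary on `[0,1] × [a,b]`, with one-sided partial derivatives `fx` and
`ft`. -/
structure IsC1Rect (a b : ℝ) (f fx ft : ℝ → ℝ → ℝ) : Prop where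
  cont : ContinuousOn (fun p : ℝ × ℝ => f p.1 p.2) (Icc (0 : ℝ) 1 ×ˢ Icc a b)
  cont_dx : ContinuousOn (fun p : ℝ × ℝ => fx p.1 p.2) (Icc (0 : ℝ) 1 ×ˢ Icc a b)
  cont_dt : ContinuousOn (fun p : ℝ × ℝ => ft p.1 p.2) (Icc (0 : ℝ) 1 ×ˢ Icc a b)
  dx : ∀ x ∈ Icc (0 : ℝ) 1, ∀ t ∈ Icc a b,
    HasDerivWithinAt (fun x' => f x' t) (fx x t) (Icc 0 1) x
  dt : ∀ x ∈ Icc (0 : ℝ) 1, ∀ t ∈ Icc a b,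
    HasDerivWithinAt (fun t' => f x t') (ft x t) (Icc a b) t

lemma slice_left {a b : ℝ} {f : ℝ → ℝ → ℝ}
    (h : ContinuousOn (fun p : ℝ × ℝ => f p.1 p.2) (Icc (0 : ℝ) 1 ×ˢ Icc a b))
    {t : ℝ} (ht : t ∈ Icc a b) : ContinuousOn (fun x => f x t) (Icc 0 1) :=
  h.comp (Continuous.prodMk_left t).continuousOn fun _ hx => ⟨hx, ht⟩

lemma slice_right {a b : ℝ} {f : ℝ → ℝ → ℝ}
    (h : ContinuousOn (fun p : ℝ × ℝ => f p.1 p.2) (Icc (0 : ℝ) 1 ×ˢ Icc a b))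
    {x : ℝ} (hx : x ∈ Icc (0 : ℝ) 1) : ContinuousOn (fun t => f x t) (Icc a b) :=
  h.comp (Continuous.prodMk_right x).continuousOn fun _ ht => ⟨hx, ht⟩

lemma continuousOn_toL2_slice {a b : ℝ} {f : ℝ → ℝ → ℝ}
    (h : ContinuousOn (fun p : ℝ × ℝ => f p.1 p.2) (Icc (0 : ℝ) 1 ×ˢ Icc a b)) :
    ContinuousOn (fun t => toL2 fun x => f x t) (Icc a b) :=
  continuousOn_toL2 (K := fun t x => f x t)
    (h.comp continuous_swap.continuousOn fun _ hp => ⟨hp.2, hp.1⟩)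

namespace IsC1Rect

variable {a b : ℝ} {f fx ft : ℝ → ℝ → ℝ}

lemma deriv_x (h : IsC1Rect a b f fx ft) {x t : ℝ} (hx : x ∈ Ioo (0 : ℝ) 1) (ht : t ∈ Icc a b) :
    deriv (fun x' => f x' t) x = fx x t :=
  ((h.dx x (Ioo_subset_Icc_self hx) t ht).hasDerivAt (Icc_mem_nhds hx.1 hx.2)).deriv

lemma deriv_t (h : IsC1Rect a b f fx ft) {x t : ℝ} (hx : x ∈ Icc (0 : ℝ) 1) (ht : t ∈ Ioo a b) :
    deriv (fun t' => f x t') t = ft x t :=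
  ((h.dt x hx t (Ioo_subset_Icc_self ht)).hasDerivAt (Icc_mem_nhds ht.1 ht.2)).deriv

lemma mono (h : IsC1Rect a b f fx ft) {a' b' : ℝ} (ha : a ≤ a') (hb : b' ≤ b) :
    IsC1Rect a' b' f fx ft where
  cont := h.cont.mono (prod_mono_right (Icc_subset_Icc ha hb))
  cont_dx := h.cont_dx.mono (prod_mono_right (Icc_subset_Icc ha hb))
  cont_dt := h.cont_dt.mono (prod_mono_right (Icc_subset_Icc ha hb))
  dx x hx t ht := h.dx x hx t (Icc_subset_Icc ha hb ht)
  dt x hx t ht := (h.dt x hx t (Icc_subset_Icc ha hb ht)).mono (Icc_subset_Icc ha hb)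

/-- Continuous partial derivatives up to the boundary give a Fréchet derivative up to the
boundary, by the mean value inequality along each coordinate. -/
lemma hasFDerivWithinAt (h : IsC1Rect a b f fx ft) {p : ℝ × ℝ}
    (hp : p ∈ Icc (0 : ℝ) 1 ×ˢ Icc a b) :
    HasFDerivWithinAt (fun p : ℝ × ℝ => f p.1 p.2)
      (fx p.1 p.2 • ContinuousLinearMap.fst ℝ ℝ ℝ + ft p.1 p.2 • ContinuousLinearMap.snd ℝ ℝ ℝ)
      (Icc (0 : ℝ) 1 ×ˢ Icc a b) p := by
  obtain ⟨x, t⟩ := p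
  obtain ⟨hx, ht⟩ : x ∈ Icc (0 : ℝ) 1 ∧ t ∈ Icc a b := hp
  rw [hasFDerivWithinAt_iff_isLittleO, Asymptotics.isLittleO_iff]
  intro ε hε
  have hc := Metric.continuousWithinAt_iff.1 (h.cont_dx (x, t) ⟨hx, ht⟩) (ε / 2) (by positivity)
  have hd := Metric.continuousWithinAt_iff.1 (h.cont_dt (x, t) ⟨hx, ht⟩) (ε / 2) (by positivity)
  obtain ⟨δ₁, hδ₁, hc⟩ := hc
  obtain ⟨δ₂, hδ₂, hd⟩ := hd
  have hmem : Metric.ball (x, t) (min δ₁ δ₂) ∩ (Icc (0 : ℝ) 1 ×ˢ Icc a b)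
      ∈ 𝓝[Icc (0 : ℝ) 1 ×ˢ Icc a b] (x, t) :=
    by
    rw [inter_comm]
    exact inter_mem_nhdsWithin _ (Metric.ball_mem_nhds _ (lt_min hδ₁ hδ₂))
  filter_upwards [hmem]
  rintro ⟨x', t'⟩ ⟨hb, hx', ht'⟩
  simp only at hx' ht'
  rw [Metric.mem_ball, Prod.dist_eq, max_lt_iff, lt_min_iff, lt_min_iff] at hb
  simp only at hb
  have e1 : ‖(f x' t' - fx x t * x') - (f x t' - fx x t * x)‖ ≤ ε / 2 * ‖x' - x‖ := by
    refine Convex.norm_image_sub_le_of_norm_hasDerivWithin_le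
      (f := fun z => f z t' - fx x t * z) (f' := fun z => fx z t' - fx x t)
      (s := Icc 0 1 ∩ Metric.ball x δ₁) (fun z hz => ?_) (fun z hz => ?_)
      ((convex_Icc 0 1).inter (convex_ball x δ₁)) ⟨hx, Metric.mem_ball_self hδ₁⟩ ⟨hx', hb.1.1⟩
    · have := ((h.dx z hz.1 t' ht').mono inter_subset_left).fun_sub
        (((hasDerivAt_id z).const_mul (fx x t)).hasDerivWithinAt (s := Icc 0 1 ∩ Metric.ball x δ₁))
      simpa using this
    · refine (hc (x := (z, t')) ⟨hz.1, ht'⟩ ?_).le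
      rw [Prod.dist_eq]; exact max_lt hz.2 hb.2.1
  have e2 : ‖(f x t' - ft x t * t') - (f x t - ft x t * t)‖ ≤ ε / 2 * ‖t' - t‖ := by
    refine Convex.norm_image_sub_le_of_norm_hasDerivWithin_le
      (f := fun z => f x z - ft x t * z) (f' := fun z => ft x z - ft x t)
      (s := Icc a b ∩ Metric.ball t δ₂) (fun z hz => ?_) (fun z hz => ?_)
      ((convex_Icc a b).inter (convex_ball t δ₂)) ⟨ht, Metric.mem_ball_self hδ₂⟩ ⟨ht', hb.2.2⟩
    · have := ((h.dt x hx z hz.1).mono inter_subset_left).fun_sub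
        (((hasDerivAt_id z).const_mul (ft x t)).hasDerivWithinAt (s := Icc a b ∩ Metric.ball t δ₂))
      simpa using this
    · refine (hd (x := (x, z)) ⟨hx, hz.1⟩ ?_).le
      rw [Prod.dist_eq]; simpa [hδ₂] using hz.2
  have n1 : ‖x' - x‖ ≤ ‖(x', t') - (x, t)‖ := norm_fst_le ((x', t') - (x, t))
  have n2 : ‖t' - t‖ ≤ ‖(x', t') - (x, t)‖ := norm_snd_le ((x', t') - (x, t))
  calc _ = ‖((f x' t' - fx x t * x') - (f x t' - fx x t * x))
        + ((f x t' - ft x t * t') - (f x t - ft x t * t))‖ := by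
        congr 1; simp; ring
    _ ≤ ε / 2 * ‖x' - x‖ + ε / 2 * ‖t' - t‖ := (norm_add_le _ _).trans (add_le_add e1 e2)
    _ ≤ ε / 2 * ‖(x', t') - (x, t)‖ + ε / 2 * ‖(x', t') - (x, t)‖ := by gcongr
    _ = ε * ‖(x', t') - (x, t)‖ := by ring

lemma contDiffOn (h : IsC1Rect a b f fx ft) (hab : a < b) :
    ContDiffOn ℝ 1 (fun p : ℝ × ℝ => f p.1 p.2) (Icc (0 : ℝ) 1 ×ˢ Icc a b) := by
  have hu : UniqueDiffOn ℝ (Icc (0 : ℝ) 1 ×ˢ Icc a b) :=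
    (uniqueDiffOn_Icc zero_lt_one).prod (uniqueDiffOn_Icc hab)
  have := (contDiffOn_succ_iff_hasFDerivWithinAt_of_uniqueDiffOn (n := 0) hu
    (f := fun p : ℝ × ℝ => f p.1 p.2)).2 ⟨by simp, _, ?_, fun p hp => h.hasFDerivWithinAt hp⟩
  · simpa using this
  · exact contDiffOn_zero.2 ((h.cont_dx.smul continuousOn_const).add
      (h.cont_dt.smul continuousOn_const))

/-- A function that is `C¹` up to the boundary in the sense of Mathlib has continuous one-sided
partial derivatives. -/
lemma of_contDiffOn (hab : a < b)
    (h : ContDiffOn ℝ 1 (fun p : ℝ × ℝ => f p.1 p.2) (Icc (0 : ℝ) 1 ×ˢ Icc a b)) :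
    ∃ fx ft, IsC1Rect a b f fx ft := by
  have hu : UniqueDiffOn ℝ (Icc (0 : ℝ) 1 ×ˢ Icc a b) :=
    (uniqueDiffOn_Icc zero_lt_one).prod (uniqueDiffOn_Icc hab)
  have hc := h.continuousOn_fderivWithin hu le_rfl
  have hd := h.differentiableOn one_ne_zero
  refine ⟨fun x t => fderivWithin ℝ (fun p : ℝ × ℝ => f p.1 p.2) (Icc (0 : ℝ) 1 ×ˢ Icc a b) (x, t)
    (1, 0), fun x t => fderivWithin ℝ (fun p : ℝ × ℝ => f p.1 p.2) (Icc (0 : ℝ) 1 ×ˢ Icc a b) (x, t)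
    (0, 1), h.continuousOn, hc.clm_apply continuousOn_const, hc.clm_apply continuousOn_const,
    fun x hx t ht => ?_, fun x hx t ht => ?_⟩
  · exact (hd (x, t) ⟨hx, ht⟩).hasFDerivWithinAt.comp_hasDerivWithinAt (f := fun x' => (x', t)) x
      ((hasDerivAt_id x).prodMk (hasDerivAt_const x t)).hasDerivWithinAt fun x' hx' => ⟨hx', ht⟩
  · exact (hd (x, t) ⟨hx, ht⟩).hasFDerivWithinAt.comp_hasDerivWithinAt (f := fun t' => (x, t')) t
      ((hasDerivAt_const t x).prodMk (hasDerivAt_id t)).hasDerivWithinAt fun t' ht' => ⟨hx, ht'⟩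

lemma const_zero : IsC1Rect a b (fun _ _ => 0) (fun _ _ => 0) (fun _ _ => 0) :=
  ⟨continuousOn_const, continuousOn_const, continuousOn_const,
    fun _ _ _ _ => hasDerivWithinAt_const _ _ _, fun _ _ _ _ => hasDerivWithinAt_const _ _ _⟩

end IsC1Rect

/-- `P` is `C¹` up to the boundary on `[0,1]² × [0,T]`, with one-sided partial derivatives `Px`,
`Py`, `Pt`. -/
structure IsC1Cube (T : ℝ) (P Px Py Pt : ℝ → ℝ → ℝ → ℝ) : Prop where
  cont : ContinuousOn (fun p : ℝ × ℝ × ℝ => P p.1 p.2.1 p.2.2)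
    (Icc (0 : ℝ) 1 ×ˢ Icc (0 : ℝ) 1 ×ˢ Icc 0 T)
  cont_dx : ContinuousOn (fun p : ℝ × ℝ × ℝ => Px p.1 p.2.1 p.2.2)
    (Icc (0 : ℝ) 1 ×ˢ Icc (0 : ℝ) 1 ×ˢ Icc 0 T)
  cont_dy : ContinuousOn (fun p : ℝ × ℝ × ℝ => Py p.1 p.2.1 p.2.2)
    (Icc (0 : ℝ) 1 ×ˢ Icc (0 : ℝ) 1 ×ˢ Icc 0 T)
  cont_dt : ContinuousOn (fun p : ℝ × ℝ × ℝ => Pt p.1 p.2.1 p.2.2)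
    (Icc (0 : ℝ) 1 ×ˢ Icc (0 : ℝ) 1 ×ˢ Icc 0 T)
  dx : ∀ x ∈ Icc (0 : ℝ) 1, ∀ y ∈ Icc (0 : ℝ) 1, ∀ t ∈ Icc 0 T,
    HasDerivWithinAt (fun x' => P x' y t) (Px x y t) (Icc 0 1) x
  dy : ∀ x ∈ Icc (0 : ℝ) 1, ∀ y ∈ Icc (0 : ℝ) 1, ∀ t ∈ Icc 0 T,
    HasDerivWithinAt (fun y' => P x y' t) (Py x y t) (Icc 0 1) y
  dt : ∀ x ∈ Icc (0 : ℝ) 1, ∀ y ∈ Icc (0 : ℝ) 1, ∀ t ∈ Icc 0 T,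
    HasDerivWithinAt (fun t' => P x y t') (Pt x y t) (Icc 0 T) t

lemma IsC1Kernel.exists_isC1Cube {S : Problem} {P : ℝ → ℝ → ℝ → ℝ} (h : IsC1Kernel S P) :
    ∃ Px Py Pt, IsC1Cube S.T P Px Py Pt := by
  rw [IsC1Kernel] at h
  set D : Set (ℝ × ℝ × ℝ) := Icc (0 : ℝ) 1 ×ˢ Icc (0 : ℝ) 1 ×ˢ Icc 0 S.T
  set F : ℝ × ℝ × ℝ → ℝ := fun p => P p.1 p.2.1 p.2.2
  have hu : UniqueDiffOn ℝ D := (uniqueDiffOn_Icc zero_lt_one).prod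
    ((uniqueDiffOn_Icc zero_lt_one).prod (uniqueDiffOn_Icc S.T_pos))
  have hc := h.continuousOn_fderivWithin hu le_rfl
  have hd := h.differentiableOn one_ne_zero
  refine ⟨fun x y t => fderivWithin ℝ F D (x, y, t) (1, 0, 0),
    fun x y t => fderivWithin ℝ F D (x, y, t) (0, 1, 0),
    fun x y t => fderivWithin ℝ F D (x, y, t) (0, 0, 1),
    h.continuousOn, hc.clm_apply continuousOn_const, hc.clm_apply continuousOn_const,
    hc.clm_apply continuousOn_const,
    fun x hx y hy t ht => ?_, fun x hx y hy t ht => ?_, fun x hx y hy t ht => ?_⟩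
  · exact (hd (x, y, t) ⟨hx, hy, ht⟩).hasFDerivWithinAt.comp_hasDerivWithinAt
      (f := fun x' => (x', y, t)) x ((hasDerivAt_id x).prodMk
        ((hasDerivAt_const x y).prodMk (hasDerivAt_const x t))).hasDerivWithinAt
      fun x' hx' => ⟨hx', hy, ht⟩
  · exact (hd (x, y, t) ⟨hx, hy, ht⟩).hasFDerivWithinAt.comp_hasDerivWithinAt
      (f := fun y' => (x, y', t)) y ((hasDerivAt_const y x).prodMk
        ((hasDerivAt_id y).prodMk (hasDerivAt_const y t))).hasDerivWithinAt
      fun y' hy' => ⟨hx, hy', ht⟩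
  · exact (hd (x, y, t) ⟨hx, hy, ht⟩).hasFDerivWithinAt.comp_hasDerivWithinAt
      (f := fun t' => (x, y, t')) t ((hasDerivAt_const t x).prodMk
        ((hasDerivAt_const t y).prodMk (hasDerivAt_id t))).hasDerivWithinAt
      fun t' ht' => ⟨hx, hy, ht'⟩

lemma IsC1Cube.slice {T : ℝ} {P Px Py Pt : ℝ → ℝ → ℝ → ℝ} (h : IsC1Cube T P Px Py Pt)
    {x : ℝ} (hx : x ∈ Icc (0 : ℝ) 1) : IsC1Rect 0 T (P x) (Py x) (Pt x) := by
  have key : ∀ {F : ℝ → ℝ → ℝ → ℝ}, ContinuousOn (fun p : ℝ × ℝ × ℝ => F p.1 p.2.1 p.2.2)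
      (Icc (0 : ℝ) 1 ×ˢ Icc (0 : ℝ) 1 ×ˢ Icc 0 T) →
      ContinuousOn (fun p : ℝ × ℝ => F x p.1 p.2) (Icc (0 : ℝ) 1 ×ˢ Icc 0 T) := fun hF =>
    hF.comp (Continuous.prodMk_right x).continuousOn fun _ hp => ⟨hx, hp⟩
  exact ⟨key h.cont, key h.cont_dy, key h.cont_dt, fun y hy t ht => h.dy x hx y hy t ht,
    fun y hy t ht => h.dt x hx y hy t ht⟩

/-! ### The weak formulation in terms of inner products -/

section Weak

variable {S : Problem} {s : ℝ} {u₀ v₀ : L2} {u v : ℝ → L2} {U : ℝ → ℝ}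
  {φ φx φt ψ ψx ψt : ℝ → ℝ → ℝ}

/-- The first component `φ_t + ε₁ φ_x + c₂ ψ` of the formal adjoint operator. -/
def adjFst (S : Problem) (φx φt ψ : ℝ → ℝ → ℝ) (x t : ℝ) : ℝ :=
  φt x t + S.ε₁ * φx x t + S.c₂ x * ψ x t

/-- The second component `ψ_t - ε₂ ψ_x + c₁ φ` of the formal adjoint operator. -/
def adjSnd (S : Problem) (ψx ψt φ : ℝ → ℝ → ℝ) (x t : ℝ) : ℝ :=
  ψt x t - S.ε₂ * ψx x t + S.c₁ x * φ x t

lemma continuousOn_adjFst {a b : ℝ} (hφ : IsC1Rect a b φ φx φt) (hψ : IsC1Rect a b ψ ψx ψt) :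
    ContinuousOn (fun p : ℝ × ℝ => adjFst S φx φt ψ p.1 p.2) (Icc (0 : ℝ) 1 ×ˢ Icc a b) :=
  (hφ.cont_dt.add (continuousOn_const.mul hφ.cont_dx)).add
    ((S.c₂_cont.comp continuousOn_fst fun _ hp => hp.1).mul hψ.cont)

lemma continuousOn_adjSnd {a b : ℝ} (hφ : IsC1Rect a b φ φx φt) (hψ : IsC1Rect a b ψ ψx ψt) :
    ContinuousOn (fun p : ℝ × ℝ => adjSnd S ψx ψt φ p.1 p.2) (Icc (0 : ℝ) 1 ×ˢ Icc a b) :=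
  (hψ.cont_dt.sub (continuousOn_const.mul hψ.cont_dx)).add
    ((S.c₁_cont.comp continuousOn_fst fun _ hp => hp.1).mul hφ.cont)

lemma integral_pair {f g : ℝ → ℝ} (hf : ContinuousOn f (Icc 0 1)) (hg : ContinuousOn g (Icc 0 1))
    (u v : L2) : ∫ x, (u x * f x + v x * g x) ∂unitMeasure
      = inner ℝ u (toL2 f) + inner ℝ v (toL2 g) := by
  rw [integral_add (integrable_mul_coeFn hf u) (integrable_mul_coeFn hg v),
    real_inner_comm, real_inner_comm (toL2 g), inner_toL2 hf, inner_toL2 hg]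
  simp only [mul_comm]

lemma integral_adjoint {a b : ℝ} (hφ : IsC1Rect a b φ φx φt) (hψ : IsC1Rect a b ψ ψx ψt)
    {τ : ℝ} (hτ : τ ∈ Icc a b) :
    (∫ t in a..τ, ∫ x,
          (u t x * (deriv (fun t' => φ x t') t + S.ε₁ * deriv (fun x' => φ x' t) x
              + S.c₂ x * ψ x t)
            + v t x * (deriv (fun t' => ψ x t') t - S.ε₂ * deriv (fun x' => ψ x' t) x
              + S.c₁ x * φ x t)) ∂unitMeasure)
      = ∫ t in a..τ, (inner ℝ (u t) (toL2 fun x => adjFst S φx φt ψ x t)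
          + inner ℝ (v t) (toL2 fun x => adjSnd S ψx ψt φ x t)) := by
  refine intervalIntegral.integral_congr_ae ?_
  filter_upwards [Measure.ae_ne volume b] with t htb ht
  rw [uIoc_of_le hτ.1] at ht
  have ht' : t ∈ Ioo a b := ⟨ht.1, lt_of_le_of_ne (ht.2.trans hτ.2) htb⟩
  have ht'' := Ioo_subset_Icc_self ht'
  rw [← integral_pair (slice_left (continuousOn_adjFst hφ hψ) ht'')
    (slice_left (continuousOn_adjSnd hφ hψ) ht'')]
  refine integral_congr_ae ?_
  filter_upwards [ae_unitMeasure_mem_Ioo] with x hx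
  have hx' := Ioo_subset_Icc_self hx
  rw [hφ.deriv_t hx' ht', hφ.deriv_x hx ht'', hψ.deriv_t hx' ht', hψ.deriv_x hx ht'', adjFst,
    adjSnd]

/-- The weak formulation of the state equation, tested with a pair that is `C¹` on
`[0,1] × [s,T]`, in terms of inner products of `L²([0,1])`. -/
lemma IsTrajectory.weak_inner (h : IsTrajectory S s u₀ v₀ u v U) (hs : s < S.T)
    (hφ : IsC1Rect s S.T φ φx φt) (hψ : IsC1Rect s S.T ψ ψx ψt)
    (h1 : ∀ t ∈ Icc s S.T, φ 1 t = 0)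
    (h0 : ∀ t ∈ Icc s S.T, S.ε₂ * ψ 0 t = S.q * S.ε₁ * φ 0 t) {τ : ℝ} (hτ : τ ∈ Icc s S.T) :
    inner ℝ (u τ) (toL2 fun x => φ x τ) + inner ℝ (v τ) (toL2 fun x => ψ x τ)
        - (inner ℝ u₀ (toL2 fun x => φ x s) + inner ℝ v₀ (toL2 fun x => ψ x s))
      = (∫ t in s..τ, (inner ℝ (u t) (toL2 fun x => adjFst S φx φt ψ x t)
          + inner ℝ (v t) (toL2 fun x => adjSnd S ψx ψt φ x t)))
        + ∫ t in s..τ, S.ε₂ * ψ 1 t * U t := by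
  have hs' : s ∈ Icc s S.T := ⟨le_rfl, hs.le⟩
  have := h.weak φ ψ ⟨hφ.contDiffOn hs, hψ.contDiffOn hs, h1, h0⟩ τ hτ
  rwa [integral_adjoint hφ hψ hτ,
    integral_pair (slice_left hφ.cont hτ) (slice_left hψ.cont hτ),
    integral_pair (slice_left hφ.cont hs')
      (slice_left hψ.cont hs')] at this

lemma IsTrajectory.of_weak_inner (hs : s < S.T)
    (control : MemLp U 2 (volume.restrict (Icc s S.T)))
    (cont_u : ContinuousOn u (Icc s S.T)) (cont_v : ContinuousOn v (Icc s S.T))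
    (init_u : u s = u₀) (init_v : v s = v₀)
    (weak : ∀ {φ φx φt ψ ψx ψt : ℝ → ℝ → ℝ}, IsC1Rect s S.T φ φx φt → IsC1Rect s S.T ψ ψx ψt →
      (∀ t ∈ Icc s S.T, φ 1 t = 0) →
      (∀ t ∈ Icc s S.T, S.ε₂ * ψ 0 t = S.q * S.ε₁ * φ 0 t) → ∀ τ ∈ Icc s S.T,
      inner ℝ (u τ) (toL2 fun x => φ x τ) + inner ℝ (v τ) (toL2 fun x => ψ x τ)
          - (inner ℝ u₀ (toL2 fun x => φ x s) + inner ℝ v₀ (toL2 fun x => ψ x s))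
        = (∫ t in s..τ, (inner ℝ (u t) (toL2 fun x => adjFst S φx φt ψ x t)
            + inner ℝ (v t) (toL2 fun x => adjSnd S ψx ψt φ x t)))
          + ∫ t in s..τ, S.ε₂ * ψ 1 t * U t) :
    IsTrajectory S s u₀ v₀ u v U where
  control := control
  cont_u := cont_u
  cont_v := cont_v
  init_u := init_u
  init_v := init_v
  weak φ ψ h τ hτ := by
    obtain ⟨φx, φt, hφ⟩ := IsC1Rect.of_contDiffOn hs h.contDiff_fst
    obtain ⟨ψx, ψt, hψ⟩ := IsC1Rect.of_contDiffOn hs h.contDiff_snd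
    have hs' : s ∈ Icc s S.T := ⟨le_rfl, hs.le⟩
    rw [integral_adjoint hφ hψ hτ,
      integral_pair (slice_left hφ.cont hτ) (slice_left hψ.cont hτ),
      integral_pair (slice_left hφ.cont hs')
        (slice_left hψ.cont hs')]
    exact weak hφ hψ h.at_one h.at_zero τ hτ

end Weak

/-! ### Linearity of the state equation -/

section Linearity

variable {S : Problem} {s : ℝ}

lemma intervalIntegrable_of_continuousOn {a b τ : ℝ} {f : ℝ → ℝ} (hf : ContinuousOn f (Icc a b))
    (hτ : τ ∈ Icc a b) : IntervalIntegrable f volume a τ :=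
  ContinuousOn.intervalIntegrable (hf.mono (by rw [uIcc_of_le hτ.1]; exact Icc_subset_Icc_right hτ.2))

lemma intervalIntegrable_mul_control {a b τ : ℝ} {g U : ℝ → ℝ} (hg : ContinuousOn g (Icc a b))
    (hU : MemLp U 2 (volume.restrict (Icc a b))) (hτ : τ ∈ Icc a b) :
    IntervalIntegrable (fun t => g t * U t) volume a τ := by
  obtain ⟨C, hC⟩ := isCompact_Icc.exists_bound_of_continuousOn hg
  have h1 : Integrable U (volume.restrict (Icc a b)) := hU.integrable one_le_two
  have h2 := h1.bdd_mul (hg.aestronglyMeasurable measurableSet_Icc) (c := C) (by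
    filter_upwards [ae_restrict_mem measurableSet_Icc] with x hx using hC x hx)
  rw [intervalIntegrable_iff_integrableOn_Ioc_of_le hτ.1]
  exact IntegrableOn.mono_set h2 (Ioc_subset_Icc_self.trans (Icc_subset_Icc_right hτ.2))

lemma intervalIntegrable_control_sq {a b τ : ℝ} {U : ℝ → ℝ}
    (hU : MemLp U 2 (volume.restrict (Icc a b))) (hτ : τ ∈ Icc a b) :
    IntervalIntegrable (fun t => U t ^ 2) volume a τ := by
  rw [intervalIntegrable_iff_integrableOn_Ioc_of_le hτ.1]
  exact IntegrableOn.mono_set hU.integrable_sq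
    (Ioc_subset_Icc_self.trans (Icc_subset_Icc_right hτ.2))

lemma continuousOn_inner_adj {φ φx φt ψ ψx ψt : ℝ → ℝ → ℝ} {b : ℝ} {u v : ℝ → L2}
    (hu : ContinuousOn u (Icc s b)) (hv : ContinuousOn v (Icc s b))
    (hφ : IsC1Rect s b φ φx φt) (hψ : IsC1Rect s b ψ ψx ψt) :
    ContinuousOn (fun t => inner ℝ (u t) (toL2 fun x => adjFst S φx φt ψ x t)
          + inner ℝ (v t) (toL2 fun x => adjSnd S ψx ψt φ x t)) (Icc s b) :=
  (hu.inner (continuousOn_toL2_slice (continuousOn_adjFst hφ hψ))).add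
    (hv.inner (continuousOn_toL2_slice (continuousOn_adjSnd hφ hψ)))

lemma IsTrajectory.add_const_mul {u₀ v₀ u₀' v₀' : L2} {u v u' v' : ℝ → L2} {U U' : ℝ → ℝ}
    (hs : s < S.T) (h : IsTrajectory S s u₀ v₀ u v U) (h' : IsTrajectory S s u₀' v₀' u' v' U')
    (c : ℝ) :
    IsTrajectory S s (u₀ + c • u₀') (v₀ + c • v₀') (fun t => u t + c • u' t)
      (fun t => v t + c • v' t) (fun t => U t + c * U' t) := by
  refine IsTrajectory.of_weak_inner hs (h.control.add (h'.control.const_mul c))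
    (h.cont_u.add (h'.cont_u.const_smul c)) (h.cont_v.add (h'.cont_v.const_smul c))
    (by rw [h.init_u, h'.init_u]) (by rw [h.init_v, h'.init_v]) ?_
  intro φ φx φt ψ ψx ψt hφ hψ h1 h0 τ hτ
  have e := h.weak_inner hs hφ hψ h1 h0 hτ
  have e' := h'.weak_inner hs hφ hψ h1 h0 hτ
  have i1 := intervalIntegrable_of_continuousOn
    (continuousOn_inner_adj (S := S) h.cont_u h.cont_v hφ hψ) hτ
  have i2 := intervalIntegrable_of_continuousOn
    (continuousOn_inner_adj (S := S) h'.cont_u h'.cont_v hφ hψ) hτ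
  have hc1 : ContinuousOn (fun t => S.ε₂ * ψ 1 t) (Icc s S.T) :=
    continuousOn_const.mul (slice_right hψ.cont (by simp))
  have i3 := intervalIntegrable_mul_control hc1 h.control hτ
  have i4 := intervalIntegrable_mul_control hc1 h'.control hτ
  have r1 : (∫ t in s..τ, (inner ℝ (u t + c • u' t) (toL2 fun x => adjFst S φx φt ψ x t)
          + inner ℝ (v t + c • v' t) (toL2 fun x => adjSnd S ψx ψt φ x t)))
      = (∫ t in s..τ, (inner ℝ (u t) (toL2 fun x => adjFst S φx φt ψ x t)
          + inner ℝ (v t) (toL2 fun x => adjSnd S ψx ψt φ x t)))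
        + c * ∫ t in s..τ, (inner ℝ (u' t) (toL2 fun x => adjFst S φx φt ψ x t)
          + inner ℝ (v' t) (toL2 fun x => adjSnd S ψx ψt φ x t)) := by
    rw [← intervalIntegral.integral_const_mul, ← intervalIntegral.integral_add i1 (i2.const_mul c)]
    congr 1; ext t
    simp only [inner_add_left, inner_smul_left, conj_trivial]; ring
  have r2 : (∫ t in s..τ, S.ε₂ * ψ 1 t * (U t + c * U' t))
      = (∫ t in s..τ, S.ε₂ * ψ 1 t * U t) + c * ∫ t in s..τ, S.ε₂ * ψ 1 t * U' t := by
    rw [← intervalIntegral.integral_const_mul, ← intervalIntegral.integral_add i3 (i4.const_mul c)]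
    congr 1; ext t; ring
  rw [r1, r2]
  simp only [inner_add_left, inner_smul_left, conj_trivial]
  linear_combination e + c * e'

end Linearity

/-! ### The energy estimate -/

/-- The integral form of Gronwall's inequality for a continuous function. -/
lemma gronwall_integral {f : ℝ → ℝ} {a b c K : ℝ} (hf : ContinuousOn f (Icc a b)) (hK : 0 ≤ K)
    (h : ∀ t ∈ Icc a b, f t ≤ c + K * ∫ r in a..t, f r) :
    ∀ t ∈ Icc a b, f t ≤ c * Real.exp (K * (t - a)) := by
  intro t ht
  have hab : a ≤ b := ht.1.trans ht.2
  set F : ℝ → ℝ := fun t => c + K * ∫ r in a..t, f r with hF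
  have hint : IntegrableOn f (uIcc a b) := by
    rw [uIcc_of_le hab]; exact hf.integrableOn_Icc
  have hFc : ContinuousOn F (Icc a b) := by
    have := intervalIntegral.continuousOn_primitive_interval hint
    rw [uIcc_of_le hab] at this
    exact continuousOn_const.add (continuousOn_const.mul this)
  have hFd : ∀ x ∈ Ioo a b, HasDerivAt F (K * f x) x := fun x hx => by
    have hx' := Ioo_subset_Icc_self hx
    have := intervalIntegral.integral_hasDerivAt_right (intervalIntegrable_of_continuousOn hf hx')
      (hf.stronglyMeasurableAtFilter_nhdsWithin measurableSet_Icc x |>.filter_mono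
        (by rw [nhdsWithin_eq_nhds.2 (Icc_mem_nhds hx.1 hx.2)]))
      (hf.continuousAt (Icc_mem_nhds hx.1 hx.2))
    exact (this.const_mul K).const_add c
  have hanti : AntitoneOn (fun t => F t * Real.exp (-(K * (t - a)))) (Icc a b) := by
    refine antitoneOn_of_deriv_nonpos (convex_Icc a b)
      (hFc.mul (by fun_prop)) ?_ ?_
    · intro x hx
      rw [interior_Icc] at hx
      exact ((hFd x hx).differentiableAt.mul (by fun_prop)).differentiableWithinAt
    · intro x hx
      rw [interior_Icc] at hx
      have he : HasDerivAt (fun t => Real.exp (-(K * (t - a)))) (Real.exp (-(K * (x - a))) * (-K)) x := by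
        have : HasDerivAt (fun t : ℝ => -(K * (t - a))) (-K) x := by
          simpa using (((hasDerivAt_id x).sub_const a).const_mul K).fun_neg
        exact this.exp
      rw [((hFd x hx).fun_mul he).deriv]
      have h1 : f x ≤ F x := h x (Ioo_subset_Icc_self hx)
      have h2 := Real.exp_pos (-(K * (x - a)))
      have h3 : 0 ≤ K * Real.exp (-(K * (x - a))) * (F x - f x) :=
        mul_nonneg (by positivity) (by linarith)
      linarith
  have h1 := hanti ⟨le_rfl, hab⟩ ht ht.1
  have h2 : F a = c := by simp [hF]
  simp only [sub_self, mul_zero, neg_zero, Real.exp_zero, mul_one, h2] at h1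
  rw [Real.exp_neg, ← div_eq_mul_inv, div_le_iff₀ (Real.exp_pos _)] at h1
  exact (h t ht).trans h1

/-- The part over any set of the `L²` norm of a function with support in `(0,1)`, after an affine
change of variables. This bounds the explicit solutions of the uncoupled adjoint equation and their
traces at once. -/
lemma setIntegral_comp_affine_sq_le {G : ℝ → ℝ} (hG : Continuous G) (hc : HasCompactSupport G)
    (hs : tsupport G ⊆ Ioo (0 : ℝ) 1) (b : ℝ) {κ : ℝ} (hκ : κ ≠ 0) (A : Set ℝ) :
    ∫ x in A, G (b + κ * x) ^ 2 ≤ |κ|⁻¹ * ∫ x in Icc (0 : ℝ) 1, G x ^ 2 := by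
  have hc2 : HasCompactSupport (fun x => G x ^ 2) := by
    simp only [sq]
    exact hc.mul_left
  have hi : Integrable (fun x => G x ^ 2) := (hG.pow 2).integrable_of_hasCompactSupport hc2
  have hi1 : Integrable (fun x => G (b + x) ^ 2) := hi.comp_add_left b
  have hi' : Integrable (fun x => G (b + κ * x) ^ 2) := hi1.comp_mul_left' hκ
  calc ∫ x in A, G (b + κ * x) ^ 2 ≤ ∫ x, G (b + κ * x) ^ 2 :=
        setIntegral_le_integral hi' (.of_forall fun x => sq_nonneg _)
    _ = |κ|⁻¹ * ∫ x, G x ^ 2 := by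
        rw [Measure.integral_comp_mul_left (fun x => G (b + x) ^ 2) κ,
          integral_add_left_eq_self (fun x => G x ^ 2) b, smul_eq_mul, abs_inv]
    _ = |κ|⁻¹ * ∫ x in Icc (0 : ℝ) 1, G x ^ 2 := by
        rw [setIntegral_eq_integral_of_forall_compl_eq_zero]
        intro x hx
        have : x ∉ tsupport G := fun h => hx (Ioo_subset_Icc_self (hs h))
        simp [image_eq_zero_of_notMem_tsupport this]

lemma IsC1Rect.of_contDiff {a b : ℝ} {f : ℝ → ℝ → ℝ}
    (h : ContDiff ℝ 1 (fun p : ℝ × ℝ => f p.1 p.2)) :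
    IsC1Rect a b f (fun x t => deriv (fun x' => f x' t) x) (fun x t => deriv (fun t' => f x t') t) := by
  have hd := h.differentiable one_ne_zero
  have hc := h.continuous_fderiv one_ne_zero
  have e1 : ∀ x t, HasDerivAt (fun x' => f x' t)
      (fderiv ℝ (fun p : ℝ × ℝ => f p.1 p.2) (x, t) (1, 0)) x := fun x t =>
    (hd (x, t)).hasFDerivAt.comp_hasDerivAt (f := fun x' => (x', t)) x
      ((hasDerivAt_id x).prodMk (hasDerivAt_const x t))
  have e2 : ∀ x t, HasDerivAt (fun t' => f x t')
      (fderiv ℝ (fun p : ℝ × ℝ => f p.1 p.2) (x, t) (0, 1)) t := fun x t =>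
    (hd (x, t)).hasFDerivAt.comp_hasDerivAt (f := fun t' => (x, t')) t
      ((hasDerivAt_const t x).prodMk (hasDerivAt_id t))
  refine ⟨h.continuous.continuousOn, ?_, ?_, fun x _ t _ => ?_, fun x _ t _ => ?_⟩
  · simp only [(e1 _ _).deriv]
    exact (hc.clm_apply continuous_const).continuousOn
  · simp only [(e2 _ _).deriv]
    exact (hc.clm_apply continuous_const).continuousOn
  · simpa only [(e1 x t).deriv] using (e1 x t).hasDerivWithinAt
  · simpa only [(e2 x t).deriv] using (e2 x t).hasDerivWithinAt

section Energy

variable {S : Problem} {s : ℝ} {u₀ v₀ : L2} {u v : ℝ → L2} {U : ℝ → ℝ} {G₁ G₂ : ℝ → ℝ} {τ : ℝ}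

/-- The first component of the solution of the uncoupled adjoint equation (`c₁ = c₂ = 0`) with
value `(G₁, G₂)` at time `τ`, where `G₁`, `G₂` are supported in `(0,1)`. -/
def backFst (S : Problem) (G₁ : ℝ → ℝ) (τ x t : ℝ) : ℝ := G₁ (S.ε₁ * (τ - t) + 1 * x)

/-- The second component of the solution of the uncoupled adjoint equation with value `(G₁, G₂)` at
time `τ`: a transported copy of `G₂`, and the wave reflected at `x = 0`. -/
def backSnd (S : Problem) (G₁ G₂ : ℝ → ℝ) (τ x t : ℝ) : ℝ :=
  G₂ (-S.ε₂ * (τ - t) + 1 * x)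
    + S.q * S.ε₁ / S.ε₂ * G₁ (S.ε₁ * (τ - t) + -(S.ε₁ / S.ε₂) * x)

lemma eq_zero_of_notMem_Ioo {G : ℝ → ℝ} (hs : tsupport G ⊆ Ioo (0 : ℝ) 1) {x : ℝ}
    (hx : x ∉ Ioo (0 : ℝ) 1) : G x = 0 :=
  image_eq_zero_of_notMem_tsupport fun h => hx (hs h)

/-- A support in `(0,1)` keeps a distance from the boundary. -/
lemma exists_margin {G : ℝ → ℝ} (hs : tsupport G ⊆ Ioo (0 : ℝ) 1) :
    ∃ η > 0, ∀ x, (x < η ∨ 1 - η < x) → G x = 0 := by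
  have hU : IsOpen (tsupport G)ᶜ := (isClosed_tsupport G).isOpen_compl
  obtain ⟨a, ha, ha'⟩ := Metric.isOpen_iff.1 hU 0 fun h => lt_irrefl _ (hs h).1
  obtain ⟨b, hb, hb'⟩ := Metric.isOpen_iff.1 hU 1 fun h => lt_irrefl _ (hs h).2
  refine ⟨min a b, lt_min ha hb, fun x hx => ?_⟩
  by_cases hx' : x ∈ Ioo (0 : ℝ) 1
  · refine image_eq_zero_of_notMem_tsupport ?_
    rcases hx with h | h
    · refine ha' ?_
      rw [Metric.mem_ball, Real.dist_eq, abs_lt]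
      exact ⟨by linarith [hx'.1], by linarith [min_le_left a b]⟩
    · refine hb' ?_
      rw [Metric.mem_ball, Real.dist_eq, abs_lt]
      exact ⟨by linarith [min_le_right a b], by linarith [hx'.2]⟩
  · exact eq_zero_of_notMem_Ioo hs hx'

lemma contDiff_backFst (h₁ : ContDiff ℝ (⊤ : ℕ∞) G₁) :
    ContDiff ℝ 1 (fun p : ℝ × ℝ => backFst S G₁ τ p.1 p.2) := by
  have h := h₁.of_le (show (1 : WithTop ℕ∞) ≤ ((⊤ : ℕ∞) : WithTop ℕ∞) by exact_mod_cast le_top)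
  exact h.comp (by fun_prop)

lemma contDiff_backSnd (h₁ : ContDiff ℝ (⊤ : ℕ∞) G₁) (h₂ : ContDiff ℝ (⊤ : ℕ∞) G₂) :
    ContDiff ℝ 1 (fun p : ℝ × ℝ => backSnd S G₁ G₂ τ p.1 p.2) := by
  have h := h₁.of_le (show (1 : WithTop ℕ∞) ≤ ((⊤ : ℕ∞) : WithTop ℕ∞) by exact_mod_cast le_top)
  have h' := h₂.of_le (show (1 : WithTop ℕ∞) ≤ ((⊤ : ℕ∞) : WithTop ℕ∞) by exact_mod_cast le_top)
  exact (h'.comp (by fun_prop)).add (contDiff_const.mul (h.comp (by fun_prop)))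

lemma hasDerivAt_comp_affine {G : ℝ → ℝ} (hG : Differentiable ℝ G) (a b x : ℝ) :
    HasDerivAt (fun x => G (a + b * x)) (b * deriv G (a + b * x)) x := by
  have h : HasDerivAt (fun x : ℝ => a + b * x) b x := by
    simpa using ((hasDerivAt_id x).const_mul b).const_add a
  have := (hG (a + b * x)).hasDerivAt.comp x h
  rw [mul_comm]; exact this

lemma deriv_backFst (h₁ : ContDiff ℝ (⊤ : ℕ∞) G₁) (x t : ℝ) :
    deriv (fun t' => backFst S G₁ τ x t') t + S.ε₁ * deriv (fun x' => backFst S G₁ τ x' t) x = 0 := by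
  have hd : Differentiable ℝ G₁ := h₁.differentiable (by simp)
  have e1 : HasDerivAt (fun x' => backFst S G₁ τ x' t) _ x :=
    hasDerivAt_comp_affine hd (S.ε₁ * (τ - t)) 1 x
  have e2 := hasDerivAt_comp_affine hd (S.ε₁ * τ + x) (-S.ε₁) t
  have e3 : (fun t' => backFst S G₁ τ x t') = fun t' => G₁ (S.ε₁ * τ + x + -S.ε₁ * t') := by
    ext t'; simp only [backFst]; congr 1; ring
  rw [e3, e2.deriv, e1.deriv]
  rw [show S.ε₁ * τ + x + -S.ε₁ * t = S.ε₁ * (τ - t) + 1 * x by ring]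
  ring

lemma deriv_backSnd (h₁ : ContDiff ℝ (⊤ : ℕ∞) G₁) (h₂ : ContDiff ℝ (⊤ : ℕ∞) G₂) (x t : ℝ) :
    deriv (fun t' => backSnd S G₁ G₂ τ x t') t
      - S.ε₂ * deriv (fun x' => backSnd S G₁ G₂ τ x' t) x = 0 := by
  have hd : Differentiable ℝ G₁ := h₁.differentiable (by simp)
  have hd' : Differentiable ℝ G₂ := h₂.differentiable (by simp)
  have hε := S.ε₂_pos.ne'
  have e1 : HasDerivAt (fun x' => backSnd S G₁ G₂ τ x' t) _ x :=
    (hasDerivAt_comp_affine hd' (-S.ε₂ * (τ - t)) 1 x).fun_add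
    ((hasDerivAt_comp_affine hd (S.ε₁ * (τ - t)) (-(S.ε₁ / S.ε₂)) x).const_mul
      (S.q * S.ε₁ / S.ε₂))
  have e2 := (hasDerivAt_comp_affine hd' (-S.ε₂ * τ + x) S.ε₂ t).fun_add
    ((hasDerivAt_comp_affine hd (S.ε₁ * τ - S.ε₁ / S.ε₂ * x) (-S.ε₁) t).const_mul
      (S.q * S.ε₁ / S.ε₂))
  have e3 : (fun t' => backSnd S G₁ G₂ τ x t') = fun t' => G₂ (-S.ε₂ * τ + x + S.ε₂ * t')
      + S.q * S.ε₁ / S.ε₂ * G₁ (S.ε₁ * τ - S.ε₁ / S.ε₂ * x + -S.ε₁ * t') := by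
    ext t'; simp only [backSnd]
    congr 2
    · ring
    · congr 1; ring
  rw [e3, e2.deriv, e1.deriv]
  rw [show -S.ε₂ * τ + x + S.ε₂ * t = -S.ε₂ * (τ - t) + 1 * x by ring,
    show S.ε₁ * τ - S.ε₁ / S.ε₂ * x + -S.ε₁ * t = S.ε₁ * (τ - t) + -(S.ε₁ / S.ε₂) * x by ring]
  field_simp
  ring

/-- The weak formulation tested with the solution of the uncoupled adjoint equation that has the
value `(G₁, G₂)` at time `τ`. After time `τ` the test functions are cut off, at a rate at which the
supports of `G₁` and `G₂` do not reach the boundary. -/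
lemma IsTrajectory.inner_contDiff (h : IsTrajectory S s u₀ v₀ u v U) (hs : s < S.T)
    (hτ : τ ∈ Icc s S.T) (h₁ : ContDiff ℝ (⊤ : ℕ∞) G₁) (hs₁ : tsupport G₁ ⊆ Ioo (0 : ℝ) 1)
    (h₂ : ContDiff ℝ (⊤ : ℕ∞) G₂) (hs₂ : tsupport G₂ ⊆ Ioo (0 : ℝ) 1) :
    inner ℝ (u τ) (toL2 G₁) + inner ℝ (v τ) (toL2 G₂)
      = inner ℝ u₀ (toL2 fun x => backFst S G₁ τ x s)
        + inner ℝ v₀ (toL2 fun x => backSnd S G₁ G₂ τ x s)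
        + (∫ t in s..τ, (inner ℝ (mulL2 S.c₂ S.c₂_cont (u t)) (toL2 fun x => backSnd S G₁ G₂ τ x t)
          + inner ℝ (mulL2 S.c₁ S.c₁_cont (v t)) (toL2 fun x => backFst S G₁ τ x t)))
        + ∫ t in s..τ, S.ε₂ * backSnd S G₁ G₂ τ 1 t * U t := by
  have hε₁ := S.ε₁_pos
  have hε₂ := S.ε₂_pos
  obtain ⟨η₁, hη₁, hz₁⟩ := exists_margin hs₁
  obtain ⟨η₂, hη₂, hz₂⟩ := exists_margin hs₂
  set δ : ℝ := min (η₁ / S.ε₁) (η₂ / S.ε₂) with hδ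
  have hδ0 : 0 < δ := lt_min (by positivity) (by positivity)
  have hδ₁ : S.ε₁ * δ ≤ η₁ := by
    have := min_le_left (η₁ / S.ε₁) (η₂ / S.ε₂)
    rw [← hδ, le_div_iff₀ hε₁] at this; linarith
  have hδ₂ : S.ε₂ * δ ≤ η₂ := by
    have := min_le_right (η₁ / S.ε₁) (η₂ / S.ε₂)
    rw [← hδ, le_div_iff₀ hε₂] at this; linarith
  -- `χ = 1` before `τ`, and `χ = 0` after `τ + δ`, when the shifted supports may reach the boundary
  set χ : ℝ → ℝ := fun t => Real.smoothTransition (1 - (t - τ) / δ) with hχ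
  have hχ1 : ∀ t ≤ τ, χ t = 1 := fun t ht => Real.smoothTransition.one_of_one_le (by
    have : (t - τ) / δ ≤ 0 := div_nonpos_of_nonpos_of_nonneg (by linarith) hδ0.le
    linarith)
  have hχ0 : ∀ t, τ + δ ≤ t → χ t = 0 := fun t ht => Real.smoothTransition.zero_of_nonpos (by
    have : 1 ≤ (t - τ) / δ := by rw [le_div_iff₀ hδ0]; linarith
    linarith)
  have hχd : ContDiff ℝ 1 (fun p : ℝ × ℝ => χ p.2) :=
    (Real.smoothTransition.contDiff (n := 1)).comp (by fun_prop)
  have c1 : ContDiff ℝ 1 (fun p : ℝ × ℝ => χ p.2 * backFst S G₁ τ p.1 p.2) :=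
    hχd.mul (contDiff_backFst h₁)
  have c2 : ContDiff ℝ 1 (fun p : ℝ × ℝ => χ p.2 * backSnd S G₁ G₂ τ p.1 p.2) :=
    hχd.mul (contDiff_backSnd h₁ h₂)
  have C1 := IsC1Rect.of_contDiff (a := s) (b := S.T)
    (f := fun x t => χ t * backFst S G₁ τ x t) c1
  have C2 := IsC1Rect.of_contDiff (a := s) (b := S.T)
    (f := fun x t => χ t * backSnd S G₁ G₂ τ x t) c2
  have key := h.weak_inner hs C1 C2 (fun t _ => ?_) (fun t _ => ?_) hτ
  · have f1 : (fun x => χ τ * backFst S G₁ τ x τ) = G₁ := by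
      ext x; rw [hχ1 τ le_rfl]; simp [backFst]
    have f2 : toL2 (fun x => χ τ * backSnd S G₁ G₂ τ x τ) = toL2 G₂ := by
      refine toL2_congr fun x hx => ?_
      have : -(S.ε₁ / S.ε₂) * x ∉ Ioo (0 : ℝ) 1 := fun h => by
        have : 0 ≤ S.ε₁ / S.ε₂ * x := mul_nonneg (by positivity) hx.1
        linarith [h.1]
      simp only [hχ1 τ le_rfl, backSnd, sub_self, mul_zero, zero_add, one_mul,
        eq_zero_of_notMem_Ioo hs₁ this, add_zero]
    have f3 : ∀ t ≤ τ, (fun x => χ t * backFst S G₁ τ x t) = fun x => backFst S G₁ τ x t :=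
      fun t ht => by ext x; rw [hχ1 t ht, one_mul]
    have f4 : ∀ t ≤ τ, (fun x => χ t * backSnd S G₁ G₂ τ x t) = fun x => backSnd S G₁ G₂ τ x t :=
      fun t ht => by ext x; rw [hχ1 t ht, one_mul]
    rw [f1, f2, f3 s hτ.1, f4 s hτ.1] at key
    have f5 : (∫ t in s..τ, S.ε₂ * (χ t * backSnd S G₁ G₂ τ 1 t) * U t)
        = ∫ t in s..τ, S.ε₂ * backSnd S G₁ G₂ τ 1 t * U t := by
      refine intervalIntegral.integral_congr fun t ht => ?_
      rw [uIcc_of_le hτ.1] at ht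
      simp only [hχ1 t ht.2, one_mul]
    rw [f5] at key
    rw [sub_eq_iff_eq_add] at key
    rw [key]
    have f6 : (∫ t in s..τ, (inner ℝ (u t) (toL2 fun x => adjFst S
            (fun x t => deriv (fun x' => χ t * backFst S G₁ τ x' t) x)
            (fun x t => deriv (fun t' => χ t' * backFst S G₁ τ x t') t)
            (fun x t => χ t * backSnd S G₁ G₂ τ x t) x t)
          + inner ℝ (v t) (toL2 fun x => adjSnd S
            (fun x t => deriv (fun x' => χ t * backSnd S G₁ G₂ τ x' t) x)
            (fun x t => deriv (fun t' => χ t' * backSnd S G₁ G₂ τ x t') t)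
            (fun x t => χ t * backFst S G₁ τ x t) x t)))
        = ∫ t in s..τ, (inner ℝ (mulL2 S.c₂ S.c₂_cont (u t)) (toL2 fun x => backSnd S G₁ G₂ τ x t)
          + inner ℝ (mulL2 S.c₁ S.c₁_cont (v t)) (toL2 fun x => backFst S G₁ τ x t)) := by
      refine intervalIntegral.integral_congr_ae ?_
      filter_upwards [Measure.ae_ne volume τ] with t htτ ht
      rw [uIoc_of_le hτ.1] at ht
      have ht' : t < τ := lt_of_le_of_ne ht.2 htτ
      have g1 : ContinuousOn (fun x => backFst S G₁ τ x t) (Icc 0 1) :=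
        ((contDiff_backFst h₁).continuous.comp (Continuous.prodMk_left t)).continuousOn
      have g2 : ContinuousOn (fun x => backSnd S G₁ G₂ τ x t) (Icc 0 1) :=
        ((contDiff_backSnd h₁ h₂).continuous.comp (Continuous.prodMk_left t)).continuousOn
      have hev : ∀ᶠ t' in 𝓝 t, χ t' = 1 := by
        filter_upwards [Iio_mem_nhds ht'] with t' h' using hχ1 t' (le_of_lt h')
      rw [inner_mulL2 S.c₂_cont g2, inner_mulL2 S.c₁_cont g1]
      congr 3
      · ext x
        have hd : deriv (fun t' => χ t' * backFst S G₁ τ x t') t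
            = deriv (fun t' => backFst S G₁ τ x t') t := by
          refine Filter.EventuallyEq.deriv_eq ?_
          filter_upwards [hev] with t' h'
          rw [h', one_mul]
        have := deriv_backFst (S := S) (τ := τ) h₁ x t
        simp only [adjFst, hd, hχ1 t ht'.le, one_mul]
        linarith
      · ext x
        have hd : deriv (fun t' => χ t' * backSnd S G₁ G₂ τ x t') t
            = deriv (fun t' => backSnd S G₁ G₂ τ x t') t := by
          refine Filter.EventuallyEq.deriv_eq ?_
          filter_upwards [hev] with t' h'
          rw [h', one_mul]
        have := deriv_backSnd (S := S) (τ := τ) h₁ h₂ x t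
        simp only [adjSnd, hd, hχ1 t ht'.le, one_mul]
        linarith
    rw [f6]
    ring
  · rcases lt_or_ge t (τ + δ) with ht | ht
    · have h1 : S.ε₁ * (t - τ) < S.ε₁ * δ := mul_lt_mul_of_pos_left (by linarith) hε₁
      have : backFst S G₁ τ 1 t = 0 := hz₁ _ (Or.inr (by linarith))
      rw [this, mul_zero]
    · rw [hχ0 t ht, zero_mul]
  · rcases lt_or_ge t (τ + δ) with ht | ht
    · have h1 : S.ε₂ * (t - τ) < S.ε₂ * δ := mul_lt_mul_of_pos_left (by linarith) hε₂
      have : G₂ (-S.ε₂ * (τ - t) + 1 * 0) = 0 := hz₂ _ (Or.inl (by linarith))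
      simp only [backSnd, backFst]
      rw [this]
      simp only [mul_zero, add_zero, zero_add]
      field_simp
    · rw [hχ0 t ht, zero_mul, zero_mul, mul_zero, mul_zero]

/-- The solution of the uncoupled adjoint equation is bounded in `L²([0,1])`, and so is its trace
at `x = 1` in `L²` of the time interval. -/
lemma exists_back_bound (S : Problem) : ∃ B, 0 ≤ B ∧ ∀ {G₁ G₂ : ℝ → ℝ},
    ContDiff ℝ (⊤ : ℕ∞) G₁ → HasCompactSupport G₁ → tsupport G₁ ⊆ Ioo (0 : ℝ) 1 →
    ContDiff ℝ (⊤ : ℕ∞) G₂ → HasCompactSupport G₂ → tsupport G₂ ⊆ Ioo (0 : ℝ) 1 →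
    (∀ τ t, ‖toL2 fun x => backFst S G₁ τ x t‖ ^ 2 ≤ B * (‖toL2 G₁‖ ^ 2 + ‖toL2 G₂‖ ^ 2)) ∧
    (∀ τ t, ‖toL2 fun x => backSnd S G₁ G₂ τ x t‖ ^ 2 ≤ B * (‖toL2 G₁‖ ^ 2 + ‖toL2 G₂‖ ^ 2)) ∧
    (∀ s τ, s ≤ τ → ∫ t in s..τ, backSnd S G₁ G₂ τ 1 t ^ 2
      ≤ B * (‖toL2 G₁‖ ^ 2 + ‖toL2 G₂‖ ^ 2)) := by
  have hε₁ := S.ε₁_pos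
  have hε₂ := S.ε₂_pos
  set k : ℝ := S.q * S.ε₁ / S.ε₂ with hk
  set r : ℝ := S.ε₁ / S.ε₂ with hr
  have hr0 : 0 < r := by positivity
  refine ⟨1 + (2 + 2 * k ^ 2 * r⁻¹) + (2 * S.ε₂⁻¹ + 2 * k ^ 2 * S.ε₁⁻¹), by positivity, ?_⟩
  intro G₁ G₂ h₁ hc₁ hs₁ h₂ hc₂ hs₂
  have i1 : 0 < S.ε₁⁻¹ := by positivity
  have i2 : 0 < S.ε₂⁻¹ := by positivity
  have i3 : 0 < r⁻¹ := by positivity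
  have hn₁ := norm_toL2_sq h₁.continuous.continuousOn
  have hn₂ := norm_toL2_sq h₂.continuous.continuousOn
  have N1 : 0 ≤ ‖toL2 G₁‖ ^ 2 := by positivity
  have N2 : 0 ≤ ‖toL2 G₂‖ ^ 2 := by positivity
  -- the square of a sum, integrated over any set on which both summands are square integrable
  have hsum : ∀ (A : Set ℝ) (b b' κ κ' : ℝ), κ ≠ 0 → κ' ≠ 0 →
      IntegrableOn (fun x => G₂ (b + κ * x) ^ 2) A → IntegrableOn (fun x => G₁ (b' + κ' * x) ^ 2) A →
      IntegrableOn (fun x => (G₂ (b + κ * x) + k * G₁ (b' + κ' * x)) ^ 2) A →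
      ∫ x in A, (G₂ (b + κ * x) + k * G₁ (b' + κ' * x)) ^ 2
        ≤ 2 * (|κ|⁻¹ * ‖toL2 G₂‖ ^ 2) + 2 * k ^ 2 * (|κ'|⁻¹ * ‖toL2 G₁‖ ^ 2) := by
    intro A b b' κ κ' hκ hκ' j2 j1 j
    calc ∫ x in A, (G₂ (b + κ * x) + k * G₁ (b' + κ' * x)) ^ 2
        ≤ ∫ x in A, (2 * G₂ (b + κ * x) ^ 2 + 2 * k ^ 2 * G₁ (b' + κ' * x) ^ 2) := by
          refine integral_mono j ((j2.const_mul 2).add (j1.const_mul (2 * k ^ 2))) fun x => ?_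
          nlinarith [sq_nonneg (G₂ (b + κ * x) - k * G₁ (b' + κ' * x))]
      _ = 2 * (∫ x in A, G₂ (b + κ * x) ^ 2) + 2 * k ^ 2 * ∫ x in A, G₁ (b' + κ' * x) ^ 2 := by
          rw [integral_add (j2.const_mul 2) (j1.const_mul (2 * k ^ 2)), integral_const_mul,
            integral_const_mul]
      _ ≤ _ := by
          rw [hn₁, hn₂]
          have e2 := setIntegral_comp_affine_sq_le h₂.continuous hc₂ hs₂ b hκ A
          have e1 := setIntegral_comp_affine_sq_le h₁.continuous hc₁ hs₁ b' hκ' A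
          gcongr
  have hint : ∀ {f : ℝ → ℝ} (a b : ℝ), Continuous f → IntegrableOn f (Icc a b) := fun a b hf =>
    hf.continuousOn.integrableOn_Icc
  have cont₁ := h₁.continuous
  have cont₂ := h₂.continuous
  refine ⟨fun τ t => ?_, fun τ t => ?_, fun s τ hsτ => ?_⟩
  · have g1 : ContinuousOn (fun x => backFst S G₁ τ x t) (Icc 0 1) :=
      ((contDiff_backFst h₁).continuous.comp (Continuous.prodMk_left t)).continuousOn
    rw [norm_toL2_sq g1]
    have := setIntegral_comp_affine_sq_le h₁.continuous hc₁ hs₁ (S.ε₁ * (τ - t)) one_ne_zero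
      (Icc (0 : ℝ) 1)
    rw [← hn₁] at this
    simp only [abs_one, inv_one, one_mul] at this
    refine (le_of_eq ?_).trans (this.trans ?_)
    · simp only [backFst, one_mul]
    · have : 0 ≤ k ^ 2 * r⁻¹ := by positivity
      have : 0 ≤ k ^ 2 * S.ε₁⁻¹ := by positivity
      nlinarith
  · have g2 : ContinuousOn (fun x => backSnd S G₁ G₂ τ x t) (Icc 0 1) :=
      ((contDiff_backSnd h₁ h₂).continuous.comp (Continuous.prodMk_left t)).continuousOn
    rw [norm_toL2_sq g2]
    have := hsum (Icc 0 1) (-S.ε₂ * (τ - t)) (S.ε₁ * (τ - t)) 1 (-r) one_ne_zero (by linarith)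
      (hint _ _ (by fun_prop)) (hint _ _ (by fun_prop)) (hint _ _ (by fun_prop))
    refine this.trans ?_
    rw [abs_one, abs_neg, abs_of_pos hr0, inv_one, one_mul]
    have a1 : 0 ≤ k ^ 2 * r⁻¹ := by positivity
    have a2 : 0 ≤ k ^ 2 * S.ε₁⁻¹ := by positivity
    have a3 := mul_nonneg a1 N2
    have a4 := mul_nonneg a2 N1
    have a5 := mul_nonneg a2 N2
    have a6 := mul_nonneg i2.le N1
    have a7 := mul_nonneg i2.le N2
    nlinarith
  · have hh := hsum (Icc s τ) (-S.ε₂ * τ + 1) (S.ε₁ * τ - r) S.ε₂ (-S.ε₁) hε₂.ne'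
      (by linarith) (hint _ _ (by fun_prop)) (hint _ _ (by fun_prop)) (hint _ _ (by fun_prop))
    rw [intervalIntegral.integral_of_le hsτ, ← integral_Icc_eq_integral_Ioc]
    refine (le_of_eq ?_).trans (hh.trans ?_)
    · congr 1; ext t
      simp only [backSnd]
      congr 3
      · ring
      · congr 1; ring
    rw [abs_neg, abs_of_pos hε₁, abs_of_pos hε₂]
    have a1 : 0 ≤ k ^ 2 * r⁻¹ := by positivity
    have a2 : 0 ≤ k ^ 2 * S.ε₁⁻¹ := by positivity
    have a3 := mul_nonneg a1 N2
    have a3' := mul_nonneg a1 N1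
    have a5 := mul_nonneg a2 N2
    have a6 := mul_nonneg i2.le N1
    nlinarith

end Energy

section Energy

variable {S : Problem} {s : ℝ} {u₀ v₀ : L2} {u v : ℝ → L2} {U : ℝ → ℝ} {τ : ℝ}

lemma inner_le_sq_add_sq {E : Type*} [NormedAddCommGroup E] [InnerProductSpace ℝ E] (a b : E) :
    inner ℝ a b ≤ ‖a‖ ^ 2 + ‖b‖ ^ 2 := by
  have := real_inner_le_norm a b
  nlinarith [sq_nonneg (‖a‖ - ‖b‖), sq_nonneg (‖a‖), sq_nonneg ‖b‖]

/-- Trajectories are controlled by their initial state, their own history and their control. The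
weak formulation is tested with solutions of the uncoupled adjoint equation, which gives the bound
in duality with smooth functions. -/
lemma exists_energy_estimate (S : Problem) : ∃ C, 0 ≤ C ∧ ∀ {s : ℝ}, s ∈ Ico 0 S.T →
    ∀ {u₀ v₀ : L2} {u v : ℝ → L2} {U : ℝ → ℝ}, IsTrajectory S s u₀ v₀ u v U →
    ∀ τ ∈ Icc s S.T, ‖u τ‖ ^ 2 + ‖v τ‖ ^ 2
      ≤ C * (‖u₀‖ ^ 2 + ‖v₀‖ ^ 2 + (∫ t in s..τ, (‖u t‖ ^ 2 + ‖v t‖ ^ 2))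
        + ∫ t in s..τ, U t ^ 2) := by
  obtain ⟨B, hB, hbound⟩ := exists_back_bound S
  set m₁ : ℝ := ‖mulL2 S.c₁ S.c₁_cont‖
  set m₂ : ℝ := ‖mulL2 S.c₂ S.c₂_cont‖
  set K : ℝ := 1 + m₁ ^ 2 + m₂ ^ 2 + 2 * B + 2 * S.T * B + S.ε₂ ^ 2 * B with hK
  have hT := S.T_pos
  have hTB : 0 ≤ S.T * B := by positivity
  have hεB : 0 ≤ S.ε₂ ^ 2 * B := by positivity
  have hK1 : 1 ≤ K := by rw [hK]; nlinarith [sq_nonneg m₁, sq_nonneg m₂]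
  refine ⟨4 * K ^ 2, by positivity, ?_⟩
  intro s hs u₀ v₀ u v U h τ hτ
  have hnu : ContinuousOn (fun t => ‖u t‖ ^ 2 + ‖v t‖ ^ 2) (Icc s S.T) :=
    (h.cont_u.norm.pow 2).add (h.cont_v.norm.pow 2)
  set I₁ : ℝ := ∫ t in s..τ, (‖u t‖ ^ 2 + ‖v t‖ ^ 2) with hI₁
  set I₂ : ℝ := ∫ t in s..τ, U t ^ 2 with hI₂
  have hI₁0 : 0 ≤ I₁ := intervalIntegral.integral_nonneg hτ.1 fun t _ => by positivity
  have hI₂0 : 0 ≤ I₂ := intervalIntegral.integral_nonneg hτ.1 fun t _ => by positivity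
  set D : ℝ := ‖u₀‖ ^ 2 + ‖v₀‖ ^ 2 + I₁ + I₂ with hD
  have smooth : ∀ G₁ G₂ : ℝ → ℝ,
      ContDiff ℝ (⊤ : ℕ∞) G₁ → HasCompactSupport G₁ → tsupport G₁ ⊆ Ioo (0 : ℝ) 1 →
      ContDiff ℝ (⊤ : ℕ∞) G₂ → HasCompactSupport G₂ → tsupport G₂ ⊆ Ioo (0 : ℝ) 1 →
      inner ℝ (u τ) (toL2 G₁) + inner ℝ (v τ) (toL2 G₂)
        ≤ K * D + K * (‖toL2 G₁‖ ^ 2 + ‖toL2 G₂‖ ^ 2) := by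
    intro G₁ G₂ h₁ hc₁ hs₁ h₂ hc₂ hs₂
    obtain ⟨b1, b2, b3⟩ := hbound h₁ hc₁ hs₁ h₂ hc₂ hs₂
    set N : ℝ := ‖toL2 G₁‖ ^ 2 + ‖toL2 G₂‖ ^ 2 with hN
    have hN0 : 0 ≤ N := by positivity
    have hBN : 0 ≤ B * N := by positivity
    rw [h.inner_contDiff hs.2 hτ h₁ hs₁ h₂ hs₂]
    have t1 := (inner_le_sq_add_sq u₀ (toL2 fun x => backFst S G₁ τ x s)).trans
      (add_le_add_right (b1 τ s) _)
    have t2 := (inner_le_sq_add_sq v₀ (toL2 fun x => backSnd S G₁ G₂ τ x s)).trans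
      (add_le_add_right (b2 τ s) _)
    have cF : ContinuousOn (fun t => toL2 fun x => backFst S G₁ τ x t) (Icc s S.T) :=
      continuousOn_toL2_slice (contDiff_backFst h₁).continuous.continuousOn
    have cS : ContinuousOn (fun t => toL2 fun x => backSnd S G₁ G₂ τ x t) (Icc s S.T) :=
      continuousOn_toL2_slice (contDiff_backSnd h₁ h₂).continuous.continuousOn
    have t3 : (∫ t in s..τ,
          (inner ℝ (mulL2 S.c₂ S.c₂_cont (u t)) (toL2 fun x => backSnd S G₁ G₂ τ x t)
          + inner ℝ (mulL2 S.c₁ S.c₁_cont (v t)) (toL2 fun x => backFst S G₁ τ x t)))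
        ≤ ∫ t in s..τ, ((m₁ ^ 2 + m₂ ^ 2) * (‖u t‖ ^ 2 + ‖v t‖ ^ 2) + 2 * (B * N)) := by
      refine intervalIntegral.integral_mono_on hτ.1 ?_ ?_ fun t _ => ?_
      · refine intervalIntegrable_of_continuousOn (ContinuousOn.add ?_ ?_) hτ
        · exact ((mulL2 S.c₂ S.c₂_cont).continuous.comp_continuousOn h.cont_u).inner cS
        · exact ((mulL2 S.c₁ S.c₁_cont).continuous.comp_continuousOn h.cont_v).inner cF
      · exact intervalIntegrable_of_continuousOn
          ((continuousOn_const.mul hnu).add continuousOn_const) hτ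
      · have e1 := (inner_le_sq_add_sq (mulL2 S.c₂ S.c₂_cont (u t))
          (toL2 fun x => backSnd S G₁ G₂ τ x t)).trans (add_le_add_right (b2 τ t) _)
        have e2 := (inner_le_sq_add_sq (mulL2 S.c₁ S.c₁_cont (v t))
          (toL2 fun x => backFst S G₁ τ x t)).trans (add_le_add_right (b1 τ t) _)
        have e3 : ‖mulL2 S.c₂ S.c₂_cont (u t)‖ ^ 2 ≤ m₂ ^ 2 * ‖u t‖ ^ 2 := by
          rw [← mul_pow]; gcongr; exact ContinuousLinearMap.le_opNorm _ _
        have e4 : ‖mulL2 S.c₁ S.c₁_cont (v t)‖ ^ 2 ≤ m₁ ^ 2 * ‖v t‖ ^ 2 := by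
          rw [← mul_pow]; gcongr; exact ContinuousLinearMap.le_opNorm _ _
        have e5 : 0 ≤ m₁ ^ 2 * ‖u t‖ ^ 2 := by positivity
        have e6 : 0 ≤ m₂ ^ 2 * ‖v t‖ ^ 2 := by positivity
        linarith
    have t3' : ∫ t in s..τ, ((m₁ ^ 2 + m₂ ^ 2) * (‖u t‖ ^ 2 + ‖v t‖ ^ 2) + 2 * (B * N))
        ≤ (m₁ ^ 2 + m₂ ^ 2) * I₁ + 2 * (S.T * B * N) := by
      have i1 : IntervalIntegrable (fun t => (m₁ ^ 2 + m₂ ^ 2) * (‖u t‖ ^ 2 + ‖v t‖ ^ 2))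
          volume s τ := intervalIntegrable_of_continuousOn (continuousOn_const.mul hnu) hτ
      rw [intervalIntegral.integral_add i1 intervalIntegrable_const, intervalIntegral.integral_const_mul,
        intervalIntegral.integral_const, smul_eq_mul]
      have : (τ - s) * (2 * (B * N)) ≤ S.T * (2 * (B * N)) :=
        mul_le_mul_of_nonneg_right (by linarith [hτ.2, hs.1]) (by positivity)
      linarith
    have cb : ContinuousOn (fun t => S.ε₂ * backSnd S G₁ G₂ τ 1 t) (Icc s S.T) :=
      continuousOn_const.mul (slice_right (b := S.T) (a := s) (f := backSnd S G₁ G₂ τ)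
        (contDiff_backSnd h₁ h₂).continuous.continuousOn (by simp))
    have iU := intervalIntegrable_control_sq h.control hτ
    have ib : IntervalIntegrable (fun t => backSnd S G₁ G₂ τ 1 t ^ 2) volume s τ :=
      intervalIntegrable_of_continuousOn ((slice_right (b := S.T) (a := s) (f := backSnd S G₁ G₂ τ)
        (contDiff_backSnd h₁ h₂).continuous.continuousOn (by simp)).pow 2) hτ
    have t4 : (∫ t in s..τ, S.ε₂ * backSnd S G₁ G₂ τ 1 t * U t)
        ≤ ∫ t in s..τ, (U t ^ 2 + S.ε₂ ^ 2 * backSnd S G₁ G₂ τ 1 t ^ 2) := by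
      refine intervalIntegral.integral_mono_on hτ.1 (intervalIntegrable_mul_control cb h.control hτ)
        (iU.add (ib.const_mul _)) fun t _ => ?_
      nlinarith [sq_nonneg (S.ε₂ * backSnd S G₁ G₂ τ 1 t - U t),
        sq_nonneg (S.ε₂ * backSnd S G₁ G₂ τ 1 t), sq_nonneg (U t)]
    have t4' : (∫ t in s..τ, (U t ^ 2 + S.ε₂ ^ 2 * backSnd S G₁ G₂ τ 1 t ^ 2))
        ≤ I₂ + S.ε₂ ^ 2 * (B * N) := by
      rw [intervalIntegral.integral_add iU (ib.const_mul _), intervalIntegral.integral_const_mul]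
      have := b3 s τ hτ.1
      gcongr
    have f1 : K * D = (‖u₀‖ ^ 2 + ‖v₀‖ ^ 2) * K + I₁ * K + I₂ * K := by rw [hD]; ring
    have f2 : ‖u₀‖ ^ 2 + ‖v₀‖ ^ 2 ≤ (‖u₀‖ ^ 2 + ‖v₀‖ ^ 2) * K :=
      le_mul_of_one_le_right (by positivity) hK1
    have f3 : (m₁ ^ 2 + m₂ ^ 2) * I₁ ≤ I₁ * K := by
      rw [mul_comm]
      exact mul_le_mul_of_nonneg_left (by rw [hK]; linarith) hI₁0
    have f4 : I₂ ≤ I₂ * K := le_mul_of_one_le_right hI₂0 hK1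
    have f5 : 2 * (B * N) + 2 * (S.T * B * N) + S.ε₂ ^ 2 * (B * N) ≤ K * N := by
      have : 0 ≤ (1 + m₁ ^ 2 + m₂ ^ 2) * N := by positivity
      rw [hK]; linarith
    linarith
  have dense : ∀ g₁ g₂ : L2, inner ℝ (u τ) g₁ + inner ℝ (v τ) g₂
      ≤ K * D + K * (‖g₁‖ ^ 2 + ‖g₂‖ ^ 2) := by
    intro g₁ g₂
    have hcl : IsClosed {p : L2 × L2 | inner ℝ (u τ) p.1 + inner ℝ (v τ) p.2
        ≤ K * D + K * (‖p.1‖ ^ 2 + ‖p.2‖ ^ 2)} :=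
      isClosed_le (by fun_prop) (by fun_prop)
    have hd := dense_toL2_contDiff.prod dense_toL2_contDiff
    refine closure_minimal ?_ hcl (hd (g₁, g₂))
    rintro ⟨_, _⟩ ⟨⟨G₁, h₁, hc₁, hs₁, rfl⟩, ⟨G₂, h₂, hc₂, hs₂, rfl⟩⟩
    exact smooth G₁ G₂ h₁ hc₁ hs₁ h₂ hc₂ hs₂
  -- the choice of the dual elements balances the quadratic term on the right
  have hfin := dense ((2 * K)⁻¹ • u τ) ((2 * K)⁻¹ • v τ)
  rw [inner_smul_right, inner_smul_right, real_inner_self_eq_norm_sq, real_inner_self_eq_norm_sq,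
    norm_smul, norm_smul, mul_pow, mul_pow, Real.norm_eq_abs, sq_abs] at hfin
  have hK0 : 0 < K := by linarith
  set X : ℝ := ‖u τ‖ ^ 2 + ‖v τ‖ ^ 2 with hX
  have e1 : (2 * K)⁻¹ * X ≤ K * D + K * ((2 * K)⁻¹ ^ 2 * X) := by
    rw [hX]; linarith
  have e2 : K * ((2 * K)⁻¹ ^ 2 * X) = (4 * K)⁻¹ * X := by field_simp; ring
  have e3 : (2 * K)⁻¹ * X = 2 * ((4 * K)⁻¹ * X) := by field_simp; ring
  have e4 : (4 * K)⁻¹ * X ≤ K * D := by linarith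
  rw [inv_mul_le_iff₀ (by positivity)] at e4
  calc X ≤ 4 * K * (K * D) := e4
    _ = 4 * K ^ 2 * D := by ring

/-- Energy bound for trajectories whose control is bounded by the state. -/
lemma exists_feedback_bound (S : Problem) (κ : ℝ) : ∃ C, 0 ≤ C ∧ ∀ {s : ℝ}, s ∈ Ico 0 S.T →
    ∀ {u₀ v₀ : L2} {u v : ℝ → L2} {U : ℝ → ℝ}, IsTrajectory S s u₀ v₀ u v U →
    (∀ᵐ t ∂(volume.restrict (Icc s S.T)), U t ^ 2 ≤ κ * ‖v t‖ ^ 2) →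
    ∀ τ ∈ Icc s S.T, ‖u τ‖ ^ 2 + ‖v τ‖ ^ 2 ≤ C * (‖u₀‖ ^ 2 + ‖v₀‖ ^ 2) := by
  obtain ⟨C, hC, hest⟩ := exists_energy_estimate S
  have hT := S.T_pos
  refine ⟨C * Real.exp (C * (1 + |κ|) * S.T), by positivity, ?_⟩
  intro s hs u₀ v₀ u v U h hU τ hτ
  have hnu : ContinuousOn (fun t => ‖u t‖ ^ 2 + ‖v t‖ ^ 2) (Icc s S.T) :=
    (h.cont_u.norm.pow 2).add (h.cont_v.norm.pow 2)
  have hg := gronwall_integral (c := C * (‖u₀‖ ^ 2 + ‖v₀‖ ^ 2)) (K := C * (1 + |κ|)) hnu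
    (by positivity) (fun t ht => ?_) τ hτ
  · refine hg.trans ?_
    rw [mul_right_comm]
    have : τ - s ≤ S.T := by linarith [hτ.2, hs.1]
    gcongr
  · have h1 := hest hs h t ht
    have h2 : ∫ r in s..t, U r ^ 2 ≤ ∫ r in s..t, |κ| * (‖u r‖ ^ 2 + ‖v r‖ ^ 2) := by
      rw [intervalIntegral.integral_of_le ht.1, intervalIntegral.integral_of_le ht.1]
      have hsub : Ioc s t ⊆ Icc s S.T := Ioc_subset_Icc_self.trans (Icc_subset_Icc_right ht.2)
      refine integral_mono_ae (intervalIntegrable_control_sq h.control ht).1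
        (intervalIntegrable_of_continuousOn (continuousOn_const.mul hnu) ht).1 ?_
      filter_upwards [ae_restrict_of_ae_restrict_of_subset hsub hU] with r hr
      have e1 : κ * ‖v r‖ ^ 2 ≤ |κ| * ‖v r‖ ^ 2 :=
        mul_le_mul_of_nonneg_right (le_abs_self κ) (by positivity)
      have e2 : 0 ≤ |κ| * ‖u r‖ ^ 2 := by positivity
      linarith
    rw [intervalIntegral.integral_const_mul] at h2
    refine h1.trans ?_
    have := mul_le_mul_of_nonneg_left h2 hC
    linarith

/-- The state is determined by the initial state and the control: the difference of two states is a
trajectory with zero initial state and zero control. -/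
lemma IsTrajectory.unique {u' v' : ℝ → L2} {U' : ℝ → ℝ} (hs : s ∈ Ico 0 S.T)
    (h : IsTrajectory S s u₀ v₀ u v U) (h' : IsTrajectory S s u₀ v₀ u' v' U')
    (hU : ∀ᵐ t ∂(volume.restrict (Icc s S.T)), U' t = U t) :
    ∀ t ∈ Icc s S.T, u' t = u t ∧ v' t = v t := by
  intro t ht
  obtain ⟨C, -, hb⟩ := exists_feedback_bound S 0
  have hd := h'.add_const_mul hs.2 h (-1)
  have := hb hs hd (by filter_upwards [hU] with r hr; rw [hr]; simp) t ht
  simp only [neg_smul, one_smul, ← sub_eq_add_neg, sub_self, norm_zero] at this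
  have h1 : ‖u' t - u t‖ ^ 2 ≤ 0 := by nlinarith [sq_nonneg ‖v' t - v t‖]
  have h2 : ‖v' t - v t‖ ^ 2 ≤ 0 := by nlinarith [sq_nonneg ‖u' t - u t‖]
  constructor
  · exact sub_eq_zero.1 (norm_eq_zero.1 (pow_eq_zero_iff two_ne_zero |>.1 (le_antisymm h1 (sq_nonneg _))))
  · exact sub_eq_zero.1 (norm_eq_zero.1 (pow_eq_zero_iff two_ne_zero |>.1 (le_antisymm h2 (sq_nonneg _))))

end Energy

/-! ### Operators on `L²(ℝ)` -/

/-- The space `L²(ℝ)` of real-valued functions. -/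
abbrev LineL2 : Type := Lp ℝ 2 (volume : Measure ℝ)

section CompL2

variable {μ ν : Measure ℝ} {g : ℝ → ℝ} {A : Set ℝ} {c : ENNReal}

lemma memLp_indicator_comp (hg : Measurable g) (hA : MeasurableSet A) (hc : c ≠ ⊤)
    (h : (μ.restrict A).map g ≤ c • ν) (f : Lp ℝ 2 ν) :
    MemLp (A.indicator fun x => f (g x)) 2 μ := by
  rw [memLp_indicator_iff_restrict hA]
  have h1 : MemLp f 2 ((μ.restrict A).map g) := ((Lp.memLp f).smul_measure hc).mono_measure h
  exact h1.comp_of_map hg.aemeasurable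

lemma ae_comp_of_ae (hg : Measurable g) (hA : MeasurableSet A)
    (h : (μ.restrict A).map g ≤ c • ν) {p : ℝ → Prop} (hp : ∀ᵐ y ∂ν, p y) :
    ∀ᵐ x ∂μ, x ∈ A → p (g x) := by
  have h1 : ∀ᵐ y ∂((μ.restrict A).map g), p y :=
    (Measure.absolutelyContinuous_of_le_smul h).ae_le hp
  exact (ae_restrict_iff' hA).1 (ae_of_ae_map hg.aemeasurable h1)

/-- Composition with `g` on the set `A`, extended by zero, as a bounded operator of `L²` spaces; the
hypothesis on the image of the measure makes it well defined and bounded. -/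
def compL2 (μ ν : Measure ℝ) (g : ℝ → ℝ) (A : Set ℝ) (c : ENNReal) (hg : Measurable g)
    (hA : MeasurableSet A) (hc : c ≠ ⊤) (h : (μ.restrict A).map g ≤ c • ν) :
    Lp ℝ 2 ν →L[ℝ] Lp ℝ 2 μ :=
  LinearMap.mkContinuousOfExistsBound
    { toFun := fun f => (memLp_indicator_comp hg hA hc h f).toLp _
      map_add' := fun f f' => by
        rw [← MemLp.toLp_add, MemLp.toLp_eq_toLp_iff]
        filter_upwards [ae_comp_of_ae hg hA h (Lp.coeFn_add f f')] with x hx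
        by_cases hxA : x ∈ A
        · simp only [Pi.add_apply, indicator_of_mem hxA]
          exact hx hxA
        · simp [hxA]
      map_smul' := fun a f => by
        rw [RingHom.id_apply, ← MemLp.toLp_const_smul, MemLp.toLp_eq_toLp_iff]
        filter_upwards [ae_comp_of_ae hg hA h (Lp.coeFn_smul a f)] with x hx
        by_cases hxA : x ∈ A
        · simp [hxA, hx hxA]
        · simp [hxA] }
    (by
      refine ⟨(c ^ (1 / (2 : ENNReal)).toReal).toReal, fun f => ?_⟩
      simp only [LinearMap.coe_mk, AddHom.coe_mk]
      rw [Lp.norm_toLp, Lp.norm_def, ← ENNReal.toReal_mul]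
      refine ENNReal.toReal_mono (ENNReal.mul_ne_top
        (ENNReal.rpow_ne_top_of_nonneg (by positivity) hc) (Lp.eLpNorm_ne_top f)) ?_
      rw [eLpNorm_indicator_eq_eLpNorm_restrict hA]
      calc eLpNorm (fun x => f (g x)) 2 (μ.restrict A)
          = eLpNorm f 2 ((μ.restrict A).map g) :=
            (eLpNorm_map_measure ((((Lp.memLp f).smul_measure hc).mono_measure h).1)
              hg.aemeasurable).symm
        _ ≤ eLpNorm f 2 (c • ν) := eLpNorm_mono_measure _ h
        _ ≤ _ := by
          exact eLpNorm_smul_measure_le c f 2 ν)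

lemma coeFn_compL2 (hg : Measurable g) (hA : MeasurableSet A) (hc : c ≠ ⊤)
    (h : (μ.restrict A).map g ≤ c • ν) (f : Lp ℝ 2 ν) :
    compL2 μ ν g A c hg hA hc h f =ᵐ[μ] A.indicator fun x => f (g x) :=
  (memLp_indicator_comp hg hA hc h f).coeFn_toLp

end CompL2

lemma map_mul_unitMeasure_le {k : ℝ} (hk : k ≠ 0) :
    (unitMeasure.restrict univ).map (fun x => k * x) ≤ ENNReal.ofReal |k⁻¹| • volume := by
  rw [← Real.map_volume_mul_left hk, Measure.restrict_univ]
  exact Measure.map_mono Measure.restrict_le_self (by fun_prop)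

/-- Sampling a function on the line: `(sample k A)(x) = A(k x)` for `x ∈ [0,1]`. -/
def sample {k : ℝ} (hk : k ≠ 0) : LineL2 →L[ℝ] L2 :=
  compL2 unitMeasure volume (fun x => k * x) univ _ (by fun_prop) MeasurableSet.univ
    ENNReal.ofReal_ne_top (map_mul_unitMeasure_le hk)

lemma coeFn_sample {k : ℝ} (hk : k ≠ 0) (A : LineL2) :
    sample hk A =ᵐ[unitMeasure] fun x => A (k * x) := by
  have := coeFn_compL2 (g := fun x => k * x) (by fun_prop) MeasurableSet.univ
    ENNReal.ofReal_ne_top (map_mul_unitMeasure_le hk) A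
  rwa [indicator_univ] at this

lemma ae_unitMeasure_mul {k : ℝ} (hk : k ≠ 0) {p : ℝ → Prop} (hp : ∀ᵐ σ, p σ) :
    ∀ᵐ x ∂unitMeasure, p (k * x) := by
  have := ae_comp_of_ae (g := fun x => k * x) (by fun_prop) MeasurableSet.univ
    (map_mul_unitMeasure_le hk) hp
  simpa using this

lemma measurableSet_mul_mem_Icc (k : ℝ) : MeasurableSet {σ : ℝ | k⁻¹ * σ ∈ Icc (0 : ℝ) 1} :=
  measurableSet_Icc.preimage (by fun_prop : Measurable fun σ : ℝ => k⁻¹ * σ)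

lemma map_mul_volume_le {k : ℝ} (hk : k ≠ 0) :
    (volume.restrict {σ : ℝ | k⁻¹ * σ ∈ Icc (0 : ℝ) 1}).map (fun σ => k⁻¹ * σ)
      ≤ ENNReal.ofReal |k| • unitMeasure := by
  have h := Measure.restrict_map (μ := volume) (f := fun σ : ℝ => k⁻¹ * σ) (by fun_prop)
    (measurableSet_Icc (a := (0 : ℝ)) (b := 1))
  rw [Real.map_volume_mul_left (inv_ne_zero hk), inv_inv, Measure.restrict_smul] at h
  exact h.ge

/-- Spreading a function on `[0,1]` over the line: `(spread k f)(σ) = f(σ / k)` if `σ / k ∈ [0,1]`,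
and `0` otherwise. -/
def spread {k : ℝ} (hk : k ≠ 0) : L2 →L[ℝ] LineL2 :=
  compL2 volume unitMeasure (fun σ => k⁻¹ * σ) {σ : ℝ | k⁻¹ * σ ∈ Icc (0 : ℝ) 1} _ (by fun_prop)
    (measurableSet_mul_mem_Icc k) ENNReal.ofReal_ne_top (map_mul_volume_le hk)

lemma coeFn_spread {k : ℝ} (hk : k ≠ 0) (f : L2) :
    spread hk f =ᵐ[volume] {σ : ℝ | k⁻¹ * σ ∈ Icc (0 : ℝ) 1}.indicator fun σ => f (k⁻¹ * σ) :=
  coeFn_compL2 _ _ _ _ f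

lemma sample_spread {k : ℝ} (hk : k ≠ 0) (f : L2) : sample hk (spread hk f) = f := by
  apply Lp.ext
  filter_upwards [coeFn_sample hk (spread hk f), ae_unitMeasure_mul hk (coeFn_spread hk f),
    ae_unitMeasure_mem] with x h1 h2 hx
  have h3 : k⁻¹ * (k * x) = x := by field_simp
  rw [h1, h2, indicator_of_mem (by simpa only [mem_ofPred_eq, h3] using hx), h3]

lemma sample_spread_of_neg {k k' : ℝ} (hk : k ≠ 0) (hk' : k' ≠ 0) (h : k'⁻¹ * k < 0) (f : L2) :
    sample hk (spread hk' f) = 0 := by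
  apply Lp.ext
  filter_upwards [coeFn_sample hk (spread hk' f), ae_unitMeasure_mul hk (coeFn_spread hk' f),
    ae_unitMeasure_mem_Ioo, Lp.coeFn_zero ℝ 2 unitMeasure] with x h1 h2 hx h0
  rw [h1, h2, h0, indicator_of_notMem, Pi.zero_apply]
  rintro ⟨h3, -⟩
  rw [← mul_assoc] at h3
  nlinarith [hx.1]

/-- Translation on `L²(ℝ)`: `(translate t A)(σ) = A(σ - t)`. -/
def translate (t : ℝ) : LineL2 →L[ℝ] LineL2 :=
  (Lp.compMeasurePreservingₗᵢ ℝ (fun σ => σ - t)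
    (measurePreserving_sub_right volume t)).toContinuousLinearMap

lemma coeFn_translate (t : ℝ) (A : LineL2) : translate t A =ᵐ[volume] fun σ => A (σ - t) :=
  Lp.coeFn_compMeasurePreserving A (measurePreserving_sub_right volume t)

lemma continuous_translate : Continuous fun p : ℝ × LineL2 => translate p.1 p.2 := by
  let g : ℝ × LineL2 → C(ℝ, ℝ) := fun p => ⟨fun σ => σ - p.1, by fun_prop⟩
  have hg : Continuous g :=
    ContinuousMap.continuous_of_continuous_uncurry g (by
      simp only [g, Function.uncurry_def, ContinuousMap.coe_mk]; fun_prop)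
  exact Continuous.compMeasurePreservingLp (μ := volume) (ν := volume) continuous_snd hg
    (fun p => measurePreserving_sub_right volume p.1) (by simp)

lemma translate_translate (t t' : ℝ) (A : LineL2) :
    translate t (translate t' A) = translate (t + t') A := by
  apply Lp.ext
  have h := (measurePreserving_sub_right (volume : Measure ℝ) t).quasiMeasurePreserving.ae
    (coeFn_translate t' A)
  filter_upwards [coeFn_translate t (translate t' A), h, coeFn_translate (t + t') A]
    with σ h1 h2 h3
  rw [h1, h2, h3]; congr 1; ring

lemma translate_zero (A : LineL2) : translate 0 A = A := by
  apply Lp.ext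
  filter_upwards [coeFn_translate 0 A] with σ h1
  rw [h1, sub_zero]

/-- Reflection on `L²(ℝ)`: `(reflect k A)(ξ) = A(k - ξ)`. -/
def reflect (k : ℝ) : LineL2 →ₗᵢ[ℝ] LineL2 :=
  Lp.compMeasurePreservingₗᵢ ℝ (fun ξ => k - ξ) (Measure.measurePreserving_sub_left volume k)

lemma coeFn_reflect (k : ℝ) (A : LineL2) : reflect k A =ᵐ[volume] fun ξ => A (k - ξ) :=
  Lp.coeFn_compMeasurePreserving A (Measure.measurePreserving_sub_left volume k)

open Classical in
/-- The class in `L²(ℝ)` of the function `g` on `[a,b]` extended by zero; it is `0` if `g` is not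
square integrable on `[a,b]`. -/
def signal (a b : ℝ) (g : ℝ → ℝ) : LineL2 :=
  if h : MemLp ((Icc a b).indicator g) 2 volume then h.toLp _ else 0

lemma coeFn_signal {a b : ℝ} {g : ℝ → ℝ} (hg : MemLp g 2 (volume.restrict (Icc a b))) :
    signal a b g =ᵐ[volume] (Icc a b).indicator g := by
  have h := (memLp_indicator_iff_restrict measurableSet_Icc).2 hg
  rw [signal, dif_pos h]
  exact h.coeFn_toLp

lemma memLp_Icc_of_continuousOn {a b : ℝ} {g : ℝ → ℝ} (hg : ContinuousOn g (Icc a b)) :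
    MemLp g 2 (volume.restrict (Icc a b)) := by
  obtain ⟨C, hC⟩ := isCompact_Icc.exists_bound_of_continuousOn hg
  refine MemLp.of_bound (hg.aestronglyMeasurable measurableSet_Icc) C ?_
  filter_upwards [ae_restrict_mem measurableSet_Icc] with x hx using hC x hx

lemma lineInner_eq_integral (f g : LineL2) : inner ℝ f g = ∫ x, f x * g x := by
  rw [L2.inner_def]; simp [mul_comm]

lemma norm_signal_sq {a b : ℝ} {g : ℝ → ℝ} (hg : MemLp g 2 (volume.restrict (Icc a b))) :
    ‖signal a b g‖ ^ 2 = ∫ t in Icc a b, g t ^ 2 := by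
  rw [← real_inner_self_eq_norm_sq, lineInner_eq_integral, ← integral_indicator measurableSet_Icc]
  refine integral_congr_ae ?_
  filter_upwards [coeFn_signal hg] with x hx
  by_cases h : x ∈ Icc a b
  · simp [hx, h, sq]
  · simp [hx, h]

/-! ### Transport on the line -/

lemma integral_unitMeasure (f : ℝ → ℝ) : ∫ x, f x ∂unitMeasure = ∫ x in (0 : ℝ)..1, f x := by
  rw [intervalIntegral.integral_of_le zero_le_one, ← integral_Icc_eq_integral_Ioc]

lemma IsC1Rect.mul {a b : ℝ} {f fx ft g gx gt : ℝ → ℝ → ℝ} (hf : IsC1Rect a b f fx ft)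
    (hg : IsC1Rect a b g gx gt) :
    IsC1Rect a b (fun x t => f x t * g x t) (fun x t => fx x t * g x t + f x t * gx x t)
      (fun x t => ft x t * g x t + f x t * gt x t) where
  cont := hf.cont.mul hg.cont
  cont_dx := (hf.cont_dx.mul hg.cont).add (hf.cont.mul hg.cont_dx)
  cont_dt := (hf.cont_dt.mul hg.cont).add (hf.cont.mul hg.cont_dt)
  dx x hx t ht := (hf.dx x hx t ht).fun_mul (hg.dx x hx t ht)
  dt x hx t ht := (hf.dt x hx t ht).fun_mul (hg.dt x hx t ht)

lemma IsC1Rect.slice_t {a b : ℝ} {f fx ft : ℝ → ℝ → ℝ} (h : IsC1Rect a b f fx ft) {x : ℝ}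
    (hx : x ∈ Icc (0 : ℝ) 1) : ContinuousOn (fun t => f x t) (Icc a b) :=
  slice_right h.cont hx

lemma continuousOn_integral_slice {a b : ℝ} {f : ℝ → ℝ → ℝ}
    (hf : ContinuousOn (fun p : ℝ × ℝ => f p.1 p.2) (Icc (0 : ℝ) 1 ×ˢ Icc a b)) :
    ContinuousOn (fun t => ∫ x, f x t ∂unitMeasure) (Icc a b) := by
  have := (continuousOn_toL2_slice hf).inner
    (continuousOn_const (c := toL2 fun _ => (1 : ℝ)) (s := Icc a b)) (𝕜 := ℝ)
  refine this.congr fun t ht => ?_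
  simp only
  rw [inner_toL2 (slice_left hf ht)]
  refine integral_congr_ae ?_
  filter_upwards [coeFn_toL2 (continuousOn_const (c := (1 : ℝ)) (s := Icc 0 1))] with x hx
  rw [hx, mul_one]

/-- The divergence theorem on a rectangle for the field `(c F, F)`. -/
lemma IsC1Rect.integral_transport {a b : ℝ} {F Fx Ft : ℝ → ℝ → ℝ} (h : IsC1Rect a b F Fx Ft)
    (c : ℝ) {τ : ℝ} (hτ : τ ∈ Icc a b) :
    ∫ t in a..τ, ∫ x, (Ft x t + c * Fx x t) ∂unitMeasure
      = (∫ x, F x τ ∂unitMeasure) - (∫ x, F x a ∂unitMeasure)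
        + c * ∫ t in a..τ, (F 1 t - F 0 t) := by
  have hsub : ∀ t ∈ uIcc a τ, t ∈ Icc a b := fun t ht => by
    rw [uIcc_of_le hτ.1] at ht; exact ⟨ht.1, ht.2.trans hτ.2⟩
  have hm : ∀ {f : ℝ → ℝ}, ContinuousOn f (Icc 0 1) → Integrable f unitMeasure := fun hf =>
    (memLp_of_continuousOn hf).integrable one_le_two
  have hcont : ∀ {f : ℝ → ℝ → ℝ}, ContinuousOn (fun p : ℝ × ℝ => f p.1 p.2)
      (Icc (0 : ℝ) 1 ×ˢ Icc a b) →
      IntervalIntegrable (fun t => ∫ x, f x t ∂unitMeasure) volume a τ := fun hf =>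
    intervalIntegrable_of_continuousOn (continuousOn_integral_slice hf) hτ
  have e1 : ∫ t in a..τ, ∫ x, (Ft x t + c * Fx x t) ∂unitMeasure
      = (∫ t in a..τ, ∫ x, Ft x t ∂unitMeasure) + c * ∫ t in a..τ, ∫ x, Fx x t ∂unitMeasure := by
    rw [← intervalIntegral.integral_const_mul,
      ← intervalIntegral.integral_add (hcont h.cont_dt) ((hcont h.cont_dx).const_mul c)]
    refine intervalIntegral.integral_congr fun t ht => ?_
    have ht' := hsub t ht
    rw [integral_add (hm (slice_left h.cont_dt ht')) ((hm (slice_left h.cont_dx ht')).const_mul c),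
      integral_const_mul]
  have e2 : ∫ t in a..τ, ∫ x, Fx x t ∂unitMeasure = ∫ t in a..τ, (F 1 t - F 0 t) := by
    refine intervalIntegral.integral_congr fun t ht => ?_
    have ht' := hsub t ht
    rw [integral_unitMeasure, intervalIntegral.integral_eq_sub_of_hasDerivAt_of_le zero_le_one
      (slice_left h.cont ht') (fun x hx => (h.dx x (Ioo_subset_Icc_self hx) t ht').hasDerivAt
        (Icc_mem_nhds hx.1 hx.2))]
    exact ContinuousOn.intervalIntegrable (by
      rw [uIcc_of_le zero_le_one]; exact slice_left h.cont_dx ht')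
  have e3 : ∫ t in a..τ, ∫ x, Ft x t ∂unitMeasure
      = (∫ x, F x τ ∂unitMeasure) - (∫ x, F x a ∂unitMeasure) := by
    rw [intervalIntegral.integral_of_le hτ.1]
    rw [integral_integral_swap (f := fun t x => Ft x t)]
    · rw [← integral_sub (hm (slice_left h.cont hτ)) (hm (slice_left h.cont (hsub a (by simp))))]
      refine integral_congr_ae ?_
      filter_upwards [ae_unitMeasure_mem] with x hx
      rw [← intervalIntegral.integral_of_le hτ.1,
        intervalIntegral.integral_eq_sub_of_hasDerivAt_of_le hτ.1
          ((slice_right h.cont hx).mono (Icc_subset_Icc_right hτ.2)) (fun t ht =>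
            (h.dt x hx t ⟨ht.1.le, ht.2.le.trans hτ.2⟩).hasDerivAt
              (Icc_mem_nhds ht.1 (ht.2.trans_le hτ.2)))]
      exact intervalIntegrable_of_continuousOn (slice_right h.cont_dt hx) hτ
    · have hc : ContinuousOn (Function.uncurry fun t x => Ft x t) (Icc a b ×ˢ Icc (0 : ℝ) 1) :=
        h.cont_dt.comp continuous_swap.continuousOn fun _ hp => ⟨hp.2, hp.1⟩
      have := hc.integrableOn_compact (μ := volume.prod volume) (isCompact_Icc.prod isCompact_Icc)
      rw [unitMeasure, Measure.prod_restrict]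
      exact this.mono_set (prod_mono_left (Ioc_subset_Icc_self.trans (Icc_subset_Icc_right hτ.2)))
  rw [e1, e2, e3]

/-- A profile on the line travelling with speed one, seen on `[0,1]` in the coordinate `k x`. -/
lemma isC1Rect_wave {f : ℝ → ℝ} (hf : ContDiff ℝ 1 f) (m k a b : ℝ) :
    IsC1Rect a b (fun x t => m * f (k * x - t)) (fun x t => m * (k * deriv f (k * x - t)))
      (fun x t => m * -deriv f (k * x - t)) := by
  have hd := hf.differentiable one_ne_zero
  have hc := hf.continuous_deriv le_rfl
  have hc' := hf.continuous
  refine ⟨by fun_prop, by fun_prop, by fun_prop, fun x _ t _ => ?_, fun x _ t _ => ?_⟩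
  · have h1 : HasDerivAt (fun x' : ℝ => k * x' - t) k x := by
      simpa using ((hasDerivAt_id x).const_mul k).sub_const t
    have h2 := ((hd (k * x - t)).hasDerivAt.comp x h1).const_mul m
    rw [mul_comm k]
    exact h2.hasDerivWithinAt
  · have h1 : HasDerivAt (fun t' : ℝ => k * x - t') (-1) t := by
      simpa using (hasDerivAt_id t).const_sub (k * x)
    have h2 := ((hd (k * x - t)).hasDerivAt.comp t h1).const_mul m
    rw [show -deriv f (k * x - t) = deriv f (k * x - t) * -1 by ring]
    exact h2.hasDerivWithinAt

section Line

variable (S : Problem)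

lemma inv_ε₁_ne_zero : S.ε₁⁻¹ ≠ 0 := inv_ne_zero S.ε₁_pos.ne'

lemma neg_inv_ε₂_ne_zero : -S.ε₂⁻¹ ≠ 0 := neg_ne_zero.2 (inv_ne_zero S.ε₂_pos.ne')

/-- The pair `(u, v)` read off from one function `w` on the line, `u(x) = q w(x/ε₁)` and
`v(x) = w(-x/ε₂)`. In the travel time coordinate on the line both components move to the right
with speed one, and continuity at the origin is the boundary condition `u(0) = q v(0)`; the control
enters at `-1/ε₂`. -/
def readOff : LineL2 →L[ℝ] L2 × L2 :=
  (S.q • sample (inv_ε₁_ne_zero S)).prod (sample (neg_inv_ε₂_ne_zero S))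

/-- The function on the line that has a given pair as its read-off and vanishes elsewhere. -/
def place : L2 × L2 →L[ℝ] LineL2 :=
  (S.q⁻¹ • spread (inv_ε₁_ne_zero S)).coprod (spread (neg_inv_ε₂_ne_zero S))

lemma readOff_place (z : L2 × L2) : readOff S (place S z) = z := by
  have h1 := S.ε₁_pos
  have h2 := S.ε₂_pos
  have e1 : (S.ε₁⁻¹)⁻¹ * -S.ε₂⁻¹ < 0 := by
    have : 0 < (S.ε₁⁻¹)⁻¹ * S.ε₂⁻¹ := by positivity
    linarith
  have e2 : (-S.ε₂⁻¹)⁻¹ * S.ε₁⁻¹ < 0 := by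
    have : 0 < (S.ε₂⁻¹)⁻¹ * S.ε₁⁻¹ := by positivity
    rw [inv_neg]; linarith
  ext1
  · simp [readOff, place, sample_spread, sample_spread_of_neg _ _ e2, smul_smul,
      mul_inv_cancel₀ S.q_ne_zero]
  · simp [readOff, place, sample_spread, sample_spread_of_neg _ _ e1]

/-- The pairing of `(u, v) ∈ L²([0,1])²` with a pair of test functions. -/
def pair (z : L2 × L2) (g₁ g₂ : L2) : ℝ := inner ℝ z.1 g₁ + inner ℝ z.2 g₂

lemma sample_translate_of_continuous {f : ℝ → ℝ} (hf : Continuous f) {A : LineL2}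
    (hA : A =ᵐ[volume] f) {k : ℝ} (hk : k ≠ 0) (t : ℝ) :
    sample hk (translate t A) = toL2 fun x => f (k * x - t) := by
  apply Lp.ext
  have h1 := (measurePreserving_sub_right (volume : Measure ℝ) t).quasiMeasurePreserving.ae hA
  filter_upwards [coeFn_sample hk (translate t A), ae_unitMeasure_mul hk (coeFn_translate t A),
    ae_unitMeasure_mul hk h1,
    coeFn_toL2 (g := fun x => f (k * x - t)) (by fun_prop)] with x e1 e2 e3 e4
  rw [e1, e2, e3, e4]

variable {S} {φ φx φt ψ ψx ψt : ℝ → ℝ → ℝ} {a b τ : ℝ}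

lemma pair_readOff_of_continuous {f : ℝ → ℝ} (hf : Continuous f) {A : LineL2}
    (hA : A =ᵐ[volume] f) (t : ℝ) {g₁ g₂ : ℝ → ℝ} (h₁ : ContinuousOn g₁ (Icc 0 1))
    (h₂ : ContinuousOn g₂ (Icc 0 1)) :
    pair (readOff S (translate t A)) (toL2 g₁) (toL2 g₂)
      = (∫ x, S.q * f (S.ε₁⁻¹ * x - t) * g₁ x ∂unitMeasure)
        + ∫ x, 1 * f (-S.ε₂⁻¹ * x - t) * g₂ x ∂unitMeasure := by
  have c1 : ContinuousOn (fun x => f (S.ε₁⁻¹ * x - t)) (Icc 0 1) := by fun_prop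
  have c2 : ContinuousOn (fun x => f (-S.ε₂⁻¹ * x - t)) (Icc 0 1) := by fun_prop
  simp only [pair, readOff, ContinuousLinearMap.prod_apply, smul_apply,
    sample_translate_of_continuous hf hA]
  rw [← toL2_const_mul _ c1, inner_toL2 (g := fun x => S.q * f (S.ε₁⁻¹ * x - t))
    (continuousOn_const.mul c1), inner_toL2 c2]
  congr 1
  · refine integral_congr_ae ?_
    filter_upwards [coeFn_toL2 h₁] with x hx
    rw [hx]
  · refine integral_congr_ae ?_
    filter_upwards [coeFn_toL2 h₂] with x hx
    rw [hx, one_mul]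

/-- Integration by parts for the free transport of a function of class `C¹` on the line. -/
lemma transport_identity_of_contDiff (hφ : IsC1Rect a b φ φx φt) (hψ : IsC1Rect a b ψ ψx ψt)
    (h1 : ∀ t ∈ Icc a b, φ 1 t = 0)
    (h0 : ∀ t ∈ Icc a b, S.ε₂ * ψ 0 t = S.q * S.ε₁ * φ 0 t) (hτ : τ ∈ Icc a b)
    {f : ℝ → ℝ} (hf : ContDiff ℝ 1 f) {A : LineL2} (hA : A =ᵐ[volume] f) :
    pair (readOff S (translate τ A)) (toL2 fun x => φ x τ) (toL2 fun x => ψ x τ)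
        - pair (readOff S (translate a A)) (toL2 fun x => φ x a) (toL2 fun x => ψ x a)
      = (∫ t in a..τ, pair (readOff S (translate t A)) (toL2 fun x => φt x t + S.ε₁ * φx x t)
          (toL2 fun x => ψt x t - S.ε₂ * ψx x t))
        + inner ℝ (reflect (-S.ε₂⁻¹) (signal a τ fun t => S.ε₂ * ψ 1 t)) A := by
  have hε₁ := S.ε₁_pos.ne'
  have hε₂ := S.ε₂_pos.ne'
  have hab : a ≤ b := hτ.1.trans hτ.2
  have ha : a ∈ Icc a b := ⟨le_rfl, hab⟩
  have hsub : ∀ t ∈ uIcc a τ, t ∈ Icc a b := fun t ht => by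
    rw [uIcc_of_le hτ.1] at ht; exact ⟨ht.1, ht.2.trans hτ.2⟩
  have hfc := hf.continuous
  have w1 := (isC1Rect_wave hf S.q S.ε₁⁻¹ a b).mul hφ
  have w2 := (isC1Rect_wave hf 1 (-S.ε₂⁻¹) a b).mul hψ
  have t1 := w1.integral_transport S.ε₁ hτ
  have t2 := w2.integral_transport (-S.ε₂) hτ
  rw [pair_readOff_of_continuous hfc hA τ (slice_left hφ.cont hτ) (slice_left hψ.cont hτ),
    pair_readOff_of_continuous hfc hA a (slice_left hφ.cont ha) (slice_left hψ.cont ha)]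
  have cφ : ContinuousOn (fun p : ℝ × ℝ => φt p.1 p.2 + S.ε₁ * φx p.1 p.2)
      (Icc (0 : ℝ) 1 ×ˢ Icc a b) := hφ.cont_dt.add (continuousOn_const.mul hφ.cont_dx)
  have cψ : ContinuousOn (fun p : ℝ × ℝ => ψt p.1 p.2 - S.ε₂ * ψx p.1 p.2)
      (Icc (0 : ℝ) 1 ×ˢ Icc a b) := hψ.cont_dt.sub (continuousOn_const.mul hψ.cont_dx)
  have e1 : (∫ t in a..τ, pair (readOff S (translate t A))
        (toL2 fun x => φt x t + S.ε₁ * φx x t) (toL2 fun x => ψt x t - S.ε₂ * ψx x t))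
      = (∫ t in a..τ, ∫ x, (((S.q * -deriv f (S.ε₁⁻¹ * x - t)) * φ x t
            + S.q * f (S.ε₁⁻¹ * x - t) * φt x t)
          + S.ε₁ * ((S.q * (S.ε₁⁻¹ * deriv f (S.ε₁⁻¹ * x - t))) * φ x t
            + S.q * f (S.ε₁⁻¹ * x - t) * φx x t)) ∂unitMeasure)
        + ∫ t in a..τ, ∫ x, (((1 * -deriv f (-S.ε₂⁻¹ * x - t)) * ψ x t
            + 1 * f (-S.ε₂⁻¹ * x - t) * ψt x t)
          + -S.ε₂ * ((1 * (-S.ε₂⁻¹ * deriv f (-S.ε₂⁻¹ * x - t))) * ψ x t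
            + 1 * f (-S.ε₂⁻¹ * x - t) * ψx x t)) ∂unitMeasure := by
    rw [← intervalIntegral.integral_add]
    · refine intervalIntegral.integral_congr fun t ht => ?_
      rw [pair_readOff_of_continuous hfc hA t (g₁ := fun x => φt x t + S.ε₁ * φx x t)
        (g₂ := fun x => ψt x t - S.ε₂ * ψx x t)
        (slice_left (f := fun x t => φt x t + S.ε₁ * φx x t) cφ (hsub t ht))
        (slice_left (f := fun x t => ψt x t - S.ε₂ * ψx x t) cψ (hsub t ht))]
      congr 1
      · refine integral_congr_ae (.of_forall fun x => ?_)
        beta_reduce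
        field_simp
        ring
      · refine integral_congr_ae (.of_forall fun x => ?_)
        beta_reduce
        field_simp
        ring
    · exact intervalIntegrable_of_continuousOn (continuousOn_integral_slice
        (w1.cont_dt.add (continuousOn_const.mul w1.cont_dx))) hτ
    · exact intervalIntegrable_of_continuousOn (continuousOn_integral_slice
        (w2.cont_dt.add (continuousOn_const.mul w2.cont_dx))) hτ
  rw [e1, t1, t2]
  have hc1 : ContinuousOn (fun t => S.ε₂ * ψ 1 t) (Icc a b) :=
    continuousOn_const.mul (slice_right hψ.cont (by simp))
  have hsig := coeFn_signal (memLp_Icc_of_continuousOn (hc1.mono (Icc_subset_Icc_right hτ.2)))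
  have e2 : inner ℝ (reflect (-S.ε₂⁻¹) (signal a τ fun t => S.ε₂ * ψ 1 t)) A
      = ∫ t in a..τ, S.ε₂ * ψ 1 t * f (-S.ε₂⁻¹ - t) := by
    rw [lineInner_eq_integral, intervalIntegral.integral_of_le hτ.1,
      ← integral_Icc_eq_integral_Ioc, ← integral_indicator measurableSet_Icc,
      ← integral_sub_left_eq_self ((Icc a τ).indicator fun t => S.ε₂ * ψ 1 t * f (-S.ε₂⁻¹ - t))
        volume (-S.ε₂⁻¹)]
    refine integral_congr_ae ?_
    have h2 := (Measure.measurePreserving_sub_left (volume : Measure ℝ)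
      (-S.ε₂⁻¹)).quasiMeasurePreserving.ae hsig
    filter_upwards [coeFn_reflect (-S.ε₂⁻¹) (signal a τ fun t => S.ε₂ * ψ 1 t), h2, hA]
      with ξ g1 g2 g3
    rw [g1, g2, g3]
    by_cases hξ : -S.ε₂⁻¹ - ξ ∈ Icc a τ
    · simp only [indicator_of_mem hξ, sub_sub_cancel]
    · simp only [indicator_of_notMem hξ, zero_mul]
  rw [e2]
  have i1 := intervalIntegrable_of_continuousOn
    ((w1.slice_t (x := 1) (by simp)).fun_sub (w1.slice_t (x := 0) (by simp))) hτ
  have i2 := intervalIntegrable_of_continuousOn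
    ((w2.slice_t (x := 1) (by simp)).fun_sub (w2.slice_t (x := 0) (by simp))) hτ
  have i3 : IntervalIntegrable (fun t => S.ε₂ * ψ 1 t * f (-S.ε₂⁻¹ - t)) volume a τ :=
    intervalIntegrable_of_continuousOn (hc1.mul (by fun_prop)) hτ
  have e3 : (∫ t in a..τ, (S.ε₁ * (S.q * f (S.ε₁⁻¹ * 1 - t) * φ 1 t
          - S.q * f (S.ε₁⁻¹ * 0 - t) * φ 0 t)
        + -S.ε₂ * (1 * f (-S.ε₂⁻¹ * 1 - t) * ψ 1 t - 1 * f (-S.ε₂⁻¹ * 0 - t) * ψ 0 t)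
        + S.ε₂ * ψ 1 t * f (-S.ε₂⁻¹ - t))) = ∫ t in a..τ, (0 : ℝ) := by
    refine intervalIntegral.integral_congr fun t ht => ?_
    have g1 := h1 t (hsub t ht)
    have g0 := h0 t (hsub t ht)
    simp only [mul_zero, mul_one, g1, zero_sub]
    linear_combination f (-t) * g0
  rw [intervalIntegral.integral_add ((i1.const_mul _).add (i2.const_mul _)) i3,
    intervalIntegral.integral_add (i1.const_mul _) (i2.const_mul _),
    intervalIntegral.integral_const_mul, intervalIntegral.integral_const_mul,
    intervalIntegral.integral_zero] at e3
  linear_combination -e3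

end Line

section Line

variable {S : Problem} {φ φx φt ψ ψx ψt : ℝ → ℝ → ℝ} {a b τ : ℝ}

lemma exists_continuous_extension {E : Type*} [TopologicalSpace E] {f : ℝ → E}
    (hf : ContinuousOn f (Icc a b)) (hab : a ≤ b) :
    ∃ g : ℝ → E, Continuous g ∧ EqOn g f (Icc a b) :=
  ⟨fun t => f (projIcc a b hab t),
    hf.comp_continuous (continuous_subtype_val.comp continuous_projIcc) fun t =>
      (projIcc a b hab t).2, fun t ht => by simp only [projIcc_of_mem hab ht]⟩

lemma continuous_pair_readOff {X : Type*} [TopologicalSpace X] {t : X → ℝ} {A : X → LineL2}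
    {g₁ g₂ : X → L2} (ht : Continuous t) (hA : Continuous A) (h₁ : Continuous g₁)
    (h₂ : Continuous g₂) :
    Continuous fun x => pair (readOff S (translate (t x) (A x))) (g₁ x) (g₂ x) := by
  have h : Continuous fun x => readOff S (translate (t x) (A x)) :=
    (readOff S).continuous.comp (continuous_translate.comp (ht.prodMk hA))
  exact (h.fst.inner h₁).add (h.snd.inner h₂)

/-- Integration by parts for the free transport of a square integrable function on the line. The
last term is the inflow at `x = 1`. -/
lemma transport_identity (hφ : IsC1Rect a b φ φx φt) (hψ : IsC1Rect a b ψ ψx ψt)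
    (h1 : ∀ t ∈ Icc a b, φ 1 t = 0)
    (h0 : ∀ t ∈ Icc a b, S.ε₂ * ψ 0 t = S.q * S.ε₁ * φ 0 t) (hτ : τ ∈ Icc a b) (A : LineL2) :
    pair (readOff S (translate τ A)) (toL2 fun x => φ x τ) (toL2 fun x => ψ x τ)
        - pair (readOff S (translate a A)) (toL2 fun x => φ x a) (toL2 fun x => ψ x a)
      = (∫ t in a..τ, pair (readOff S (translate t A)) (toL2 fun x => φt x t + S.ε₁ * φx x t)
          (toL2 fun x => ψt x t - S.ε₂ * ψx x t))
        + inner ℝ (reflect (-S.ε₂⁻¹) (signal a τ fun t => S.ε₂ * ψ 1 t)) A := by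
  have hab : a ≤ b := hτ.1.trans hτ.2
  obtain ⟨g₁, hg₁, hg₁'⟩ := exists_continuous_extension (continuousOn_toL2_slice
    (f := fun x t => φt x t + S.ε₁ * φx x t)
    (hφ.cont_dt.add (continuousOn_const.mul hφ.cont_dx))) hab
  obtain ⟨g₂, hg₂, hg₂'⟩ := exists_continuous_extension (continuousOn_toL2_slice
    (f := fun x t => ψt x t - S.ε₂ * ψx x t)
    (hψ.cont_dt.sub (continuousOn_const.mul hψ.cont_dx))) hab
  have hint : ∀ A : LineL2, (∫ t in a..τ, pair (readOff S (translate t A))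
        (toL2 fun x => φt x t + S.ε₁ * φx x t) (toL2 fun x => ψt x t - S.ε₂ * ψx x t))
      = ∫ t in a..τ, pair (readOff S (translate t A)) (g₁ t) (g₂ t) := fun A => by
    refine intervalIntegral.integral_congr fun t ht => ?_
    rw [uIcc_of_le hτ.1] at ht
    have ht' : t ∈ Icc a b := ⟨ht.1, ht.2.trans hτ.2⟩
    simp only [hg₁' ht', hg₂' ht']
  rw [hint]
  have hcl : IsClosed {A : LineL2 |
      pair (readOff S (translate τ A)) (toL2 fun x => φ x τ) (toL2 fun x => ψ x τ)
        - pair (readOff S (translate a A)) (toL2 fun x => φ x a) (toL2 fun x => ψ x a)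
      = (∫ t in a..τ, pair (readOff S (translate t A)) (g₁ t) (g₂ t))
        + inner ℝ (reflect (-S.ε₂⁻¹) (signal a τ fun t => S.ε₂ * ψ 1 t)) A} := by
    refine isClosed_eq ?_ ?_
    · exact (continuous_pair_readOff continuous_const continuous_id continuous_const
        continuous_const).sub (continuous_pair_readOff continuous_const continuous_id
        continuous_const continuous_const)
    · refine Continuous.add ?_ (continuous_const.inner continuous_id)
      refine intervalIntegral.continuous_parametric_intervalIntegral_of_continuous' ?_ a τ
      exact continuous_pair_readOff continuous_snd continuous_fst (hg₁.comp continuous_snd)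
        (hg₂.comp continuous_snd)
  -- both sides are continuous in `A`, and Schwartz functions are dense
  have hd := SchwartzMap.denseRange_toLpCLM (E := ℝ) (F := ℝ) (p := 2) (μ := volume)
    ENNReal.ofNat_ne_top
  refine hcl.closure_subset_iff.2 ?_ (hd A)
  rintro _ ⟨f, rfl⟩
  have := transport_identity_of_contDiff hφ hψ h1 h0 hτ (f.smooth 1) (f.coeFn_toLp 2 volume)
  rw [hint] at this
  exact this

/-- Only the part of a function on the line over `[-1/ε₂ - t, 1/ε₁ - t]` is read off at time `t`. -/
lemma readOff_translate_congr {A B : LineL2} (t : ℝ)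
    (h : ∀ᵐ ξ, ξ + t ∈ Ioo (-S.ε₂⁻¹) S.ε₁⁻¹ → A ξ = B ξ) :
    readOff S (translate t A) = readOff S (translate t B) := by
  have key : ∀ {k : ℝ} (hk : k ≠ 0), (∀ x ∈ Ioo (0 : ℝ) 1, k * x ∈ Ioo (-S.ε₂⁻¹) S.ε₁⁻¹) →
      sample hk (translate t A) = sample hk (translate t B) := fun {k} hk hk' => by
    apply Lp.ext
    have h1 := (measurePreserving_sub_right (volume : Measure ℝ) t).quasiMeasurePreserving.ae h
    filter_upwards [coeFn_sample hk (translate t A), coeFn_sample hk (translate t B),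
      ae_unitMeasure_mul hk (coeFn_translate t A), ae_unitMeasure_mul hk (coeFn_translate t B),
      ae_unitMeasure_mul hk h1, ae_unitMeasure_mem_Ioo] with x e1 e2 e3 e4 e5 hx
    rw [e1, e2, e3, e4]
    refine e5 ?_
    rw [sub_add_cancel]
    exact hk' x hx
  have i1 : 0 < S.ε₁⁻¹ := inv_pos.2 S.ε₁_pos
  have i2 : 0 < S.ε₂⁻¹ := inv_pos.2 S.ε₂_pos
  have k1 := key (inv_ε₁_ne_zero S) fun x hx => ⟨by nlinarith [hx.1], by nlinarith [hx.2]⟩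
  have k2 := key (neg_inv_ε₂_ne_zero S) fun x hx => ⟨by nlinarith [hx.2], by nlinarith [hx.1]⟩
  simp only [readOff, ContinuousLinearMap.prod_apply, smul_apply, k1, k2]

lemma coeFn_place_eq_zero (z : L2 × L2) : ∀ᵐ σ, σ < -S.ε₂⁻¹ → place S z σ = 0 := by
  have i1 : 0 < S.ε₁⁻¹ := inv_pos.2 S.ε₁_pos
  have i2 : 0 < S.ε₂⁻¹ := inv_pos.2 S.ε₂_pos
  have e : place S z = S.q⁻¹ • spread (inv_ε₁_ne_zero S) z.1 + spread (neg_inv_ε₂_ne_zero S) z.2 := by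
    simp [place]
  rw [e]
  filter_upwards [Lp.coeFn_add (S.q⁻¹ • spread (inv_ε₁_ne_zero S) z.1)
      (spread (neg_inv_ε₂_ne_zero S) z.2), Lp.coeFn_smul S.q⁻¹ (spread (inv_ε₁_ne_zero S) z.1),
    coeFn_spread (inv_ε₁_ne_zero S) z.1, coeFn_spread (neg_inv_ε₂_ne_zero S) z.2] with σ e1 e2 e3 e4 hσ
  rw [e1, Pi.add_apply, e2, Pi.smul_apply, e3, e4, indicator_of_notMem, indicator_of_notMem]
  · simp
  · rintro ⟨-, h⟩
    rw [inv_neg, inv_inv] at h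
    have h3 : S.ε₂ * S.ε₂⁻¹ = 1 := mul_inv_cancel₀ S.ε₂_pos.ne'
    nlinarith [S.ε₂_pos]
  · rintro ⟨h, -⟩
    rw [inv_inv] at h
    have : S.ε₁ * σ < 0 := mul_neg_of_pos_of_neg S.ε₁_pos (by linarith)
    linarith

/-- Inflow after the time `a` does not meet a state placed on the line at the time `a`. -/
lemma inner_reflect_signal_place {g : ℝ → ℝ} (hg : MemLp g 2 (volume.restrict (Icc a τ)))
    (z : L2 × L2) :
    inner ℝ (reflect (-S.ε₂⁻¹) (signal a τ g)) (translate (-a) (place S z)) = 0 := by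
  rw [lineInner_eq_integral]
  refine integral_eq_zero_of_ae ?_
  have h1 := (measurePreserving_sub_right (volume : Measure ℝ) (-a)).quasiMeasurePreserving.ae
    (coeFn_place_eq_zero (S := S) z)
  have h2 := (Measure.measurePreserving_sub_left (volume : Measure ℝ)
      (-S.ε₂⁻¹)).quasiMeasurePreserving.ae (coeFn_signal hg)
  filter_upwards [coeFn_reflect (-S.ε₂⁻¹) (signal a τ g), coeFn_translate (-a) (place S z), h1, h2,
    Measure.ae_ne volume (-S.ε₂⁻¹ - a)] with ξ e1 e2 e3 e4 hξ
  rw [e1, e2, e4, Pi.zero_apply]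
  rcases lt_or_ge (-S.ε₂⁻¹ - a) ξ with h | h
  · rw [indicator_of_notMem (fun h' => by linarith [h'.1]), zero_mul]
  · have : ξ < -S.ε₂⁻¹ - a := lt_of_le_of_ne h hξ
    rw [e3 (by linarith), mul_zero]

lemma inner_reflect_signal {g U : ℝ → ℝ} (hg : MemLp g 2 (volume.restrict (Icc a τ)))
    (hU : MemLp U 2 (volume.restrict (Icc a b))) (hτ : τ ∈ Icc a b) (k : ℝ) :
    inner ℝ (reflect k (signal a τ g)) (reflect k (signal a b U)) = ∫ t in a..τ, g t * U t := by
  rw [LinearIsometry.inner_map_map, lineInner_eq_integral, intervalIntegral.integral_of_le hτ.1,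
    ← integral_Icc_eq_integral_Ioc, ← integral_indicator measurableSet_Icc]
  refine integral_congr_ae ?_
  filter_upwards [coeFn_signal hg, coeFn_signal hU] with t e1 e2
  rw [e1, e2]
  by_cases ht : t ∈ Icc a τ
  · rw [indicator_of_mem ht, indicator_of_mem ht,
      indicator_of_mem (show t ∈ Icc a b from ⟨ht.1, ht.2.trans hτ.2⟩)]
  · rw [indicator_of_notMem ht, indicator_of_notMem ht, zero_mul]

/-- Causality: at time `t` only the control before time `t` has entered. -/
lemma readOff_translate_signal {U : ℝ → ℝ} (hU : MemLp U 2 (volume.restrict (Icc a b)))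
    (hτ : τ ∈ Icc a b) :
    readOff S (translate τ (reflect (-S.ε₂⁻¹) (signal a b U)))
      = readOff S (translate τ (reflect (-S.ε₂⁻¹) (signal a τ U))) := by
  have hU' : MemLp U 2 (volume.restrict (Icc a τ)) :=
    hU.mono_measure (Measure.restrict_mono (Icc_subset_Icc_right hτ.2) le_rfl)
  refine readOff_translate_congr τ ?_
  have q := (Measure.measurePreserving_sub_left (volume : Measure ℝ)
      (-S.ε₂⁻¹)).quasiMeasurePreserving
  filter_upwards [coeFn_reflect (-S.ε₂⁻¹) (signal a b U), coeFn_reflect (-S.ε₂⁻¹) (signal a τ U),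
    q.ae (coeFn_signal hU), q.ae (coeFn_signal hU')] with ξ e1 e2 e3 e4 hξ
  rw [e1, e2, e3, e4]
  have h1 : -S.ε₂⁻¹ - ξ ≤ τ := by linarith [hξ.1]
  by_cases ha : a ≤ -S.ε₂⁻¹ - ξ
  · rw [indicator_of_mem (show _ ∈ Icc a τ from ⟨ha, h1⟩),
      indicator_of_mem (show _ ∈ Icc a b from ⟨ha, h1.trans hτ.2⟩)]
  · rw [indicator_of_notMem fun h => ha h.1, indicator_of_notMem fun h => ha h.1]

end Line

/-! ### Existence of trajectories -/

/-- Exchange of the order of integration over the triangle `s ≤ r ≤ t' ≤ t`. -/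
lemma integral_triangle_swap {h : ℝ → ℝ → ℝ} (hc : Continuous (Function.uncurry h)) {s t : ℝ}
    (hst : s ≤ t) :
    ∫ r in s..t, ∫ t' in r..t, h r t' = ∫ t' in s..t, ∫ r in s..t', h r t' := by
  set D : Set (ℝ × ℝ) := {p | p.1 < p.2} with hD
  have hDm : MeasurableSet D := measurableSet_lt measurable_fst measurable_snd
  have e1 : ∫ r in s..t, ∫ t' in r..t, h r t'
      = ∫ r in Ioc s t, ∫ t' in Ioc s t, D.indicator (Function.uncurry h) (r, t') := by
    rw [intervalIntegral.integral_of_le hst]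
    refine setIntegral_congr_fun measurableSet_Ioc fun r hr => ?_
    rw [intervalIntegral.integral_of_le hr.2, ← integral_indicator measurableSet_Ioc,
      ← integral_indicator measurableSet_Ioc]
    congr 1; ext t'
    by_cases h1 : r < t' <;> by_cases h2 : t' ≤ t
    · rw [indicator_of_mem (show t' ∈ Ioc r t from ⟨h1, h2⟩),
        indicator_of_mem (show t' ∈ Ioc s t from ⟨hr.1.trans h1, h2⟩),
        indicator_of_mem (show (r, t') ∈ D from h1), Function.uncurry]
    · rw [indicator_of_notMem fun h' : t' ∈ Ioc r t => h2 h'.2,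
        indicator_of_notMem fun h' : t' ∈ Ioc s t => h2 h'.2]
    all_goals
      rw [indicator_of_notMem fun h' : t' ∈ Ioc r t => h1 h'.1, eq_comm]
      refine indicator_apply_eq_zero.2 fun _ => ?_
      exact indicator_of_notMem (show (r, t') ∉ D from h1) _
  have e2 : ∫ t' in s..t, ∫ r in s..t', h r t'
      = ∫ t' in Ioc s t, ∫ r in Ioc s t, D.indicator (Function.uncurry h) (r, t') := by
    rw [intervalIntegral.integral_of_le hst]
    refine setIntegral_congr_fun measurableSet_Ioc fun t' ht' => ?_
    rw [intervalIntegral.integral_of_le ht'.1.le, ← integral_indicator measurableSet_Ioc,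
      ← integral_indicator measurableSet_Ioc]
    refine integral_congr_ae ?_
    filter_upwards [Measure.ae_ne volume t'] with r hr
    by_cases h1 : r < t' <;> by_cases h2 : s < r
    · rw [indicator_of_mem (show r ∈ Ioc s t' from ⟨h2, h1.le⟩),
        indicator_of_mem (show r ∈ Ioc s t from ⟨h2, h1.le.trans ht'.2⟩),
        indicator_of_mem (show (r, t') ∈ D from h1), Function.uncurry]
    · rw [indicator_of_notMem fun h' : r ∈ Ioc s t' => h2 h'.1,
        indicator_of_notMem fun h' : r ∈ Ioc s t => h2 h'.1]
    all_goals
      rw [indicator_of_notMem fun h' : r ∈ Ioc s t' => h1 (lt_of_le_of_ne h'.2 hr), eq_comm]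
      refine indicator_apply_eq_zero.2 fun _ => ?_
      exact indicator_of_notMem (show (r, t') ∉ D from h1) _
  rw [e1, e2, integral_integral_swap (f := fun r t' => D.indicator (Function.uncurry h) (r, t'))]
  have hi : IntegrableOn (Function.uncurry h) (Icc s t ×ˢ Icc s t) (volume.prod volume) :=
    hc.continuousOn.integrableOn_compact (isCompact_Icc.prod isCompact_Icc)
  rw [Measure.prod_restrict]
  exact (hi.mono_set (prod_mono Ioc_subset_Icc_self Ioc_subset_Icc_self)).integrable.indicator hDm

/-- The Cauchy–Schwarz inequality against the constant `1`, from the nonnegativity of the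
variance. -/
lemma sq_integral_le {f : ℝ → ℝ} (hf : Continuous f) {s t : ℝ} (hst : s ≤ t) :
    (∫ r in s..t, f r) ^ 2 ≤ (t - s) * ∫ r in s..t, f r ^ 2 := by
  rcases hst.eq_or_lt with rfl | hlt
  · simp
  set I := ∫ r in s..t, f r with hI
  set J := ∫ r in s..t, f r ^ 2 with hJ
  have hL : 0 < t - s := sub_pos.2 hlt
  set m : ℝ := I / (t - s)
  have h0 : 0 ≤ ∫ r in s..t, (f r - m) ^ 2 :=
    intervalIntegral.integral_nonneg hst fun r _ => sq_nonneg _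
  have h1 : ∫ r in s..t, (f r - m) ^ 2 = J - 2 * m * I + m ^ 2 * (t - s) := by
    have i1 : IntervalIntegrable (fun r => f r ^ 2) volume s t := (hf.pow 2).intervalIntegrable _ _
    have i2 : IntervalIntegrable (fun r => 2 * m * f r) volume s t :=
      (continuous_const.mul hf).intervalIntegrable _ _
    rw [show (fun r => (f r - m) ^ 2) = fun r => (f r ^ 2 - 2 * m * f r) + m ^ 2 by ext r; ring,
      intervalIntegral.integral_add (i1.sub i2) intervalIntegrable_const,
      intervalIntegral.integral_sub i1 i2, intervalIntegral.integral_const_mul,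
      intervalIntegral.integral_const, smul_eq_mul]
    ring
  have h2 : m * (t - s) = I := div_mul_cancel₀ I hL.ne'
  rw [h1] at h0
  have h3 : J - 2 * m * I + m ^ 2 * (t - s) = J - m * I := by rw [← h2]; ring
  rw [h3] at h0
  have h4 : (t - s) * (J - m * I) = (t - s) * J - I ^ 2 := by rw [← h2]; ring
  nlinarith [mul_nonneg hL.le h0]

/-- A map of Volterra type on continuous functions on `[a,b]` has a fixed point, because its
iterates have Lipschitz constants that tend to `0`. -/
lemma exists_fixedPoint_volterra {E : Type*} [NormedAddCommGroup E] [CompleteSpace E] {a b : ℝ}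
    (hab : a ≤ b) (Ψ : C(Icc a b, E) → C(Icc a b, E)) {C : ℝ} (hC : 0 ≤ C)
    (h : ∀ z z' t, ‖Ψ z t - Ψ z' t‖ ^ 2
      ≤ C * ∫ r in a..t, ‖z (projIcc a b hab r) - z' (projIcc a b hab r)‖ ^ 2) :
    ∃ z, Ψ z = z := by
  have iter : ∀ (n : ℕ) (z z' : C(Icc a b, E)) (t : Icc a b), ‖Ψ^[n] z t - Ψ^[n] z' t‖ ^ 2
      ≤ (C * (t - a)) ^ n / n.factorial * ‖z - z'‖ ^ 2 := by
    intro n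
    induction n with
    | zero =>
      intro z z' t
      simp only [Function.iterate_zero, id, pow_zero, Nat.factorial_zero, Nat.cast_one, div_one,
        one_mul]
      gcongr
      exact (z - z').norm_coe_le_norm t
    | succ n ih =>
      intro z z' t
      rw [Function.iterate_succ_apply', Function.iterate_succ_apply']
      refine (h _ _ t).trans ?_
      have hle : ∫ r in a..t, ‖Ψ^[n] z (projIcc a b hab r) - Ψ^[n] z' (projIcc a b hab r)‖ ^ 2
          ≤ ∫ r in a..t, (C ^ n / n.factorial * ‖z - z'‖ ^ 2) * (r - a) ^ n := by
        refine intervalIntegral.integral_mono_on t.2.1 ?_ ?_ fun r hr => ?_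
        · refine Continuous.intervalIntegrable ?_ _ _
          have hp := continuous_projIcc (h := hab)
          exact (((map_continuous _).comp hp).sub ((map_continuous _).comp hp)).norm.pow 2
        · exact Continuous.intervalIntegrable (by fun_prop) _ _
        · have := ih z z' (projIcc a b hab r)
          rw [projIcc_of_mem hab ⟨hr.1, hr.2.trans t.2.2⟩] at this ⊢
          refine this.trans (le_of_eq ?_)
          simp only [mul_pow]; ring
      refine (mul_le_mul_of_nonneg_left hle hC).trans (le_of_eq ?_)
      rw [intervalIntegral.integral_const_mul,
        intervalIntegral.integral_comp_sub_right (fun r => r ^ n) a, integral_pow, sub_self,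
        zero_pow n.succ_ne_zero, sub_zero, Nat.factorial_succ, mul_pow, Nat.cast_mul, Nat.cast_succ]
      field_simp
      ring
  have hlim := FloorSemiring.tendsto_pow_div_factorial_atTop (C * (b - a))
  obtain ⟨n, hn⟩ := (hlim.eventually (gt_mem_nhds (show (0 : ℝ) < 1 / 4 by norm_num))).exists
  have hcon : ContractingWith (1 / 2 : NNReal) Ψ^[n] := by
    refine ⟨by rw [div_lt_one (by norm_num)]; norm_num, LipschitzWith.of_dist_le_mul fun z z' => ?_⟩
    rw [dist_eq_norm, dist_eq_norm]
    refine (ContinuousMap.norm_le _ (by positivity)).2 fun t => ?_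
    have h1 := iter n z z' t
    have h2 : (C * (t - a)) ^ n / n.factorial ≤ 1 / 4 := by
      refine le_trans ?_ hn.le
      have := t.2.1
      have := t.2.2
      have : 0 ≤ C * (t - a) := mul_nonneg hC (by linarith)
      gcongr
    have h3 : ‖Ψ^[n] z t - Ψ^[n] z' t‖ ^ 2 ≤ (1 / 2 * ‖z - z'‖) ^ 2 := by
      refine h1.trans ?_
      have := mul_le_mul_of_nonneg_right h2 (sq_nonneg ‖z - z'‖)
      linarith
    have h4 := abs_le_of_sq_le_sq h3 (by positivity)
    rw [abs_of_nonneg (norm_nonneg _)] at h4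
    simpa using h4
  have : Nonempty (Icc a b) := ⟨⟨a, le_rfl, hab⟩⟩
  exact ⟨_, hcon.isFixedPt_fixedPoint_iterate⟩

section Mild

variable {S : Problem} {φ φx φt ψ ψx ψt : ℝ → ℝ → ℝ} {a b τ : ℝ}

lemma norm_translate (t : ℝ) (A : LineL2) : ‖translate t A‖ = ‖A‖ :=
  (Lp.compMeasurePreservingₗᵢ ℝ (fun σ => σ - t) (measurePreserving_sub_right volume t)).norm_map A

lemma signal_self (U : ℝ → ℝ) : signal a a U = 0 := by
  have hU : MemLp U 2 (volume.restrict (Icc a a)) := by simp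
  apply Lp.ext
  filter_upwards [coeFn_signal hU, Lp.coeFn_zero ℝ 2 (volume : Measure ℝ),
    Measure.ae_ne volume a] with t h1 h2 h3
  rw [h1, h2, indicator_of_notMem (by simpa using h3), Pi.zero_apply]

lemma signal_sub {U U' : ℝ → ℝ} (hU : MemLp U 2 (volume.restrict (Icc a b)))
    (hU' : MemLp U' 2 (volume.restrict (Icc a b))) :
    signal a b U - signal a b U' = signal a b fun t => U t - U' t := by
  apply Lp.ext
  filter_upwards [coeFn_signal hU, coeFn_signal hU',
    coeFn_signal (g := fun t => U t - U' t) (hU.sub hU'),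
    Lp.coeFn_sub (signal a b U) (signal a b U')] with t h1 h2 h3 h4
  rw [h4, Pi.sub_apply, h1, h2, h3]
  by_cases h : t ∈ Icc a b <;> simp [h]

variable (S) in
/-- The function on the line carried along by the flow: the initial state, the control on `[a,b]`,
and the source `F` that has entered up to time `t`. -/
def carried (a b : ℝ) (z₀ : L2 × L2) (U : ℝ → ℝ) (F : ℝ → L2 × L2) (t : ℝ) : LineL2 :=
  translate (-a) (place S z₀) + reflect (-S.ε₂⁻¹) (signal a b U)
    + ∫ r in a..t, translate (-r) (place S (F r))

variable (S) in
/-- The variation of constants formula for transport with control `U` and source `F`. -/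
def mild (a b : ℝ) (z₀ : L2 × L2) (U : ℝ → ℝ) (F : ℝ → L2 × L2) (t : ℝ) : L2 × L2 :=
  readOff S (translate t (carried S a b z₀ U F t))

variable {z₀ : L2 × L2} {U : ℝ → ℝ} {F : ℝ → L2 × L2}

lemma continuous_source (hF : Continuous F) :
    Continuous fun r => translate (-r) (place S (F r)) :=
  continuous_translate.comp (continuous_neg.prodMk ((place S).continuous.comp hF))

lemma continuous_mild (hF : Continuous F) : Continuous (mild S a b z₀ U F) := by
  refine (readOff S).continuous.comp (continuous_translate.comp (continuous_id.prodMk ?_))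
  refine continuous_const.add ?_
  exact intervalIntegral.continuous_primitive
    (fun x y => (continuous_source hF).intervalIntegrable x y) a

lemma mild_init (hU : MemLp U 2 (volume.restrict (Icc a b))) (hab : a ≤ b) :
    mild S a b z₀ U F a = z₀ := by
  rw [mild, carried, intervalIntegral.integral_same, add_zero, map_add, map_add,
    readOff_translate_signal hU ⟨le_rfl, hab⟩, signal_self, translate_translate, add_neg_cancel,
    translate_zero, readOff_place]
  simp

/-- The functional `z ↦ pair z g₁ g₂` after the flow, as a continuous linear form on the line. -/
def pairFlow (S : Problem) (t : ℝ) (g₁ g₂ : L2) : LineL2 →L[ℝ] ℝ :=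
  (((innerSL ℝ g₁).comp (ContinuousLinearMap.fst ℝ L2 L2))
    + (innerSL ℝ g₂).comp (ContinuousLinearMap.snd ℝ L2 L2)).comp
      ((readOff S).comp (translate t))

lemma pairFlow_apply (t : ℝ) (g₁ g₂ : L2) (A : LineL2) :
    pairFlow S t g₁ g₂ A = pair (readOff S (translate t A)) g₁ g₂ := by
  simp [pairFlow, pair, real_inner_comm]

lemma pair_mild (hF : Continuous F) (t : ℝ) (g₁ g₂ : L2) :
    pair (mild S a b z₀ U F t) g₁ g₂
      = pair (readOff S (translate t (translate (-a) (place S z₀)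
          + reflect (-S.ε₂⁻¹) (signal a b U)))) g₁ g₂
        + ∫ r in a..t, pair (readOff S (translate t (translate (-r) (place S (F r))))) g₁ g₂ := by
  rw [mild, carried]
  simp only [← pairFlow_apply]
  rw [map_add, ← ContinuousLinearMap.intervalIntegral_comp_comm _
    ((continuous_source hF).intervalIntegrable _ _)]

/-- What enters through the source at the times before `τ`, tested at time `τ`. -/
lemma integral_pair_source (hφ : IsC1Rect a b φ φx φt) (hψ : IsC1Rect a b ψ ψx ψt)
    (h1 : ∀ t ∈ Icc a b, φ 1 t = 0)
    (h0 : ∀ t ∈ Icc a b, S.ε₂ * ψ 0 t = S.q * S.ε₁ * φ 0 t) (hτ : τ ∈ Icc a b)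
    (hF : Continuous F) {g₁ g₂ p₁ p₂ : ℝ → L2} (hg₁ : Continuous g₁) (hg₂ : Continuous g₂)
    (hp₁ : Continuous p₁) (hp₂ : Continuous p₂)
    (hg₁' : ∀ t ∈ Icc a b, g₁ t = toL2 fun x => φt x t + S.ε₁ * φx x t)
    (hg₂' : ∀ t ∈ Icc a b, g₂ t = toL2 fun x => ψt x t - S.ε₂ * ψx x t)
    (hp₁' : ∀ t ∈ Icc a b, p₁ t = toL2 fun x => φ x t)
    (hp₂' : ∀ t ∈ Icc a b, p₂ t = toL2 fun x => ψ x t) :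
    ∫ r in a..τ, pair (readOff S (translate τ (translate (-r) (place S (F r))))) (p₁ τ) (p₂ τ)
      = (∫ r in a..τ, pair (F r) (p₁ r) (p₂ r))
        + ∫ t in a..τ, ∫ r in a..t,
          pair (readOff S (translate t (translate (-r) (place S (F r))))) (g₁ t) (g₂ t) := by
  have hψ1 : ContinuousOn (fun t => S.ε₂ * ψ 1 t) (Icc a b) :=
    continuousOn_const.mul (slice_right hψ.cont (by simp))
  have eB : ∀ r ∈ Icc a τ,
      pair (readOff S (translate τ (translate (-r) (place S (F r))))) (p₁ τ) (p₂ τ)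
      = pair (F r) (p₁ r) (p₂ r) + ∫ t in r..τ,
          pair (readOff S (translate t (translate (-r) (place S (F r))))) (g₁ t) (g₂ t) := by
    intro r hr
    have hr' : r ∈ Icc a b := ⟨hr.1, hr.2.trans hτ.2⟩
    have e := transport_identity (hφ.mono hr.1 le_rfl) (hψ.mono hr.1 le_rfl)
      (fun t ht => h1 t ⟨hr.1.trans ht.1, ht.2⟩) (fun t ht => h0 t ⟨hr.1.trans ht.1, ht.2⟩)
      (⟨hr.2, hτ.2⟩ : τ ∈ Icc r b) (translate (-r) (place S (F r)))
    have memψ : MemLp (fun t => S.ε₂ * ψ 1 t) 2 (volume.restrict (Icc r τ)) :=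
      (memLp_Icc_of_continuousOn hψ1).mono_measure
        (Measure.restrict_mono (Icc_subset_Icc hr.1 hτ.2) le_rfl)
    rw [inner_reflect_signal_place memψ, add_zero, sub_eq_iff_eq_add,
      translate_translate r, add_neg_cancel, translate_zero, readOff_place] at e
    rw [hp₁' τ hτ, hp₂' τ hτ, hp₁' r hr', hp₂' r hr', e, add_comm]
    congr 1
    refine intervalIntegral.integral_congr fun t ht => ?_
    rw [uIcc_of_le hr.2] at ht
    have ht' : t ∈ Icc a b := ⟨hr.1.trans ht.1, ht.2.trans hτ.2⟩
    simp only [hg₁' t ht', hg₂' t ht']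
  have hh : Continuous (Function.uncurry fun r t =>
      pair (readOff S (translate t (translate (-r) (place S (F r))))) (g₁ t) (g₂ t)) :=
    continuous_pair_readOff continuous_snd ((continuous_source hF).comp continuous_fst)
      (hg₁.comp continuous_snd) (hg₂.comp continuous_snd)
  have hFp : Continuous fun r => pair (F r) (p₁ r) (p₂ r) :=
    (hF.fst.inner hp₁).add (hF.snd.inner hp₂)
  obtain ⟨h, hh'⟩ : ∃ h : ℝ → ℝ → ℝ, ∀ r t, h r t
      = pair (readOff S (translate t (translate (-r) (place S (F r))))) (g₁ t) (g₂ t) :=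
    ⟨_, fun _ _ => rfl⟩
  simp only [← hh'] at hh eB ⊢
  rw [← integral_triangle_swap hh hτ.1,
    intervalIntegral.integral_congr fun r hr => eB r (by rwa [uIcc_of_le hτ.1] at hr),
    intervalIntegral.integral_add (hFp.intervalIntegrable _ _)]
  refine Continuous.intervalIntegrable ?_ _ _
  have e : (fun r => ∫ t in r..τ, h r t) = fun r => -∫ t in τ..r, h r t := by
    ext r; rw [intervalIntegral.integral_symm]
  rw [e]
  exact (intervalIntegral.continuous_parametric_intervalIntegral_of_continuous hh
    continuous_id).neg

/-- The variation of constants formula gives a weak solution of the transport equation with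
source. -/
lemma pair_mild_sub (hφ : IsC1Rect a b φ φx φt) (hψ : IsC1Rect a b ψ ψx ψt)
    (h1 : ∀ t ∈ Icc a b, φ 1 t = 0)
    (h0 : ∀ t ∈ Icc a b, S.ε₂ * ψ 0 t = S.q * S.ε₁ * φ 0 t) (hτ : τ ∈ Icc a b)
    (hU : MemLp U 2 (volume.restrict (Icc a b))) (hF : Continuous F) :
    pair (mild S a b z₀ U F τ) (toL2 fun x => φ x τ) (toL2 fun x => ψ x τ)
        - pair z₀ (toL2 fun x => φ x a) (toL2 fun x => ψ x a)
      = (∫ t in a..τ, (pair (mild S a b z₀ U F t) (toL2 fun x => φt x t + S.ε₁ * φx x t)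
            (toL2 fun x => ψt x t - S.ε₂ * ψx x t)
          + pair (F t) (toL2 fun x => φ x t) (toL2 fun x => ψ x t)))
        + ∫ t in a..τ, S.ε₂ * ψ 1 t * U t := by
  have hab : a ≤ b := hτ.1.trans hτ.2
  obtain ⟨g₁, hg₁, hg₁'⟩ := exists_continuous_extension (continuousOn_toL2_slice
    (f := fun x t => φt x t + S.ε₁ * φx x t)
    (hφ.cont_dt.add (continuousOn_const.mul hφ.cont_dx))) hab
  obtain ⟨g₂, hg₂, hg₂'⟩ := exists_continuous_extension (continuousOn_toL2_slice
    (f := fun x t => ψt x t - S.ε₂ * ψx x t)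
    (hψ.cont_dt.sub (continuousOn_const.mul hψ.cont_dx))) hab
  obtain ⟨p₁, hp₁, hp₁'⟩ := exists_continuous_extension (continuousOn_toL2_slice hφ.cont) hab
  obtain ⟨p₂, hp₂, hp₂'⟩ := exists_continuous_extension (continuousOn_toL2_slice hψ.cont) hab
  have eS := integral_pair_source hφ hψ h1 h0 hτ hF hg₁ hg₂ hp₁ hp₂ (fun t ht => hg₁' ht)
    (fun t ht => hg₂' ht) (fun t ht => hp₁' ht) (fun t ht => hp₂' ht)
  have hψ1 : ContinuousOn (fun t => S.ε₂ * ψ 1 t) (Icc a b) :=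
    continuousOn_const.mul (slice_right hψ.cont (by simp))
  have memψ : MemLp (fun t => S.ε₂ * ψ 1 t) 2 (volume.restrict (Icc a τ)) :=
    (memLp_Icc_of_continuousOn hψ1).mono_measure
      (Measure.restrict_mono (Icc_subset_Icc le_rfl hτ.2) le_rfl)
  -- the part carried along from the initial state and the control
  have eA := transport_identity hφ hψ h1 h0 hτ (translate (-a) (place S z₀)
    + reflect (-S.ε₂⁻¹) (signal a b U))
  have eA0 : readOff S (translate a (translate (-a) (place S z₀)
      + reflect (-S.ε₂⁻¹) (signal a b U))) = z₀ := by
    have := mild_init (S := S) (z₀ := z₀) (F := F) hU hab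
    rwa [mild, carried, intervalIntegral.integral_same, add_zero] at this
  rw [eA0, inner_add_right, inner_reflect_signal_place memψ, zero_add,
      inner_reflect_signal memψ hU hτ] at eA
  have hm : ∀ t, pair (mild S a b z₀ U F t) (g₁ t) (g₂ t) = _ := fun t => pair_mild hF t _ _
  have hmτ := pair_mild (S := S) (a := a) (b := b) (z₀ := z₀) (U := U) hF τ (p₁ τ) (p₂ τ)
  rw [eS, hp₁' hτ, hp₂' hτ] at hmτ
  have hh : Continuous (Function.uncurry fun t r =>
      pair (readOff S (translate t (translate (-r) (place S (F r))))) (g₁ t) (g₂ t)) :=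
    continuous_pair_readOff continuous_fst ((continuous_source hF).comp continuous_snd)
      (hg₁.comp continuous_fst) (hg₂.comp continuous_fst)
  have hA0c := continuous_pair_readOff (S := S) (t := fun t : ℝ => t) (A := fun _ =>
    translate (-a) (place S z₀) + reflect (-S.ε₂⁻¹) (signal a b U)) continuous_id continuous_const
    hg₁ hg₂
  have hFp : Continuous fun r => pair (F r) (p₁ r) (p₂ r) :=
    (hF.fst.inner hp₁).add (hF.snd.inner hp₂)
  have hin : Continuous fun t => ∫ r in a..t,
      pair (readOff S (translate t (translate (-r) (place S (F r))))) (g₁ t) (g₂ t) :=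
    intervalIntegral.continuous_parametric_intervalIntegral_of_continuous hh continuous_id
  have add3 : ∀ f g h : ℝ → ℝ, Continuous f → Continuous g → Continuous h →
      ∫ t in a..τ, (f t + g t + h t) = (∫ t in a..τ, f t) + (∫ t in a..τ, g t)
        + ∫ t in a..τ, h t := fun f g h hf hg hh => by
    rw [← intervalIntegral.integral_add (hf.intervalIntegrable _ _) (hg.intervalIntegrable _ _),
      ← intervalIntegral.integral_add (f := fun t => f t + g t)
        ((hf.add hg).intervalIntegrable _ _)
        (hh.intervalIntegrable _ _)]
  have hI0 : (∫ t in a..τ, pair (readOff S (translate t (translate (-a) (place S z₀)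
        + reflect (-S.ε₂⁻¹) (signal a b U)))) (toL2 fun x => φt x t + S.ε₁ * φx x t)
          (toL2 fun x => ψt x t - S.ε₂ * ψx x t))
      = ∫ t in a..τ, pair (readOff S (translate t (translate (-a) (place S z₀)
        + reflect (-S.ε₂⁻¹) (signal a b U)))) (g₁ t) (g₂ t) := by
    refine intervalIntegral.integral_congr fun t ht => ?_
    rw [uIcc_of_le hτ.1] at ht
    have ht' : t ∈ Icc a b := ⟨ht.1, ht.2.trans hτ.2⟩
    simp only [hg₁' ht', hg₂' ht']
  have hI : (∫ t in a..τ, (pair (mild S a b z₀ U F t) (toL2 fun x => φt x t + S.ε₁ * φx x t)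
            (toL2 fun x => ψt x t - S.ε₂ * ψx x t)
          + pair (F t) (toL2 fun x => φ x t) (toL2 fun x => ψ x t)))
      = ∫ t in a..τ, (pair (mild S a b z₀ U F t) (g₁ t) (g₂ t) + pair (F t) (p₁ t) (p₂ t)) := by
    refine intervalIntegral.integral_congr fun t ht => ?_
    rw [uIcc_of_le hτ.1] at ht
    have ht' : t ∈ Icc a b := ⟨ht.1, ht.2.trans hτ.2⟩
    simp only [hg₁' ht', hg₂' ht', hp₁' ht', hp₂' ht']
  rw [hI0] at eA
  rw [hI, hmτ]
  simp only [hm]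
  rw [add3 _ _ _ hA0c hin hFp]
  linear_combination eA

/-- At time `τ` the solution depends on control and source before `τ` only, with an `L²` bound; this
is what makes the fixed point problem of the coupled equation one of Volterra type. -/
lemma mild_sub_sq_le {U' : ℝ → ℝ} {F' : ℝ → L2 × L2} (hU : MemLp U 2 (volume.restrict (Icc a b)))
    (hU' : MemLp U' 2 (volume.restrict (Icc a b))) (hF : Continuous F) (hF' : Continuous F')
    (hτ : τ ∈ Icc a b) :
    ‖mild S a b z₀ U F τ - mild S a b z₀ U' F' τ‖ ^ 2
      ≤ 2 * ‖readOff S‖ ^ 2 * ((∫ t in a..τ, (U t - U' t) ^ 2)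
          + ‖place S‖ ^ 2 * (b - a) * ∫ t in a..τ, ‖F t - F' t‖ ^ 2) := by
  have mono : ∀ {V : ℝ → ℝ}, MemLp V 2 (volume.restrict (Icc a b)) →
      MemLp V 2 (volume.restrict (Icc a τ)) := fun hV =>
    hV.mono_measure (Measure.restrict_mono (Icc_subset_Icc_right hτ.2) le_rfl)
  set D := reflect (-S.ε₂⁻¹) (signal a τ fun t => U t - U' t) with hD
  set I := ∫ r in a..τ, translate (-r) (place S (F r - F' r)) with hI
  have e : mild S a b z₀ U F τ - mild S a b z₀ U' F' τ = readOff S (translate τ (D + I)) := by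
    have eI : I = (∫ r in a..τ, translate (-r) (place S (F r)))
        - ∫ r in a..τ, translate (-r) (place S (F' r)) := by
      rw [hI, ← intervalIntegral.integral_sub ((continuous_source hF).intervalIntegrable _ _)
        ((continuous_source hF').intervalIntegrable _ _)]
      simp only [map_sub]
    rw [hD, ← signal_sub (mono hU) (mono hU'), eI]
    simp only [mild, carried, map_add, map_sub]
    rw [readOff_translate_signal hU hτ, readOff_translate_signal hU' hτ]
    abel
  have nD : ‖D‖ ^ 2 = ∫ t in a..τ, (U t - U' t) ^ 2 := by
    rw [hD, LinearIsometry.norm_map, norm_signal_sq (g := fun t => U t - U' t) ((mono hU).sub (mono hU')),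
      intervalIntegral.integral_of_le hτ.1, integral_Icc_eq_integral_Ioc]
  have nI : ‖I‖ ≤ ‖place S‖ * ∫ r in a..τ, ‖F r - F' r‖ := by
    rw [← intervalIntegral.integral_const_mul]
    refine intervalIntegral.norm_integral_le_of_norm_le hτ.1 ?_ ?_
    · refine ae_of_all _ fun r _ => ?_
      rw [norm_translate]
      exact (place S).le_opNorm _
    · exact (continuous_const.mul (hF.sub hF').norm).intervalIntegrable _ _
  have nI' : ‖I‖ ^ 2 ≤ ‖place S‖ ^ 2 * (b - a) * ∫ r in a..τ, ‖F r - F' r‖ ^ 2 := by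
    have h1 := sq_integral_le (hF.sub hF').norm hτ.1
    have h2 : 0 ≤ ∫ r in a..τ, ‖F r - F' r‖ ^ 2 :=
      intervalIntegral.integral_nonneg hτ.1 fun _ _ => sq_nonneg _
    calc ‖I‖ ^ 2 ≤ (‖place S‖ * ∫ r in a..τ, ‖F r - F' r‖) ^ 2 := by gcongr
      _ = ‖place S‖ ^ 2 * (∫ r in a..τ, ‖F r - F' r‖) ^ 2 := by ring
      _ ≤ ‖place S‖ ^ 2 * ((b - a) * ∫ r in a..τ, ‖F r - F' r‖ ^ 2) := by
        refine mul_le_mul_of_nonneg_left (h1.trans ?_) (sq_nonneg _)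
        exact mul_le_mul_of_nonneg_right (by linarith [hτ.2]) h2
      _ = _ := by ring
  have n1 : ‖readOff S (translate τ (D + I))‖ ≤ ‖readOff S‖ * (‖D‖ + ‖I‖) := by
    refine ((readOff S).le_opNorm _).trans ?_
    rw [norm_translate]
    exact mul_le_mul_of_nonneg_left (norm_add_le _ _) (norm_nonneg _)
  rw [e]
  calc ‖readOff S (translate τ (D + I))‖ ^ 2 ≤ (‖readOff S‖ * (‖D‖ + ‖I‖)) ^ 2 := by gcongr
    _ = ‖readOff S‖ ^ 2 * (‖D‖ + ‖I‖) ^ 2 := by ring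
    _ ≤ ‖readOff S‖ ^ 2 * (2 * (‖D‖ ^ 2 + ‖I‖ ^ 2)) := by
      gcongr; nlinarith [sq_nonneg (‖D‖ - ‖I‖)]
    _ ≤ ‖readOff S‖ ^ 2 * (2 * ((∫ t in a..τ, (U t - U' t) ^ 2)
          + ‖place S‖ ^ 2 * (b - a) * ∫ t in a..τ, ‖F t - F' t‖ ^ 2)) := by
      rw [nD]; gcongr
    _ = _ := by ring

end Mild

variable (S : Problem) in
/-- The coupling `(u,v) ↦ (c₁ v, c₂ u)`. -/
def coupling : L2 × L2 →L[ℝ] L2 × L2 :=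
  ((mulL2 S.c₁ S.c₁_cont).comp (ContinuousLinearMap.snd ℝ L2 L2)).prod
    ((mulL2 S.c₂ S.c₂_cont).comp (ContinuousLinearMap.fst ℝ L2 L2))

/-- Existence for the state equation, with an affine feedback `U = f + ⟨k, v⟩`. Coupling and feedback
are treated as source and control of the transport equation that depend on the solution. -/
theorem exists_trajectory (S : Problem) {s : ℝ} (hs : s < S.T) (u₀ v₀ : L2) {f : ℝ → ℝ}
    (hf : MemLp f 2 (volume.restrict (Icc s S.T))) {k : ℝ → L2} (hk : Continuous k) :
    ∃ u v : ℝ → L2, IsTrajectory S s u₀ v₀ u v fun t => f t + inner ℝ (k t) (v t) := by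
  set P := projIcc s S.T hs.le with hP
  have hPc : Continuous P := continuous_projIcc
  set ctrl : (ℝ → L2 × L2) → ℝ → ℝ := fun z t => f t + inner ℝ (k t) (z t).2 with hctrl
  have memc : ∀ {z : ℝ → L2 × L2}, Continuous z →
      MemLp (ctrl z) 2 (volume.restrict (Icc s S.T)) := fun hz =>
    hf.add (memLp_Icc_of_continuousOn (hk.inner hz.snd).continuousOn)
  have extc : ∀ z : C(Icc s S.T, L2 × L2), Continuous fun t => z (P t) := fun z =>
    (map_continuous z).comp hPc
  have srcc : ∀ z : C(Icc s S.T, L2 × L2), Continuous fun t => coupling S (z (P t)) := fun z =>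
    (coupling S).continuous.comp (extc z)
  let Ψ : C(Icc s S.T, L2 × L2) → C(Icc s S.T, L2 × L2) := fun z =>
    ⟨fun t => mild S s S.T (u₀, v₀) (ctrl fun t => z (P t)) (fun t => coupling S (z (P t))) t,
      (continuous_mild (srcc z)).comp continuous_subtype_val⟩
  obtain ⟨K, hK⟩ := isCompact_Icc.exists_bound_of_continuousOn (hk.continuousOn (s := Icc s S.T))
  have hest : ∀ z z' t, ‖Ψ z t - Ψ z' t‖ ^ 2
      ≤ 2 * ‖readOff S‖ ^ 2 * (K ^ 2 + ‖place S‖ ^ 2 * (S.T - s) * ‖coupling S‖ ^ 2)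
        * ∫ r in s..t, ‖z (P r) - z' (P r)‖ ^ 2 := by
    intro z z' t
    refine (mild_sub_sq_le (memc (extc z)) (memc (extc z')) (srcc z) (srcc z') t.2).trans ?_
    have hn : Continuous fun r => ‖z (P r) - z' (P r)‖ ^ 2 := ((extc z).sub (extc z')).norm.pow 2
    have i1 : (∫ r in s..t, (ctrl (fun t => z (P t)) r - ctrl (fun t => z' (P t)) r) ^ 2)
        ≤ K ^ 2 * ∫ r in s..t, ‖z (P r) - z' (P r)‖ ^ 2 := by
      have e : ∀ r, ctrl (fun t => z (P t)) r - ctrl (fun t => z' (P t)) r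
          = inner ℝ (k r) (z (P r) - z' (P r)).2 := fun r => by
        simp only [hctrl, Prod.snd_sub, inner_sub_right]; ring
      simp only [e]
      rw [← intervalIntegral.integral_const_mul]
      refine intervalIntegral.integral_mono_on t.2.1 ?_ ?_ fun r hr => ?_
      · exact ((hk.inner ((extc z).sub (extc z')).snd).pow 2).intervalIntegrable _ _
      · exact (continuous_const.mul hn).intervalIntegrable _ _
      · have h1 := abs_real_inner_le_norm (k r) (z (P r) - z' (P r)).2
        have h2 := hK r ⟨hr.1, hr.2.trans t.2.2⟩
        have h3 := norm_snd_le (z (P r) - z' (P r))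
        have h4 : |inner ℝ (k r) (z (P r) - z' (P r)).2| ≤ K * ‖z (P r) - z' (P r)‖ :=
          h1.trans (mul_le_mul h2 h3 (norm_nonneg _) ((norm_nonneg _).trans h2))
        rw [← mul_pow, ← sq_abs (inner ℝ (k r) _)]
        gcongr
    have i2 : (∫ r in s..t, ‖coupling S (z (P r)) - coupling S (z' (P r))‖ ^ 2)
        ≤ ‖coupling S‖ ^ 2 * ∫ r in s..t, ‖z (P r) - z' (P r)‖ ^ 2 := by
      rw [← intervalIntegral.integral_const_mul]
      refine intervalIntegral.integral_mono_on t.2.1 ?_ ?_ fun r hr => ?_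
      · exact (((srcc z).sub (srcc z')).norm.pow 2).intervalIntegrable _ _
      · exact (continuous_const.mul hn).intervalIntegrable _ _
      · rw [← map_sub, ← mul_pow]
        gcongr
        exact (coupling S).le_opNorm _
    have i3 : 0 ≤ ‖place S‖ ^ 2 * (S.T - s) := mul_nonneg (sq_nonneg _) (by linarith)
    calc _ ≤ 2 * ‖readOff S‖ ^ 2 * (K ^ 2 * (∫ r in s..t, ‖z (P r) - z' (P r)‖ ^ 2)
          + ‖place S‖ ^ 2 * (S.T - s)
            * (‖coupling S‖ ^ 2 * ∫ r in s..t, ‖z (P r) - z' (P r)‖ ^ 2)) := by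
          gcongr
      _ = _ := by ring
  obtain ⟨z, hz⟩ := exists_fixedPoint_volterra hs.le Ψ
    (mul_nonneg (by positivity) (add_nonneg (sq_nonneg _) (mul_nonneg (mul_nonneg (sq_nonneg _)
      (by linarith)) (sq_nonneg _)))) hest
  have hzt : ∀ t ∈ Icc s S.T, z (P t) = mild S s S.T (u₀, v₀) (ctrl fun t => z (P t))
      (fun t => coupling S (z (P t))) t := fun t ht => by
    have := DFunLike.congr_fun hz (P t)
    rw [← this]
    simp only [Ψ, ContinuousMap.coe_mk, hP, projIcc_of_mem hs.le ht]
  have hs' : s ∈ Icc s S.T := ⟨le_rfl, hs.le⟩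
  have hz0 : z (P s) = (u₀, v₀) := by rw [hzt s hs', mild_init (memc (extc z)) hs.le]
  refine ⟨fun t => (z (P t)).1, fun t => (z (P t)).2, IsTrajectory.of_weak_inner hs (memc (extc z))
    (extc z).fst.continuousOn (extc z).snd.continuousOn (by rw [hz0]) (by rw [hz0]) ?_⟩
  intro φ φx φt ψ ψx ψt hφ hψ h1 h0 τ hτ
  have key := pair_mild_sub (z₀ := (u₀, v₀)) hφ hψ h1 h0 hτ (memc (extc z)) (srcc z)
  rw [← hzt τ hτ] at key
  refine key.trans ?_
  congr 1
  refine intervalIntegral.integral_congr fun t ht => ?_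
  rw [uIcc_of_le hτ.1] at ht
  have ht' : t ∈ Icc s S.T := ⟨ht.1, ht.2.trans hτ.2⟩
  have cφ := slice_left hφ.cont ht'
  have cψ := slice_left hψ.cont ht'
  have c1 : ContinuousOn (fun x => φt x t + S.ε₁ * φx x t) (Icc 0 1) :=
    (slice_left hφ.cont_dt ht').add (continuousOn_const.mul (slice_left hφ.cont_dx ht'))
  have c2 : ContinuousOn (fun x => ψt x t - S.ε₂ * ψx x t) (Icc 0 1) :=
    (slice_left hψ.cont_dt ht').sub (continuousOn_const.mul (slice_left hψ.cont_dx ht'))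
  rw [← hzt t ht']
  simp only [pair, coupling, adjFst, adjSnd]
  rw [toL2_add (f := fun x => φt x t + S.ε₁ * φx x t) (g := fun x => S.c₂ x * ψ x t) c1
      (S.c₂_cont.mul cψ),
    toL2_add (f := fun x => ψt x t - S.ε₂ * ψx x t) (g := fun x => S.c₁ x * φ x t) c2
      (S.c₁_cont.mul cφ), inner_add_right, inner_add_right,
    ← inner_mulL2 S.c₂_cont cψ, ← inner_mulL2 S.c₁_cont cφ]
  simp only [ContinuousLinearMap.prod_apply, ContinuousLinearMap.comp_apply,
    ContinuousLinearMap.coe_fst', ContinuousLinearMap.coe_snd']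
  ring

/-! ### The cost as a quadratic form -/

/-- The operator with a weighting kernel. -/
def IsWeight.op {K : ℝ → ℝ → ℝ} (h : IsWeight K) : L2 →L[ℝ] L2 := kerL2 K h.continuousOn

lemma IsWeight.inner_op_comm {K : ℝ → ℝ → ℝ} (h : IsWeight K) (f g : L2) :
    inner ℝ (h.op f) g = inner ℝ (h.op g) f := by
  have hK' : ContinuousOn (fun p : ℝ × ℝ => K p.2 p.1) (Icc (0 : ℝ) 1 ×ˢ Icc (0 : ℝ) 1) :=
    h.continuousOn.comp continuous_swap.continuousOn fun _ hp => ⟨hp.2, hp.1⟩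
  rw [IsWeight.op, inner_kerL2_transpose h.continuousOn hK']
  congr 1
  rw [kerL2_apply, kerL2_apply]
  refine toL2_congr fun x hx => ?_
  refine integral_congr_ae ?_
  filter_upwards [ae_unitMeasure_mem] with y hy
  rw [h.symm x hx y hy]

lemma IsWeight.quadForm_eq {K : ℝ → ℝ → ℝ} (h : IsWeight K) (f : L2) :
    quadForm K f = inner ℝ (h.op f) f := quadForm_eq_inner h.continuousOn f

lemma IsWeight.inner_op_nonneg {K : ℝ → ℝ → ℝ} (h : IsWeight K) (f : L2) :
    0 ≤ inner ℝ (h.op f) f := h.quadForm_eq f ▸ h.nonneg f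

section Cost

variable {S : Problem} {s : ℝ} {u₀ v₀ u₀' v₀' : L2} {u v u' v' : ℝ → L2} {U U' : ℝ → ℝ}

/-- The symmetric bilinear form whose quadratic form is twice the cost. -/
def crossCost (S : Problem) (s : ℝ) (u v : ℝ → L2) (U : ℝ → ℝ) (u' v' : ℝ → L2) (U' : ℝ → ℝ) : ℝ :=
  (∫ t in s..S.T, (inner ℝ (S.Q₁_weight.op (u t)) (u' t) + inner ℝ (S.Q₂_weight.op (v t)) (v' t)
      + S.R * (U t * U' t)))
    + inner ℝ (S.Pf₁_weight.op (u S.T)) (u' S.T) + inner ℝ (S.Pf₂_weight.op (v S.T)) (v' S.T)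

lemma crossCost_comm : crossCost S s u v U u' v' U' = crossCost S s u' v' U' u v U := by
  simp only [crossCost, S.Q₁_weight.inner_op_comm (u _), S.Q₂_weight.inner_op_comm (v _),
    S.Pf₁_weight.inner_op_comm (u _), S.Pf₂_weight.inner_op_comm (v _), mul_comm (U _)]

lemma cost_eq_crossCost : cost S s u v U = 1 / 2 * crossCost S s u v U u v U := by
  simp only [cost, crossCost, S.Q₁_weight.quadForm_eq, S.Q₂_weight.quadForm_eq,
    S.Pf₁_weight.quadForm_eq, S.Pf₂_weight.quadForm_eq, ← sq]
  ring

lemma continuousOn_state_cross (h : IsTrajectory S s u₀ v₀ u v U)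
    (h' : IsTrajectory S s u₀' v₀' u' v' U') :
    ContinuousOn (fun t => inner ℝ (S.Q₁_weight.op (u t)) (u' t)
      + inner ℝ (S.Q₂_weight.op (v t)) (v' t)) (Icc s S.T) :=
  ((S.Q₁_weight.op.continuous.comp_continuousOn h.cont_u).inner h'.cont_u).add
    ((S.Q₂_weight.op.continuous.comp_continuousOn h.cont_v).inner h'.cont_v)

lemma intervalIntegrable_mul_of_memLp {a b : ℝ} (hab : a ≤ b)
    (hU : MemLp U 2 (volume.restrict (Icc a b))) (hU' : MemLp U' 2 (volume.restrict (Icc a b))) :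
    IntervalIntegrable (fun t => U t * U' t) volume a b := by
  rw [intervalIntegrable_iff_integrableOn_Ioc_of_le hab]
  exact IntegrableOn.mono_set (hU.integrable_mul hU') Ioc_subset_Icc_self

lemma intervalIntegrable_cross (hs : s ≤ S.T) (h : IsTrajectory S s u₀ v₀ u v U)
    (h' : IsTrajectory S s u₀' v₀' u' v' U') :
    IntervalIntegrable (fun t => inner ℝ (S.Q₁_weight.op (u t)) (u' t)
      + inner ℝ (S.Q₂_weight.op (v t)) (v' t) + S.R * (U t * U' t)) volume s S.T :=
  (intervalIntegrable_of_continuousOn (continuousOn_state_cross h h') ⟨hs, le_rfl⟩).add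
    ((intervalIntegrable_mul_of_memLp hs h.control h'.control).const_mul S.R)

lemma cost_add_const_mul (hs : s ≤ S.T) (h : IsTrajectory S s u₀ v₀ u v U)
    (h' : IsTrajectory S s u₀' v₀' u' v' U') (c : ℝ) :
    cost S s (fun t => u t + c • u' t) (fun t => v t + c • v' t) (fun t => U t + c * U' t)
      = cost S s u v U + c * crossCost S s u v U u' v' U' + c ^ 2 * cost S s u' v' U' := by
  have e : ∀ t, inner ℝ (S.Q₁_weight.op (u t + c • u' t)) (u t + c • u' t)
        + inner ℝ (S.Q₂_weight.op (v t + c • v' t)) (v t + c • v' t)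
        + S.R * ((U t + c * U' t) * (U t + c * U' t))
      = (inner ℝ (S.Q₁_weight.op (u t)) (u t)
          + inner ℝ (S.Q₂_weight.op (v t)) (v t) + S.R * (U t * U t))
        + 2 * c * (inner ℝ (S.Q₁_weight.op (u t)) (u' t)
          + inner ℝ (S.Q₂_weight.op (v t)) (v' t) + S.R * (U t * U' t))
        + c ^ 2 * (inner ℝ (S.Q₁_weight.op (u' t)) (u' t)
          + inner ℝ (S.Q₂_weight.op (v' t)) (v' t) + S.R * (U' t * U' t)) := fun t => by
    simp only [map_add, map_smul, inner_add_left, inner_add_right, inner_smul_left,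
      inner_smul_right, conj_trivial, S.Q₁_weight.inner_op_comm (u' t) (u t),
      S.Q₂_weight.inner_op_comm (v' t) (v t)]
    ring
  have i1 := intervalIntegrable_cross hs h h
  have i2 := (intervalIntegrable_cross hs h h').const_mul (2 * c)
  have i3 := (intervalIntegrable_cross hs h' h').const_mul (c ^ 2)
  rw [cost_eq_crossCost, cost_eq_crossCost, cost_eq_crossCost, crossCost, crossCost, crossCost,
    crossCost]
  simp only [e]
  rw [intervalIntegral.integral_add (i1.add i2) i3, intervalIntegral.integral_add i1 i2,
    intervalIntegral.integral_const_mul, intervalIntegral.integral_const_mul]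
  simp only [map_add, map_smul, inner_add_left, inner_add_right, inner_smul_left,
      inner_smul_right, conj_trivial, S.Pf₁_weight.inner_op_comm (u' S.T) (u S.T),
      S.Pf₂_weight.inner_op_comm (v' S.T) (v S.T)]
  ring

lemma control_le_cost (hs : s ≤ S.T) (h : IsTrajectory S s u₀ v₀ u v U) :
    S.R / 2 * ∫ t in s..S.T, U t ^ 2 ≤ cost S s u v U := by
  have hi := intervalIntegrable_control_sq h.control ⟨hs, le_rfl⟩
  have h1 : S.R * ∫ t in s..S.T, U t ^ 2
      ≤ ∫ t in s..S.T, (inner ℝ (S.Q₁_weight.op (u t)) (u t)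
        + inner ℝ (S.Q₂_weight.op (v t)) (v t) + S.R * (U t * U t)) := by
    rw [← intervalIntegral.integral_const_mul]
    refine intervalIntegral.integral_mono_on hs (hi.const_mul _)
      (intervalIntegrable_cross hs h h) fun t _ => ?_
    rw [← sq]
    linarith [S.Q₁_weight.inner_op_nonneg (u t), S.Q₂_weight.inner_op_nonneg (v t)]
  rw [cost_eq_crossCost, crossCost]
  linarith [S.Pf₁_weight.inner_op_nonneg (u S.T), S.Pf₂_weight.inner_op_nonneg (v S.T)]

end Cost

/-! ### Co-states and the maximum principle -/

section Costate

variable {S : Problem} {s : ℝ} {u₀ v₀ u₀' v₀' : L2} {u v u' v' : ℝ → L2} {U U' : ℝ → ℝ}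
  {l₁ l₂ : ℝ → ℝ → ℝ}

lemma continuousOn_kernelOp_prod {K : ℝ → ℝ → ℝ} (hK : IsWeight K) {w : ℝ → L2} {a b : ℝ}
    (hw : ContinuousOn w (Icc a b)) :
    ContinuousOn (fun p : ℝ × ℝ => kernelOp K (w p.2) p.1) (Icc (0 : ℝ) 1 ×ˢ Icc a b) := by
  have h1 : ContinuousOn (fun p : ℝ × ℝ => toL2 (K p.1)) (Icc (0 : ℝ) 1 ×ˢ Icc a b) :=
    (continuousOn_toL2 hK.continuousOn).comp continuousOn_fst fun _ hp => hp.1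
  have h2 : ContinuousOn (fun p : ℝ × ℝ => w p.2) (Icc (0 : ℝ) 1 ×ˢ Icc a b) :=
    hw.comp continuousOn_snd fun _ hp => hp.2
  exact (h1.inner h2).congr fun p hp => kernelOp_eq_inner (kernel_slice hK.continuousOn hp.1) _

lemma IsCostate.isC1Rect_fst (h : IsCostate S s u v l₁ l₂) (hu : ContinuousOn u (Icc s S.T)) :
    IsC1Rect s S.T l₁ (fun x t => derivWithin (fun x' => l₁ x' t) (Icc 0 1) x)
      fun x t => -(S.ε₁ * derivWithin (fun x' => l₁ x' t) (Icc 0 1) x + S.c₂ x * l₂ x t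
        + kernelOp S.Q₁ (u t) x) where
  cont := h.cont₁
  cont_dx := h.cont_dx₁
  cont_dt := (((continuousOn_const.mul h.cont_dx₁).add
    ((S.c₂_cont.comp continuousOn_fst fun _ hp => hp.1).mul h.cont₂)).add
      (continuousOn_kernelOp_prod S.Q₁_weight hu)).neg
  dx x hx t ht := (h.diff₁ t ht x hx).hasDerivWithinAt
  dt x hx t ht := h.eq₁ x hx t ht

lemma IsCostate.isC1Rect_snd (h : IsCostate S s u v l₁ l₂) (hv : ContinuousOn v (Icc s S.T)) :
    IsC1Rect s S.T l₂ (fun x t => derivWithin (fun x' => l₂ x' t) (Icc 0 1) x)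
      fun x t => -(-S.ε₂ * derivWithin (fun x' => l₂ x' t) (Icc 0 1) x + S.c₁ x * l₁ x t
        + kernelOp S.Q₂ (v t) x) where
  cont := h.cont₂
  cont_dx := h.cont_dx₂
  cont_dt := (((continuousOn_const.mul h.cont_dx₂).add
    ((S.c₁_cont.comp continuousOn_fst fun _ hp => hp.1).mul h.cont₁)).add
      (continuousOn_kernelOp_prod S.Q₂_weight hv)).neg
  dx x hx t ht := (h.diff₂ t ht x hx).hasDerivWithinAt
  dt x hx t ht := h.eq₂ x hx t ht

lemma toL2_neg_kernelOp {K : ℝ → ℝ → ℝ} (hK : IsWeight K) (w : L2) :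
    toL2 (fun x => -kernelOp K w x) = -hK.op w := by
  have h1 := continuousOn_kernelOp hK.continuousOn w
  have h2 := toL2_const_mul (-1) h1
  rw [neg_one_smul] at h2
  rw [IsWeight.op, kerL2_apply, ← h2]
  exact toL2_congr fun _ _ => by ring

/-- Green's formula for the adjoint system: the derivative of the cost in the direction of a
trajectory, in terms of the co-states. -/
lemma IsCostate.crossCost_eq (hl : IsCostate S s u v l₁ l₂) (hs : s < S.T)
    (h : IsTrajectory S s u₀ v₀ u v U) (h' : IsTrajectory S s u₀' v₀' u' v' U') :
    crossCost S s u v U u' v' U'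
      = inner ℝ (toL2 fun x => l₁ x s) u₀' + inner ℝ (toL2 fun x => l₂ x s) v₀'
        + ∫ t in s..S.T, (S.R * U t + S.ε₂ * l₂ 1 t) * U' t := by
  have hT : S.T ∈ Icc s S.T := ⟨hs.le, le_rfl⟩
  have r₁ := hl.isC1Rect_fst h.cont_u
  have r₂ := hl.isC1Rect_snd h.cont_v
  have key := h'.weak_inner hs r₁ r₂ hl.at_one (fun t ht => by
    rw [hl.at_zero t ht]; field_simp [S.ε₂_pos.ne']) hT
  have t1 : toL2 (fun x => l₁ x S.T) = S.Pf₁_weight.op (u S.T) := toL2_congr hl.final₁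
  have t2 : toL2 (fun x => l₂ x S.T) = S.Pf₂_weight.op (v S.T) := toL2_congr hl.final₂
  have hint : (∫ t in s..S.T, (inner ℝ (u' t) (toL2 fun x => adjFst S
        (fun x t => derivWithin (fun x' => l₁ x' t) (Icc 0 1) x)
        (fun x t => -(S.ε₁ * derivWithin (fun x' => l₁ x' t) (Icc 0 1) x + S.c₂ x * l₂ x t
          + kernelOp S.Q₁ (u t) x)) l₂ x t)
      + inner ℝ (v' t) (toL2 fun x => adjSnd S
        (fun x t => derivWithin (fun x' => l₂ x' t) (Icc 0 1) x)
        (fun x t => -(-S.ε₂ * derivWithin (fun x' => l₂ x' t) (Icc 0 1) x + S.c₁ x * l₁ x t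
          + kernelOp S.Q₂ (v t) x)) l₁ x t)))
      = -∫ t in s..S.T, (inner ℝ (S.Q₁_weight.op (u t)) (u' t)
        + inner ℝ (S.Q₂_weight.op (v t)) (v' t)) := by
    rw [← intervalIntegral.integral_neg]
    congr 1; ext t
    have e1 : (fun x => adjFst S
        (fun x t => derivWithin (fun x' => l₁ x' t) (Icc 0 1) x)
        (fun x t => -(S.ε₁ * derivWithin (fun x' => l₁ x' t) (Icc 0 1) x + S.c₂ x * l₂ x t
          + kernelOp S.Q₁ (u t) x)) l₂ x t) = fun x => -kernelOp S.Q₁ (u t) x := by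
      ext x; simp only [adjFst]; ring
    have e2 : (fun x => adjSnd S
        (fun x t => derivWithin (fun x' => l₂ x' t) (Icc 0 1) x)
        (fun x t => -(-S.ε₂ * derivWithin (fun x' => l₂ x' t) (Icc 0 1) x + S.c₁ x * l₁ x t
          + kernelOp S.Q₂ (v t) x)) l₁ x t) = fun x => -kernelOp S.Q₂ (v t) x := by
      ext x; simp only [adjSnd]; ring
    rw [e1, e2, toL2_neg_kernelOp S.Q₁_weight, toL2_neg_kernelOp S.Q₂_weight, inner_neg_right,
      inner_neg_right, real_inner_comm, real_inner_comm (S.Q₂_weight.op _)]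
    ring
  have hc : ContinuousOn (fun t => S.ε₂ * l₂ 1 t) (Icc s S.T) :=
    continuousOn_const.mul (slice_right hl.cont₂ (by simp))
  have i1 := intervalIntegrable_of_continuousOn (continuousOn_state_cross h h') hT
  have i2 := intervalIntegrable_mul_of_memLp hs.le h.control h'.control
  have i3 := intervalIntegrable_mul_control hc h'.control hT
  have i4 : (∫ t in s..S.T, (S.R * U t + S.ε₂ * l₂ 1 t) * U' t)
      = (∫ t in s..S.T, S.R * (U t * U' t)) + ∫ t in s..S.T, S.ε₂ * l₂ 1 t * U' t := by
    rw [← intervalIntegral.integral_add (i2.const_mul S.R) i3]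
    congr 1; ext t; ring
  rw [hint, t1, t2] at key
  rw [crossCost, intervalIntegral.integral_add i1 (i2.const_mul S.R), i4,
    real_inner_comm (u' S.T), real_inner_comm (v' S.T), real_inner_comm u₀', real_inner_comm v₀']
  linear_combination key

/-- The control that annihilates the derivative of the Hamiltonian in the control. -/
def IsExtremalControl (S : Problem) (s : ℝ) (l₂ : ℝ → ℝ → ℝ) (U : ℝ → ℝ) : Prop :=
  ∀ᵐ t ∂(volume.restrict (Icc s S.T)), U t = -(S.ε₂ / S.R) * l₂ 1 t

/-- At an extremal control the derivative of the cost depends only on the variation of the initial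
state. -/
lemma IsCostate.crossCost_of_extremal (hl : IsCostate S s u v l₁ l₂) (hs : s < S.T)
    (h : IsTrajectory S s u₀ v₀ u v U) (hU : IsExtremalControl S s l₂ U)
    (h' : IsTrajectory S s u₀' v₀' u' v' U') :
    crossCost S s u v U u' v' U'
      = inner ℝ (toL2 fun x => l₁ x s) u₀' + inner ℝ (toL2 fun x => l₂ x s) v₀' := by
  rw [hl.crossCost_eq hs h h', add_eq_left, intervalIntegral.integral_of_le hs.le,
    ← integral_Icc_eq_integral_Ioc]
  refine integral_eq_zero_of_ae ?_
  filter_upwards [hU] with t ht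
  have hR := S.R_pos.ne'
  rw [ht, Pi.zero_apply]; field_simp; ring

/-- Sufficiency: an extremal control is optimal, with a quantitative margin. -/
lemma IsCostate.cost_add_le (hl : IsCostate S s u v l₁ l₂) (hs : s < S.T)
    (h : IsTrajectory S s u₀ v₀ u v U) (hU : IsExtremalControl S s l₂ U)
    (h' : IsTrajectory S s u₀ v₀ u' v' U') :
    cost S s u v U + S.R / 2 * ∫ t in s..S.T, (U' t - U t) ^ 2 ≤ cost S s u' v' U' := by
  have hd := h'.add_const_mul hs h (-1)
  simp only [neg_one_smul, neg_one_mul, ← sub_eq_add_neg, sub_self] at hd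
  have hc := cost_add_const_mul hs.le h hd 1
  rw [hl.crossCost_of_extremal hs h hU hd] at hc
  simp only [one_smul, one_mul, one_pow, add_sub_cancel, inner_zero_right, add_zero] at hc
  have := control_le_cost hs.le hd
  linarith

lemma IsCostate.isOptimal (hl : IsCostate S s u v l₁ l₂) (hs : s < S.T)
    (h : IsTrajectory S s u₀ v₀ u v U) (hU : IsExtremalControl S s l₂ U) :
    IsOptimal S s u₀ v₀ u v U := by
  refine ⟨h, fun u' v' U' h' => ?_⟩
  have h1 := hl.cost_add_le hs h hU h'
  have h2 : 0 ≤ ∫ t in s..S.T, (U' t - U t) ^ 2 :=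
    intervalIntegral.integral_nonneg hs.le fun _ _ => sq_nonneg _
  nlinarith [S.R_pos]

lemma ae_eq_zero_of_integral_sq {a b : ℝ} (hab : a ≤ b) {f : ℝ → ℝ}
    (hf : MemLp f 2 (volume.restrict (Icc a b))) (h : ∫ t in a..b, f t ^ 2 ≤ 0) :
    ∀ᵐ t ∂(volume.restrict (Icc a b)), f t = 0 := by
  rw [intervalIntegral.integral_of_le hab, ← integral_Icc_eq_integral_Ioc] at h
  have h0 := (integral_eq_zero_iff_of_nonneg (fun t => sq_nonneg (f t)) hf.integrable_sq).1
    (le_antisymm h (integral_nonneg fun t => sq_nonneg (f t)))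
  filter_upwards [h0] with t ht
  exact pow_eq_zero_iff two_ne_zero |>.1 ht

/-- Uniqueness of the optimal control in the presence of an extremal one. -/
lemma IsCostate.control_unique (hl : IsCostate S s u v l₁ l₂) (hs : s < S.T)
    (h : IsTrajectory S s u₀ v₀ u v U) (hU : IsExtremalControl S s l₂ U)
    (h' : IsOptimal S s u₀ v₀ u' v' U') :
    ∀ᵐ t ∂(volume.restrict (Icc s S.T)), U' t = U t := by
  have h1 := hl.cost_add_le hs h hU h'.1
  have h2 := h'.2 u v U h
  have h3 : ∫ t in s..S.T, (U' t - U t) ^ 2 ≤ 0 := by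
    have hR := S.R_pos
    by_contra hc
    nlinarith [mul_pos hR (not_le.1 hc)]
  filter_upwards [ae_eq_zero_of_integral_sq hs.le (h'.1.control.sub h.control) h3] with t ht
  exact sub_eq_zero.1 ht

/-- The maximum principle: an optimal control is extremal. -/
lemma IsOptimal.isExtremalControl (h : IsOptimal S s u₀ v₀ u v U) (hs : s < S.T)
    (hl : IsCostate S s u v l₁ l₂) : IsExtremalControl S s l₂ U := by
  -- the variation `d` of the control is the defect of extremality
  set d : ℝ → ℝ := fun t => U t + S.ε₂ / S.R * l₂ 1 t with hd
  have hR := S.R_pos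
  have hdm : MemLp d 2 (volume.restrict (Icc s S.T)) :=
    h.1.control.add (memLp_Icc_of_continuousOn
      (continuousOn_const.mul (slice_right hl.cont₂ (by simp))))
  obtain ⟨a, b, hw⟩ := exists_trajectory S hs 0 0 hdm (k := fun _ => 0) continuous_const
  simp only [inner_zero_left, add_zero] at hw
  set N := ∫ t in s..S.T, d t ^ 2 with hN
  have hcr : crossCost S s u v U a b d = S.R * N := by
    rw [hl.crossCost_eq hs h.1 hw, hN, ← intervalIntegral.integral_const_mul, inner_zero_right,
      inner_zero_right, zero_add, zero_add]
    congr 1; ext t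
    simp only [hd]; field_simp
  have hvar : ∀ c : ℝ, 0 ≤ c * (S.R * N) + c ^ 2 * cost S s a b d := fun c => by
    have h1 := h.1.add_const_mul hs hw c
    simp only [smul_zero, add_zero] at h1
    have h2 := h.2 _ _ _ h1
    rw [cost_add_const_mul hs.le h.1 hw c, hcr] at h2
    linarith
  have hN0 : N ≤ 0 := by
    by_contra hc
    push Not at hc
    have hB := control_le_cost hs.le hw
    have hB' : 0 < cost S s a b d := lt_of_lt_of_le (mul_pos (by linarith) hc) hB
    -- the minimizer of the quadratic polynomial in `c`
    have := hvar (-(S.R * N) / (2 * cost S s a b d))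
    have e : -(S.R * N) / (2 * cost S s a b d) * (S.R * N)
        + (-(S.R * N) / (2 * cost S s a b d)) ^ 2 * cost S s a b d
        = -((S.R * N) ^ 2 / (4 * cost S s a b d)) := by
      field_simp; ring
    rw [e] at this
    have : 0 < (S.R * N) ^ 2 / (4 * cost S s a b d) := by positivity
    linarith
  filter_upwards [ae_eq_zero_of_integral_sq hs.le hdm hN0] with t ht
  simp only [hd] at ht
  linarith

end Costate

/-! ### Time-varying kernels applied to trajectories -/

section Kernels

variable {T : ℝ} {F P Px Py Pt : ℝ → ℝ → ℝ → ℝ}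

lemma cube_slice (hF : ContinuousOn (fun p : ℝ × ℝ × ℝ => F p.1 p.2.1 p.2.2)
      (Icc (0 : ℝ) 1 ×ˢ Icc (0 : ℝ) 1 ×ˢ Icc 0 T)) {x t : ℝ} (hx : x ∈ Icc (0 : ℝ) 1)
    (ht : t ∈ Icc 0 T) : ContinuousOn (fun y => F x y t) (Icc 0 1) :=
  hF.comp (f := fun y => (x, y, t)) (by fun_prop) fun _ hy => ⟨hx, hy, ht⟩

lemma continuousOn_toL2_cube (hF : ContinuousOn (fun p : ℝ × ℝ × ℝ => F p.1 p.2.1 p.2.2)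
      (Icc (0 : ℝ) 1 ×ˢ Icc (0 : ℝ) 1 ×ˢ Icc 0 T)) :
    ContinuousOn (fun p : ℝ × ℝ => toL2 fun y => F p.1 y p.2) (Icc (0 : ℝ) 1 ×ˢ Icc 0 T) :=
  continuousOn_toL2 (K := fun (p : ℝ × ℝ) y => F p.1 y p.2)
    (hF.comp (f := fun q : (ℝ × ℝ) × ℝ => (q.1.1, q.2, q.1.2)) (by fun_prop)
      fun _ hq => ⟨hq.1.1, hq.2, hq.1.2⟩)

lemma applyKernel_eq_inner (hP : ContinuousOn (fun p : ℝ × ℝ × ℝ => P p.1 p.2.1 p.2.2)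
      (Icc (0 : ℝ) 1 ×ˢ Icc (0 : ℝ) 1 ×ˢ Icc 0 T)) (w : ℝ → L2) {x t : ℝ}
    (hx : x ∈ Icc (0 : ℝ) 1) (ht : t ∈ Icc 0 T) :
    applyKernel P w x t = inner ℝ (toL2 fun y => P x y t) (w t) :=
  kernelOp_eq_inner (K := fun x' y => P x' y t) (cube_slice hP hx ht) (w t)

lemma continuousOn_applyKernel (hP : ContinuousOn (fun p : ℝ × ℝ × ℝ => P p.1 p.2.1 p.2.2)
      (Icc (0 : ℝ) 1 ×ˢ Icc (0 : ℝ) 1 ×ˢ Icc 0 T)) {w : ℝ → L2} {s : ℝ} (hs : 0 ≤ s)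
    (hw : ContinuousOn w (Icc s T)) :
    ContinuousOn (fun p : ℝ × ℝ => applyKernel P w p.1 p.2) (Icc (0 : ℝ) 1 ×ˢ Icc s T) := by
  have hsub : Icc (0 : ℝ) 1 ×ˢ Icc s T ⊆ Icc (0 : ℝ) 1 ×ˢ Icc 0 T :=
    prod_mono_right (Icc_subset_Icc_left hs)
  refine (((continuousOn_toL2_cube hP).mono hsub).inner
    (hw.comp continuousOn_snd fun _ hp => hp.2)).congr fun p hp => ?_
  exact applyKernel_eq_inner hP w hp.1 (hsub hp).2

/-- Differentiation in the parameter `x` commutes with passing to the class in `L²`, as the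
difference quotients converge uniformly in `y`. -/
lemma IsC1Cube.hasDerivWithinAt_toL2 (h : IsC1Cube T P Px Py Pt) {x t : ℝ}
    (hx : x ∈ Icc (0 : ℝ) 1) (ht : t ∈ Icc 0 T) :
    HasDerivWithinAt (fun x' => toL2 fun y => P x' y t) (toL2 fun y => Px x y t) (Icc 0 1) x := by
  have hc : ContinuousOn (fun p : ℝ × ℝ => Px p.1 p.2 t) (Icc (0 : ℝ) 1 ×ˢ Icc (0 : ℝ) 1) :=
    h.cont_dx.comp (f := fun p : ℝ × ℝ => (p.1, p.2, t)) (by fun_prop)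
      fun p hp => ⟨hp.1, hp.2, ht⟩
  have hu := (isCompact_Icc.prod isCompact_Icc).uniformContinuousOn_of_continuous hc
  rw [hasDerivWithinAt_iff_isLittleO, Asymptotics.isLittleO_iff]
  intro ε hε
  obtain ⟨δ, hδ, hu⟩ := Metric.uniformContinuousOn_iff.1 hu ε hε
  filter_upwards [inter_mem_nhdsWithin (Icc (0 : ℝ) 1) (Metric.ball_mem_nhds x hδ)] with x' hx'
  have c1 := cube_slice h.cont hx'.1 ht
  have c2 := cube_slice h.cont hx ht
  have c3 := cube_slice h.cont_dx hx ht
  have e : toL2 (fun y => P x' y t) - toL2 (fun y => P x y t) - (x' - x) • toL2 (fun y => Px x y t)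
      = toL2 fun y => P x' y t - P x y t - (x' - x) * Px x y t := by
    rw [← toL2_sub c1 c2, ← toL2_const_mul _ c3,
      ← toL2_sub (f := fun y => P x' y t - P x y t) (c1.sub c2)
        (g := fun y => (x' - x) * Px x y t) (continuousOn_const.mul c3)]
  rw [e]
  refine norm_toL2_le (g := fun y => P x' y t - P x y t - (x' - x) * Px x y t) ((c1.sub c2).sub (continuousOn_const.mul c3))
    (mul_nonneg hε.le (norm_nonneg _)) fun y hy => ?_
  have key := Convex.norm_image_sub_le_of_norm_hasDerivWithin_le
      (f := fun z => P z y t - Px x y t * z) (f' := fun z => Px z y t - Px x y t)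
      (s := Icc 0 1 ∩ Metric.ball x δ) (C := ε) (fun z hz => ?_) (fun z hz => ?_)
      ((convex_Icc 0 1).inter (convex_ball x δ)) ⟨hx, Metric.mem_ball_self hδ⟩ hx'
  · rw [Real.norm_eq_abs] at key
    refine le_trans (le_of_eq ?_) key
    congr 1; ring
  · have := ((h.dx z hz.1 y hy t ht).mono inter_subset_left).fun_sub
      (((hasDerivAt_id z).const_mul (Px x y t)).hasDerivWithinAt (s := Icc 0 1 ∩ Metric.ball x δ))
    simpa using this
  · refine (hu (z, y) ⟨hz.1, hy⟩ (x, y) ⟨hx, hy⟩ ?_).le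
    rw [Prod.dist_eq]
    simpa [hδ] using hz.2

lemma IsC1Cube.hasDerivWithinAt_applyKernel (h : IsC1Cube T P Px Py Pt) (w : ℝ → L2) {x t : ℝ}
    (hx : x ∈ Icc (0 : ℝ) 1) (ht : t ∈ Icc 0 T) :
    HasDerivWithinAt (fun x' => applyKernel P w x' t) (applyKernel Px w x t) (Icc 0 1) x := by
  have h1 := (h.hasDerivWithinAt_toL2 hx ht).inner ℝ (hasDerivWithinAt_const x (Icc 0 1) (w t))
  rw [inner_zero_right, zero_add, ← applyKernel_eq_inner h.cont_dx w hx ht] at h1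
  exact h1.congr (fun x' hx' => applyKernel_eq_inner h.cont w hx' ht)
    (applyKernel_eq_inner h.cont w hx ht)

lemma IsC1Cube.derivWithin_applyKernel (h : IsC1Cube T P Px Py Pt) (w : ℝ → L2) {x t : ℝ}
    (hx : x ∈ Icc (0 : ℝ) 1) (ht : t ∈ Icc 0 T) :
    derivWithin (fun x' => applyKernel P w x' t) (Icc 0 1) x = applyKernel Px w x t :=
  (h.hasDerivWithinAt_applyKernel w hx ht).derivWithin (uniqueDiffOn_Icc zero_lt_one x hx)

lemma hasDerivWithinAt_of_integral {a b : ℝ} {f g : ℝ → ℝ} (hg : ContinuousOn g (Icc a b))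
    (h : ∀ τ ∈ Icc a b, f τ - f a = ∫ r in a..τ, g r) {t : ℝ} (ht : t ∈ Icc a b) :
    HasDerivWithinAt f (g t) (Icc a b) t := by
  obtain ⟨g', hg', he⟩ := exists_continuous_extension hg (ht.1.trans ht.2)
  have h1 := (hg'.integral_hasStrictDerivAt a t).hasDerivAt.hasDerivWithinAt (s := Icc a b)
  have h2 : ∀ τ ∈ Icc a b, f τ = f a + ∫ r in a..τ, g' r := fun τ hτ => by
    rw [← sub_eq_iff_eq_add', h τ hτ]
    refine intervalIntegral.integral_congr fun r hr => ?_
    rw [uIcc_of_le hτ.1] at hr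
    exact (he ⟨hr.1, hr.2.trans hτ.2⟩).symm
  rw [← he ht]
  exact (h1.const_add (f a)).congr h2 (h2 t ht)

end Kernels

section Trajectory

variable {S : Problem} {s : ℝ} {u₀ v₀ : L2} {u v : ℝ → L2} {U : ℝ → ℝ}
  {P₁ P₁x P₁y P₁t P₂ P₂x P₂y P₂t : ℝ → ℝ → ℝ → ℝ}

/-- The time derivative of `P₁ u` along a trajectory. The slice `P₁(x,·,·)` is an admissible test
function because it vanishes at both ends. -/
lemma IsTrajectory.hasDerivWithinAt_applyKernel_fst (h : IsTrajectory S s u₀ v₀ u v U)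
    (hs : s ∈ Ico 0 S.T) (hP : IsC1Cube S.T P₁ P₁x P₁y P₁t)
    (h1 : ∀ x ∈ Icc (0 : ℝ) 1, ∀ t ∈ Icc 0 S.T, P₁ x 1 t = 0)
    (h0 : ∀ x ∈ Icc (0 : ℝ) 1, ∀ t ∈ Icc 0 S.T, P₁ x 0 t = 0)
    {x t : ℝ} (hx : x ∈ Icc (0 : ℝ) 1) (ht : t ∈ Icc s S.T) :
    HasDerivWithinAt (applyKernel P₁ u x)
      (inner ℝ (u t) (toL2 fun y => P₁t x y t + S.ε₁ * P₁y x y t)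
        + inner ℝ (v t) (toL2 fun y => S.c₁ y * P₁ x y t)) (Icc s S.T) t := by
  have hφ := (hP.slice hx).mono hs.1 (le_refl S.T)
  have hψ := IsC1Rect.const_zero (a := s) (b := S.T)
  have hsub : ∀ r ∈ Icc s S.T, r ∈ Icc 0 S.T := fun r hr => ⟨hs.1.trans hr.1, hr.2⟩
  have e1 : ∀ r, adjFst S (P₁y x) (P₁t x) (fun _ _ => 0) r = fun t => P₁t x r t + S.ε₁ * P₁y x r t :=
    fun r => by ext t; simp [adjFst]
  have e2 : ∀ r, adjSnd S (fun _ _ => 0) (fun _ _ => 0) (P₁ x) r = fun t => S.c₁ r * P₁ x r t :=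
    fun r => by ext t; simp [adjSnd]
  have hc := continuousOn_inner_adj (S := S) h.cont_u h.cont_v hφ hψ
  simp only [e1, e2] at hc
  refine hasDerivWithinAt_of_integral hc (fun τ hτ => ?_) ht
  have key := h.weak_inner hs.2 hφ hψ (fun r hr => h1 x hx r (hsub r hr))
    (fun r hr => by rw [h0 x hx r (hsub r hr), mul_zero, mul_zero]) hτ
  simp only [e1, e2] at key
  rw [applyKernel_eq_inner hP.cont u hx (hsub τ hτ),
    applyKernel_eq_inner hP.cont u hx (hsub s ⟨le_rfl, hs.2.le⟩), h.init_u]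
  simp only [toL2_zero, inner_zero_right, add_zero, mul_zero, zero_mul, intervalIntegral.integral_zero]
    at key
  rw [real_inner_comm, real_inner_comm u₀]
  exact key

/-- The time derivative of `P₂ v` along a trajectory with feedback control. The slice `P₂(x,·,·)`
vanishes at `y = 0` only, so the control enters through its value at `y = 1`. -/
lemma IsTrajectory.hasDerivWithinAt_applyKernel_snd (h : IsTrajectory S s u₀ v₀ u v U)
    (hs : s ∈ Ico 0 S.T) (hP : IsC1Cube S.T P₂ P₂x P₂y P₂t)
    (h0 : ∀ x ∈ Icc (0 : ℝ) 1, ∀ t ∈ Icc 0 S.T, P₂ x 0 t = 0)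
    (hU : IsExtremalControl S s (applyKernel P₂ v) U)
    {x t : ℝ} (hx : x ∈ Icc (0 : ℝ) 1) (ht : t ∈ Icc s S.T) :
    HasDerivWithinAt (applyKernel P₂ v x)
      (inner ℝ (u t) (toL2 fun y => S.c₂ y * P₂ x y t)
        + inner ℝ (v t) (toL2 fun y => P₂t x y t - S.ε₂ * P₂y x y t)
        - S.ε₂ ^ 2 / S.R * P₂ x 1 t * applyKernel P₂ v 1 t) (Icc s S.T) t := by
  have hψ := (hP.slice hx).mono hs.1 (le_refl S.T)
  have hφ := IsC1Rect.const_zero (a := s) (b := S.T)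
  have hsub : ∀ r ∈ Icc s S.T, r ∈ Icc 0 S.T := fun r hr => ⟨hs.1.trans hr.1, hr.2⟩
  have e1 : ∀ r, adjFst S (fun _ _ => 0) (fun _ _ => 0) (P₂ x) r = fun t => S.c₂ r * P₂ x r t :=
    fun r => by ext t; simp [adjFst]
  have e2 : ∀ r, adjSnd S (P₂y x) (P₂t x) (fun _ _ => 0) r = fun t => P₂t x r t - S.ε₂ * P₂y x r t :=
    fun r => by ext t; simp [adjSnd]
  have hc := continuousOn_inner_adj (S := S) h.cont_u h.cont_v hφ hψ
  simp only [e1, e2] at hc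
  have hl := slice_right (continuousOn_applyKernel hP.cont hs.1 h.cont_v) (x := 1) (by simp)
  have hp := slice_right hψ.cont (x := 1) (by simp)
  have hκ : ContinuousOn (fun t => S.ε₂ ^ 2 / S.R * P₂ x 1 t * applyKernel P₂ v 1 t)
      (Icc s S.T) := (continuousOn_const.mul hp).mul hl
  refine hasDerivWithinAt_of_integral (hc.fun_sub hκ) (fun τ hτ => ?_) ht
  have key := h.weak_inner hs.2 hφ hψ (fun r hr => rfl)
    (fun r hr => by rw [h0 x hx r (hsub r hr), mul_zero, mul_zero]) hτ
  simp only [e1, e2] at key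
  have hctrl : (∫ r in s..τ, S.ε₂ * P₂ x 1 r * U r)
      = -∫ r in s..τ, S.ε₂ ^ 2 / S.R * P₂ x 1 r * applyKernel P₂ v 1 r := by
    rw [← intervalIntegral.integral_neg]
    refine intervalIntegral.integral_congr_ae ?_
    have hU' := (ae_restrict_iff' measurableSet_Icc).1 hU
    filter_upwards [hU'] with r hr hr'
    rw [uIoc_of_le hτ.1] at hr'
    rw [hr ⟨hr'.1.le, hr'.2.trans hτ.2⟩]
    ring
  rw [applyKernel_eq_inner hP.cont v hx (hsub τ hτ),
    applyKernel_eq_inner hP.cont v hx (hsub s ⟨le_rfl, hs.2.le⟩), h.init_v,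
    intervalIntegral.integral_sub (intervalIntegrable_of_continuousOn hc hτ)
      (intervalIntegrable_of_continuousOn hκ hτ)]
  simp only [toL2_zero, inner_zero_right, zero_add, hctrl] at key
  rw [real_inner_comm, real_inner_comm v₀]
  linear_combination key

end Trajectory

/-! ### The Riccati equations give the co-states -/

section Riccati

variable {S : Problem} {s : ℝ} {u₀ v₀ : L2} {u v : ℝ → L2} {U : ℝ → ℝ}
  {P₁ P₁x P₁y P₁t P₂ P₂x P₂y P₂t : ℝ → ℝ → ℝ → ℝ}

/-- An identity between continuous functions on the closed cube has to be checked on the open cube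
only. -/
lemma eqOn_cube_of_open {T : ℝ} (hT : 0 < T) {F G : ℝ → ℝ → ℝ → ℝ}
    (hF : ContinuousOn (fun p : ℝ × ℝ × ℝ => F p.1 p.2.1 p.2.2)
      (Icc (0 : ℝ) 1 ×ˢ Icc (0 : ℝ) 1 ×ˢ Icc 0 T))
    (hG : ContinuousOn (fun p : ℝ × ℝ × ℝ => G p.1 p.2.1 p.2.2)
      (Icc (0 : ℝ) 1 ×ˢ Icc (0 : ℝ) 1 ×ˢ Icc 0 T))
    (h : ∀ x ∈ Ioo (0 : ℝ) 1, ∀ y ∈ Ioo (0 : ℝ) 1, ∀ t ∈ Ioo 0 T, F x y t = G x y t) :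
    ∀ x ∈ Icc (0 : ℝ) 1, ∀ y ∈ Icc (0 : ℝ) 1, ∀ t ∈ Icc 0 T, F x y t = G x y t := by
  have h' : EqOn (fun p : ℝ × ℝ × ℝ => F p.1 p.2.1 p.2.2) (fun p => G p.1 p.2.1 p.2.2)
      (Ioo (0 : ℝ) 1 ×ˢ Ioo (0 : ℝ) 1 ×ˢ Ioo 0 T) := fun p hp =>
    h p.1 hp.1 p.2.1 hp.2.1 p.2.2 hp.2.2
  have := h'.of_subset_closure hF hG (prod_mono Ioo_subset_Icc_self
    (prod_mono Ioo_subset_Icc_self Ioo_subset_Icc_self)) (by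
      rw [closure_prod_eq, closure_prod_eq, closure_Ioo zero_ne_one, closure_Ioo hT.ne])
  exact fun x hx y hy t ht => this (x := (x, y, t)) ⟨hx, hy, ht⟩

lemma IsC1Cube.deriv_x {T : ℝ} (h : IsC1Cube T P₁ P₁x P₁y P₁t) {x y t : ℝ}
    (hx : x ∈ Ioo (0 : ℝ) 1) (hy : y ∈ Icc (0 : ℝ) 1) (ht : t ∈ Icc 0 T) :
    deriv (fun x' => P₁ x' y t) x = P₁x x y t :=
  ((h.dx x (Ioo_subset_Icc_self hx) y hy t ht).hasDerivAt (Icc_mem_nhds hx.1 hx.2)).deriv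

lemma IsC1Cube.deriv_y {T : ℝ} (h : IsC1Cube T P₁ P₁x P₁y P₁t) {x y t : ℝ}
    (hx : x ∈ Icc (0 : ℝ) 1) (hy : y ∈ Ioo (0 : ℝ) 1) (ht : t ∈ Icc 0 T) :
    deriv (fun y' => P₁ x y' t) y = P₁y x y t :=
  ((h.dy x hx y (Ioo_subset_Icc_self hy) t ht).hasDerivAt (Icc_mem_nhds hy.1 hy.2)).deriv

lemma IsC1Cube.deriv_t {T : ℝ} (h : IsC1Cube T P₁ P₁x P₁y P₁t) {x y t : ℝ}
    (hx : x ∈ Icc (0 : ℝ) 1) (hy : y ∈ Icc (0 : ℝ) 1) (ht : t ∈ Ioo 0 T) :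
    deriv (fun t' => P₁ x y t') t = P₁t x y t :=
  ((h.dt x hx y hy t (Ioo_subset_Icc_self ht)).hasDerivAt (Icc_mem_nhds ht.1 ht.2)).deriv

lemma IsWeight.continuousOn_cube {K : ℝ → ℝ → ℝ} (h : IsWeight K) (T : ℝ) :
    ContinuousOn (fun p : ℝ × ℝ × ℝ => K p.1 p.2.1)
      (Icc (0 : ℝ) 1 ×ˢ Icc (0 : ℝ) 1 ×ˢ Icc 0 T) :=
  h.continuousOn.comp (f := fun p : ℝ × ℝ × ℝ => (p.1, p.2.1)) (by fun_prop)
    fun _ hp => ⟨hp.1, hp.2.1⟩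

lemma IsRiccatiSolution.closed_eq₁ (h : IsRiccatiSolution S P₁ P₂)
    (hP : IsC1Cube S.T P₁ P₁x P₁y P₁t) :
    ∀ x ∈ Icc (0 : ℝ) 1, ∀ y ∈ Icc (0 : ℝ) 1, ∀ t ∈ Icc 0 S.T,
      P₁t x y t + S.ε₁ * P₁y x y t = -(S.ε₁ * P₁x x y t + S.Q₁ x y) := by
  refine eqOn_cube_of_open S.T_pos (hP.cont_dt.add (continuousOn_const.mul hP.cont_dy))
    ((continuousOn_const.mul hP.cont_dx).add (S.Q₁_weight.continuousOn_cube S.T)).neg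
    fun x hx y hy t ht => ?_
  have e := h.eq₁ x hx y hy t ht
  rw [hP.deriv_t (Ioo_subset_Icc_self hx) (Ioo_subset_Icc_self hy) ht,
    hP.deriv_x hx (Ioo_subset_Icc_self hy) (Ioo_subset_Icc_self ht),
    hP.deriv_y (Ioo_subset_Icc_self hx) hy (Ioo_subset_Icc_self ht)] at e
  linear_combination -e

lemma IsRiccatiSolution.closed_eq₂ (h : IsRiccatiSolution S P₁ P₂)
    (hP : IsC1Cube S.T P₂ P₂x P₂y P₂t) :
    ∀ x ∈ Icc (0 : ℝ) 1, ∀ y ∈ Icc (0 : ℝ) 1, ∀ t ∈ Icc 0 S.T,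
      P₂t x y t - S.ε₂ * P₂y x y t
        = S.ε₂ ^ 2 / S.R * P₂ x 1 t * P₂ 1 y t + S.ε₂ * P₂x x y t - S.Q₂ x y := by
  have c1 : ContinuousOn (fun p : ℝ × ℝ × ℝ => P₂ p.1 1 p.2.2)
      (Icc (0 : ℝ) 1 ×ˢ Icc (0 : ℝ) 1 ×ˢ Icc 0 S.T) :=
    hP.cont.comp (f := fun p : ℝ × ℝ × ℝ => (p.1, 1, p.2.2)) (by fun_prop)
      fun p hp => ⟨hp.1, by simp, hp.2.2⟩
  have c2 : ContinuousOn (fun p : ℝ × ℝ × ℝ => P₂ 1 p.2.1 p.2.2)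
      (Icc (0 : ℝ) 1 ×ˢ Icc (0 : ℝ) 1 ×ˢ Icc 0 S.T) :=
    hP.cont.comp (f := fun p : ℝ × ℝ × ℝ => (1, p.2.1, p.2.2)) (by fun_prop)
      fun p hp => ⟨by simp, hp.2.1, hp.2.2⟩
  refine eqOn_cube_of_open S.T_pos (hP.cont_dt.sub (continuousOn_const.mul hP.cont_dy))
    ((((continuousOn_const.mul c1).mul c2).add (continuousOn_const.mul hP.cont_dx)).sub
      (S.Q₂_weight.continuousOn_cube S.T))
    fun x hx y hy t ht => ?_
  have e := h.eq₂ x hx y hy t ht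
  rw [hP.deriv_t (Ioo_subset_Icc_self hx) (Ioo_subset_Icc_self hy) ht,
    hP.deriv_x hx (Ioo_subset_Icc_self hy) (Ioo_subset_Icc_self ht),
    hP.deriv_y (Ioo_subset_Icc_self hx) hy (Ioo_subset_Icc_self ht)] at e
  linear_combination -e

/-- Along a trajectory with the feedback of a Riccati solution, `P₁ u` and `P₂ v` are the
co-states. -/
lemma IsRiccatiSolution.isCostate (h : IsRiccatiSolution S P₁ P₂)
    (hP₁ : IsC1Cube S.T P₁ P₁x P₁y P₁t) (hP₂ : IsC1Cube S.T P₂ P₂x P₂y P₂t)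
    (hs : s ∈ Ico 0 S.T) (hz : IsTrajectory S s u₀ v₀ u v U)
    (hU : IsExtremalControl S s (applyKernel P₂ v) U) :
    IsCostate S s u v (applyKernel P₁ u) (applyKernel P₂ v) := by
  have hsub : ∀ {t}, t ∈ Icc s S.T → t ∈ Icc 0 S.T := fun ht => ⟨hs.1.trans ht.1, ht.2⟩
  have h01 : (1 : ℝ) ∈ Icc (0 : ℝ) 1 := by simp
  have h00 : (0 : ℝ) ∈ Icc (0 : ℝ) 1 := by simp
  have zero_of : ∀ {P : ℝ → ℝ → ℝ → ℝ} {w : ℝ → L2} {x t : ℝ},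
      (∀ y ∈ Icc (0 : ℝ) 1, P x y t = 0) → applyKernel P w x t = 0 := fun {P w x t} hP => by
    refine integral_eq_zero_of_ae ?_
    filter_upwards [ae_unitMeasure_mem] with y hy
    rw [hP y hy, zero_mul, Pi.zero_apply]
  exact
  { cont₁ := continuousOn_applyKernel hP₁.cont hs.1 hz.cont_u
    cont₂ := continuousOn_applyKernel hP₂.cont hs.1 hz.cont_v
    diff₁ := fun t ht x hx =>
      (hP₁.hasDerivWithinAt_applyKernel u hx (hsub ht)).differentiableWithinAt
    diff₂ := fun t ht x hx =>
      (hP₂.hasDerivWithinAt_applyKernel v hx (hsub ht)).differentiableWithinAt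
    cont_dx₁ := (continuousOn_applyKernel hP₁.cont_dx hs.1 hz.cont_u).congr fun p hp =>
      hP₁.derivWithin_applyKernel u hp.1 (hsub hp.2)
    cont_dx₂ := (continuousOn_applyKernel hP₂.cont_dx hs.1 hz.cont_v).congr fun p hp =>
      hP₂.derivWithin_applyKernel v hp.1 (hsub hp.2)
    eq₁ := fun x hx t ht => by
      have ht' := hsub ht
      convert hz.hasDerivWithinAt_applyKernel_fst hs hP₁ h.P₁_right_one h.P₁_right_zero hx ht
        using 1
      have cx := cube_slice hP₁.cont_dx hx ht'
      have cQ := kernel_slice S.Q₁_weight.continuousOn hx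
      have c2 := cube_slice hP₂.cont hx ht'
      rw [hP₁.derivWithin_applyKernel u hx ht', applyKernel_eq_inner hP₁.cont_dx u hx ht',
        applyKernel_eq_inner hP₂.cont v hx ht', kernelOp_eq_inner cQ,
        toL2_congr (f := fun y => P₁t x y t + S.ε₁ * P₁y x y t)
          (g := fun y => -1 * (S.ε₁ * P₁x x y t + S.Q₁ x y)) fun y hy => by
            linear_combination h.closed_eq₁ hP₁ x hx y hy t ht',
        toL2_congr (f := fun y => S.c₁ y * P₁ x y t) (g := fun y => -S.c₂ x * P₂ x y t)
          fun y hy => by linear_combination h.algebraic x hx y hy t ht',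
        toL2_const_mul (g := fun y => S.ε₁ * P₁x x y t + S.Q₁ x y) _
          ((continuousOn_const.mul cx).add cQ),
        toL2_add (f := fun y => S.ε₁ * P₁x x y t) (continuousOn_const.mul cx) cQ,
        toL2_const_mul _ cx, toL2_const_mul _ c2]
      simp only [inner_add_right, inner_smul_right, real_inner_comm]
      ring
    eq₂ := fun x hx t ht => by
      have ht' := hsub ht
      convert hz.hasDerivWithinAt_applyKernel_snd hs hP₂ h.P₂_right_zero hU hx ht using 1
      have cx := cube_slice hP₂.cont_dx hx ht'
      have c21 := cube_slice hP₂.cont h01 ht'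
      have cQ := kernel_slice S.Q₂_weight.continuousOn hx
      have c1 := cube_slice hP₁.cont hx ht'
      rw [hP₂.derivWithin_applyKernel v hx ht', applyKernel_eq_inner hP₂.cont_dx v hx ht',
        applyKernel_eq_inner hP₁.cont u hx ht', applyKernel_eq_inner hP₂.cont v h01 ht',
        kernelOp_eq_inner cQ,
        toL2_congr (f := fun y => P₂t x y t - S.ε₂ * P₂y x y t)
          (g := fun y => S.ε₂ ^ 2 / S.R * P₂ x 1 t * P₂ 1 y t + S.ε₂ * P₂x x y t - S.Q₂ x y)
          fun y hy => h.closed_eq₂ hP₂ x hx y hy t ht',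
        toL2_congr (f := fun y => S.c₂ y * P₂ x y t) (g := fun y => -S.c₁ x * P₁ x y t)
          fun y hy => by linear_combination h.algebraic' x hx y hy t ht',
        toL2_sub (f := fun y => S.ε₂ ^ 2 / S.R * P₂ x 1 t * P₂ 1 y t + S.ε₂ * P₂x x y t)
          ((continuousOn_const.mul c21).add (continuousOn_const.mul cx)) cQ,
        toL2_add (f := fun y => S.ε₂ ^ 2 / S.R * P₂ x 1 t * P₂ 1 y t)
          (g := fun y => S.ε₂ * P₂x x y t) (continuousOn_const.mul c21)
          (continuousOn_const.mul cx),
        toL2_const_mul _ cx, toL2_const_mul _ c1, toL2_const_mul _ c21]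
      simp only [inner_add_right, inner_sub_right, inner_smul_right]
      rw [real_inner_comm (v t), real_inner_comm (u t), real_inner_comm (v t),
        real_inner_comm (v t)]
      ring
    at_one := fun t ht => zero_of fun y hy => h.P₁_left_one y hy t (hsub ht)
    at_zero := fun t ht => by
      rw [zero_of fun y hy => h.P₂_left_zero y hy t (hsub ht),
        zero_of fun y hy => h.P₁_left_zero y hy t (hsub ht), mul_zero]
    final₁ := fun x hx => integral_congr_ae (by
      filter_upwards [ae_unitMeasure_mem] with y hy
      rw [h.final₁ x hx y hy])
    final₂ := fun x hx => integral_congr_ae (by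
      filter_upwards [ae_unitMeasure_mem] with y hy
      rw [h.final₂ x hx y hy]) }

/-- The closed loop: there is a trajectory with the feedback control. -/
lemma exists_closed_loop (hP₂ : IsC1Cube S.T P₂ P₂x P₂y P₂t) (hs : s ∈ Ico 0 S.T) (u₀ v₀ : L2) :
    ∃ (u v : ℝ → L2) (U : ℝ → ℝ), IsTrajectory S s u₀ v₀ u v U ∧
      IsExtremalControl S s (applyKernel P₂ v) U := by
  have h01 : (1 : ℝ) ∈ Icc (0 : ℝ) 1 := by simp
  have hc : ContinuousOn (fun t => -(S.ε₂ / S.R) • toL2 fun y => P₂ 1 y t) (Icc s S.T) :=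
    ContinuousOn.fun_const_smul (continuousOn_toL2_slice ((hP₂.slice h01).mono hs.1 le_rfl).cont) _
  obtain ⟨k, hk, hk'⟩ := exists_continuous_extension hc hs.2.le
  obtain ⟨u, v, h⟩ := exists_trajectory S hs.2 u₀ v₀ (f := fun _ => 0) (by simp) hk
  refine ⟨u, v, _, h, ?_⟩
  filter_upwards [ae_restrict_mem measurableSet_Icc] with t ht
  rw [zero_add, hk' ht, inner_smul_left,
    applyKernel_eq_inner hP₂.cont v h01 ⟨hs.1.trans ht.1, ht.2⟩]
  rfl

lemma IsExtremalControl.congr {l₂ l₂' : ℝ → ℝ → ℝ} {U' : ℝ → ℝ} (h : IsExtremalControl S s l₂ U)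
    (hl : ∀ t ∈ Icc s S.T, l₂' 1 t = l₂ 1 t)
    (hU : ∀ᵐ t ∂(volume.restrict (Icc s S.T)), U' t = U t) : IsExtremalControl S s l₂' U' := by
  filter_upwards [h, hU, ae_restrict_mem measurableSet_Icc] with t h1 h2 h3
  rw [h2, h1, hl t h3]

/-- For a Riccati solution the optimal trajectories are those with the feedback control. -/
lemma IsRiccatiSolution.isOptimal_iff (h : IsRiccatiSolution S P₁ P₂)
    (hP₁ : IsC1Cube S.T P₁ P₁x P₁y P₁t) (hP₂ : IsC1Cube S.T P₂ P₂x P₂y P₂t)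
    (hs : s ∈ Ico 0 S.T) (hz : IsTrajectory S s u₀ v₀ u v U) :
    IsOptimal S s u₀ v₀ u v U ↔ IsExtremalControl S s (applyKernel P₂ v) U := by
  refine ⟨fun ho => ?_, fun hU => (h.isCostate hP₁ hP₂ hs hz hU).isOptimal hs.2 hz hU⟩
  -- the optimal control is that of the closed loop, hence so is the state in the feedback law
  obtain ⟨a, b, V, hV, hVU⟩ := exists_closed_loop hP₂ hs u₀ v₀
  have hUV := (h.isCostate hP₁ hP₂ hs hV hVU).control_unique hs.2 hV hVU ho
  refine hVU.congr (fun t ht => ?_) hUV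
  rw [applyKernel, applyKernel, (IsTrajectory.unique hs hV hz hUV t ht).2]

lemma IsRiccatiSolution.representsCostates (h : IsRiccatiSolution S P₁ P₂)
    (hP₁ : IsC1Cube S.T P₁ P₁x P₁y P₁t) (hP₂ : IsC1Cube S.T P₂ P₂x P₂y P₂t) :
    RepresentsCostates S P₁ P₂ := by
  intro s hs u₀ v₀
  refine ⟨?_, fun u v U ho =>
    h.isCostate hP₁ hP₂ hs ho.1 ((h.isOptimal_iff hP₁ hP₂ hs ho.1).1 ho)⟩
  obtain ⟨a, b, V, hV, hVU⟩ := exists_closed_loop hP₂ hs u₀ v₀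
  exact ⟨a, b, V, (h.isOptimal_iff hP₁ hP₂ hs hV).2 hVU⟩

end Riccati

/-! ### The co-states give the Riccati equations -/

section Terminal

variable {S : Problem} {s : ℝ} {u₀ v₀ : L2} {u v : ℝ → L2} {U : ℝ → ℝ}

lemma isC1Rect_of_contDiff {g : ℝ → ℝ} (hg : ContDiff ℝ 1 g) (a b : ℝ) :
    IsC1Rect a b (fun x _ => g x) (fun x _ => deriv g x) (fun _ _ => 0) := by
  have hc := hg.continuous_deriv le_rfl
  have hc' := hg.continuous
  exact ⟨by fun_prop, by fun_prop, continuousOn_const,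
    fun x _ t _ => (hg.differentiable one_ne_zero x).hasDerivAt.hasDerivWithinAt,
    fun x _ t _ => hasDerivWithinAt_const _ _ _⟩

/-- A bounded trajectory moves little in a short time when it is tested with smooth functions that
vanish near the boundary. -/
lemma IsTrajectory.abs_inner_sub_le (h : IsTrajectory S s u₀ v₀ u v U) (hs : s < S.T)
    {B : ℝ} (hu : ∀ t ∈ Icc s S.T, ‖u t‖ ≤ B) (hv : ∀ t ∈ Icc s S.T, ‖v t‖ ≤ B)
    {g₁ g₂ : ℝ → ℝ} (h₁ : ContDiff ℝ 1 g₁) (h₂ : ContDiff ℝ 1 g₂) (s₁ : tsupport g₁ ⊆ Ioo 0 1)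
    (s₂ : tsupport g₂ ⊆ Ioo 0 1) :
    |inner ℝ (u S.T) (toL2 g₁) + inner ℝ (v S.T) (toL2 g₂)
        - (inner ℝ u₀ (toL2 g₁) + inner ℝ v₀ (toL2 g₂))|
      ≤ B * (‖toL2 fun x => S.ε₁ * deriv g₁ x + S.c₂ x * g₂ x‖
          + ‖toL2 fun x => -(S.ε₂ * deriv g₂ x) + S.c₁ x * g₁ x‖) * (S.T - s) := by
  have hT : S.T ∈ Icc s S.T := ⟨hs.le, le_rfl⟩
  have z : ∀ {g : ℝ → ℝ}, tsupport g ⊆ Ioo 0 1 → g 0 = 0 ∧ g 1 = 0 := fun hg =>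
    ⟨image_eq_zero_of_notMem_tsupport fun h0 => lt_irrefl _ (hg h0).1,
      image_eq_zero_of_notMem_tsupport fun h1 => lt_irrefl _ (hg h1).2⟩
  have key := h.weak_inner hs (isC1Rect_of_contDiff h₁ s S.T) (isC1Rect_of_contDiff h₂ s S.T)
    (fun _ _ => (z s₁).2) (fun _ _ => by rw [(z s₁).1, (z s₂).1, mul_zero, mul_zero]) hT
  simp only [(z s₂).2, mul_zero, zero_mul, intervalIntegral.integral_zero, add_zero, adjFst,
    adjSnd, zero_add, zero_sub] at key
  rw [key, ← Real.norm_eq_abs]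
  refine (intervalIntegral.norm_integral_le_of_norm_le_const (C := B *
    (‖toL2 fun x => S.ε₁ * deriv g₁ x + S.c₂ x * g₂ x‖
      + ‖toL2 fun x => -(S.ε₂ * deriv g₂ x) + S.c₁ x * g₁ x‖)) fun t ht => ?_).trans_eq ?_
  · rw [uIoc_of_le hs.le] at ht
    have ht' : t ∈ Icc s S.T := ⟨ht.1.le, ht.2⟩
    refine (norm_add_le _ _).trans ?_
    rw [mul_add]
    exact add_le_add
      ((norm_inner_le_norm _ _).trans (mul_le_mul_of_nonneg_right (hu t ht') (norm_nonneg _)))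
      ((norm_inner_le_norm _ _).trans (mul_le_mul_of_nonneg_right (hv t ht') (norm_nonneg _)))
  · rw [abs_of_nonneg (by linarith)]

/-- A linear relation satisfied at time `T` by uniformly bounded trajectories that start from the
same state at all times before `T` is satisfied by that state, since the final states converge
weakly to it. -/
lemma inner_eq_zero_of_terminal {B : ℝ} {G₁ G₂ : L2}
    (h : ∀ s ∈ Ico 0 S.T, ∃ (u v : ℝ → L2) (U : ℝ → ℝ), IsTrajectory S s u₀ v₀ u v U ∧
      (∀ t ∈ Icc s S.T, ‖u t‖ ≤ B) ∧ (∀ t ∈ Icc s S.T, ‖v t‖ ≤ B) ∧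
      inner ℝ G₁ (u S.T) + inner ℝ G₂ (v S.T) = 0) :
    inner ℝ G₁ u₀ + inner ℝ G₂ v₀ = 0 := by
  have hB : 0 ≤ B := by
    obtain ⟨u, v, U, -, hu, -⟩ := h 0 ⟨le_rfl, S.T_pos⟩
    exact (norm_nonneg _).trans (hu S.T ⟨S.T_pos.le, le_rfl⟩)
  rw [← abs_nonpos_iff]
  refine le_of_forall_pos_le_add fun ε' hε' => ?_
  set ε := ε' / (4 * B + 1) with hεdef
  have hε : 0 < ε := by positivity
  obtain ⟨_, ⟨g₁, d₁, -, s₁, rfl⟩, n₁⟩ := Metric.dense_iff.1 dense_toL2_contDiff G₁ ε hε |>.imp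
    fun _ hg => And.symm hg
  obtain ⟨_, ⟨g₂, d₂, -, s₂, rfl⟩, n₂⟩ := Metric.dense_iff.1 dense_toL2_contDiff G₂ ε hε |>.imp
    fun _ hg => And.symm hg
  rw [Metric.mem_ball, dist_comm, dist_eq_norm] at n₁ n₂
  set C := B * (‖toL2 fun x => S.ε₁ * deriv g₁ x + S.c₂ x * g₂ x‖
          + ‖toL2 fun x => -(S.ε₂ * deriv g₂ x) + S.c₁ x * g₁ x‖) with hC
  have hC0 : 0 ≤ C := by positivity
  have hs : max 0 (S.T - ε / (C + 1)) ∈ Ico 0 S.T :=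
    ⟨le_max_left _ _, max_lt S.T_pos (by have : 0 < ε / (C + 1) := by positivity
                                         linarith)⟩
  obtain ⟨u, v, U, hz, hu, hv, e⟩ := h _ hs
  set s := max 0 (S.T - ε / (C + 1)) with hsdef
  have k1 := hz.abs_inner_sub_le hs.2 hu hv (d₁.of_le (by exact_mod_cast le_top))
    (d₂.of_le (by exact_mod_cast le_top)) s₁ s₂
  have k2 : C * (S.T - s) ≤ ε := by
    have h1 : S.T - s ≤ ε / (C + 1) := by linarith [le_max_right 0 (S.T - ε / (C + 1))]
    calc C * (S.T - s) ≤ C * (ε / (C + 1)) := by gcongr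
      _ ≤ (C + 1) * (ε / (C + 1)) := by gcongr; linarith
      _ = ε := by field_simp
  have hT : S.T ∈ Icc s S.T := ⟨hs.2.le, le_rfl⟩
  have hss : s ∈ Icc s S.T := ⟨le_rfl, hs.2.le⟩
  have close : ∀ {G g a b : L2}, ‖G - g‖ < ε → ‖a‖ ≤ B → ‖b‖ ≤ B →
      |inner ℝ (G - g) (a - b)| ≤ 2 * B * ε := fun {G g a b} hG ha hb => by
    refine (abs_real_inner_le_norm _ _).trans ?_
    have : ‖a - b‖ ≤ 2 * B := (norm_sub_le _ _).trans (by linarith)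
    calc ‖G - g‖ * ‖a - b‖ ≤ ε * (2 * B) := by gcongr
      _ = 2 * B * ε := by ring
  have b1 := close n₁ (hz.init_u ▸ hu s hss) (hu _ hT)
  have b2 := close n₂ (hz.init_v ▸ hv s hss) (hv _ hT)
  have e' : inner ℝ G₁ u₀ + inner ℝ G₂ v₀
      = inner ℝ (G₁ - toL2 g₁) (u₀ - u S.T) + inner ℝ (G₂ - toL2 g₂) (v₀ - v S.T)
        - (inner ℝ (u S.T) (toL2 g₁) + inner ℝ (v S.T) (toL2 g₂)
        - (inner ℝ u₀ (toL2 g₁) + inner ℝ v₀ (toL2 g₂))) := by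
    simp only [inner_sub_left, inner_sub_right, real_inner_comm (toL2 g₁),
      real_inner_comm (toL2 g₂)]
    linear_combination e
  rw [e', zero_add]
  have hε'' : (4 * B + 1) * ε = ε' := by rw [hεdef]; field_simp
  calc _ ≤ 2 * B * ε + 2 * B * ε + ε :=
        (abs_sub _ _).trans (add_le_add ((abs_add_le _ _).trans (add_le_add b1 b2)) (k1.trans k2))
    _ = ε' := by rw [← hε'']; ring

end Terminal

section Necessity

variable {S : Problem} {P₁ P₁x P₁y P₁t P₂ P₂x P₂y P₂t : ℝ → ℝ → ℝ → ℝ}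

lemma eq_zero_on_Icc_of_Ico {T : ℝ} (hT : 0 < T) {f : ℝ → ℝ} (hf : ContinuousOn f (Icc 0 T))
    (h : ∀ t ∈ Ico 0 T, f t = 0) : ∀ t ∈ Icc 0 T, f t = 0 := by
  have h' : EqOn f (fun _ => 0) (Ico 0 T) := h
  exact h'.of_subset_closure hf continuousOn_const Ico_subset_Icc_self
    (by rw [closure_Ico hT.ne])

lemma slice_t (hP : IsC1Cube S.T P₁ P₁x P₁y P₁t) {x y : ℝ} (hx : x ∈ Icc (0 : ℝ) 1)
    (hy : y ∈ Icc (0 : ℝ) 1) : ContinuousOn (fun t => P₁ x y t) (Icc 0 S.T) :=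
  slice_right (hP.slice hx).cont hy

lemma IsC1Cube.continuousOn_kernel (hP : IsC1Cube S.T P₁ P₁x P₁y P₁t) {t : ℝ}
    (ht : t ∈ Icc 0 S.T) :
    ContinuousOn (fun p : ℝ × ℝ => P₁ p.1 p.2 t) (Icc (0 : ℝ) 1 ×ˢ Icc (0 : ℝ) 1) :=
  hP.cont.comp (f := fun p : ℝ × ℝ => (p.1, p.2, t)) (by fun_prop) fun _ hp => ⟨hp.1, hp.2, ht⟩

/-- A kernel is symmetric if its operator is. -/
lemma kernel_symm_of_op {K : ℝ → ℝ → ℝ}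
    (hK : ContinuousOn (fun p : ℝ × ℝ => K p.1 p.2) (Icc (0 : ℝ) 1 ×ˢ Icc (0 : ℝ) 1))
    (h : ∀ f g, inner ℝ (kerL2 K hK f) g = inner ℝ (kerL2 K hK g) f) :
    ∀ x ∈ Icc (0 : ℝ) 1, ∀ y ∈ Icc (0 : ℝ) 1, K x y = K y x := by
  have hK' : ContinuousOn (fun p : ℝ × ℝ => K p.2 p.1) (Icc (0 : ℝ) 1 ×ˢ Icc (0 : ℝ) 1) :=
    hK.comp continuous_swap.continuousOn fun _ hp => ⟨hp.2, hp.1⟩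
  intro x hx y hy
  have hcx := kernel_slice hK hx
  have hcx' : ContinuousOn (fun y => K y x) (Icc 0 1) :=
    kernel_slice (K := fun x y => K y x) hK' hx
  have key := eqOn_zero_of_inner_eq_zero (g := fun y => K x y - K y x) (hcx.sub hcx')
    (fun w => by
      rw [toL2_sub hcx hcx', inner_sub_left]
      have h2 : toL2 (fun x => kernelOp K w x - kernelOp (fun x y => K y x) w x) = 0 := by
        rw [toL2_sub (continuousOn_kernelOp hK w) (continuousOn_kernelOp hK' w), sub_eq_zero]
        refine ext_inner_right ℝ fun g => ?_
        have h3 := h w g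
        rw [inner_kerL2_transpose hK hK' g w] at h3
        exact h3
      have h4 := eqOn_zero_of_toL2_eq_zero
        ((continuousOn_kernelOp hK w).sub (continuousOn_kernelOp hK' w)) h2 x hx
      rw [← kernelOp_eq_inner hcx, ← kernelOp_eq_inner (K := fun x y => K y x) hcx']
      exact h4) y hy
  exact sub_eq_zero.1 key

/-- From every state there is a trajectory whose co-states are given by the kernels, with the feedback
control. -/
lemma RepresentsCostates.exists_optimal (h : RepresentsCostates S P₁ P₂) {s : ℝ}
    (hs : s ∈ Ico 0 S.T) (u₀ v₀ : L2) :
    ∃ (u v : ℝ → L2) (U : ℝ → ℝ), IsTrajectory S s u₀ v₀ u v U ∧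
      IsCostate S s u v (applyKernel P₁ u) (applyKernel P₂ v) ∧
      IsExtremalControl S s (applyKernel P₂ v) U := by
  obtain ⟨⟨u, v, U, ho⟩, hc⟩ := h s hs u₀ v₀
  exact ⟨u, v, U, ho.1, hc u v U ho, ho.isExtremalControl hs.2 (hc u v U ho)⟩

/-- The boundary conditions of the co-states hold at the initial time for arbitrary states `u₀` and
`v₀`. The condition at `x = 0` couples them, so that both of its sides vanish, as `q ≠ 0`. -/
lemma RepresentsCostates.left_zero (h : RepresentsCostates S P₁ P₂)
    (hP₁ : IsC1Cube S.T P₁ P₁x P₁y P₁t) (hP₂ : IsC1Cube S.T P₂ P₂x P₂y P₂t) :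
    ∀ y ∈ Icc (0 : ℝ) 1, ∀ t ∈ Icc 0 S.T, P₁ 1 y t = 0 ∧ P₁ 0 y t = 0 ∧ P₂ 0 y t = 0 := by
  have h01 : (1 : ℝ) ∈ Icc (0 : ℝ) 1 := by simp
  have h00 : (0 : ℝ) ∈ Icc (0 : ℝ) 1 := by simp
  have key : ∀ t ∈ Ico 0 S.T, ∀ y ∈ Icc (0 : ℝ) 1, P₁ 1 y t = 0 ∧ P₁ 0 y t = 0 ∧ P₂ 0 y t = 0 := by
    intro t ht
    have ht' : t ∈ Icc 0 S.T := Ico_subset_Icc_self ht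
    have htt : t ∈ Icc t S.T := ⟨le_rfl, ht.2.le⟩
    have rel : ∀ u₀ v₀ : L2, inner ℝ (toL2 fun y => P₁ 1 y t) u₀ = 0 ∧
        inner ℝ (toL2 fun y => P₂ 0 y t) v₀
          = S.q * (S.ε₁ / S.ε₂) * inner ℝ (toL2 fun y => P₁ 0 y t) u₀ := fun u₀ v₀ => by
      obtain ⟨u, v, U, hz, hc, -⟩ := h.exists_optimal ht u₀ v₀
      have e1 := hc.at_one t htt
      have e2 := hc.at_zero t htt
      rw [applyKernel_eq_inner hP₁.cont u h01 ht', hz.init_u] at e1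
      rw [applyKernel_eq_inner hP₁.cont u h00 ht', applyKernel_eq_inner hP₂.cont v h00 ht',
        hz.init_u, hz.init_v] at e2
      exact ⟨e1, e2⟩
    have hne : S.q * (S.ε₁ / S.ε₂) ≠ 0 :=
      mul_ne_zero S.q_ne_zero (div_ne_zero S.ε₁_pos.ne' S.ε₂_pos.ne')
    have z1 := eqOn_zero_of_inner_eq_zero (cube_slice hP₁.cont h01 ht') fun w => (rel w 0).1
    have z2 := eqOn_zero_of_inner_eq_zero (cube_slice hP₁.cont h00 ht') fun w => by
      have := (rel w 0).2
      rw [inner_zero_right, eq_comm, mul_eq_zero] at this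
      exact this.resolve_left hne
    have z3 := eqOn_zero_of_inner_eq_zero (cube_slice hP₂.cont h00 ht') fun w => by
      have := (rel 0 w).2
      rwa [inner_zero_right, mul_zero] at this
    exact fun y hy => ⟨z1 y hy, z2 y hy, z3 y hy⟩
  intro y hy t ht
  exact ⟨eq_zero_on_Icc_of_Ico S.T_pos (slice_t hP₁ h01 hy) (fun r hr => (key r hr y hy).1) t ht,
    eq_zero_on_Icc_of_Ico S.T_pos (slice_t hP₁ h00 hy) (fun r hr => (key r hr y hy).2.1) t ht,
    eq_zero_on_Icc_of_Ico S.T_pos (slice_t hP₂ h00 hy) (fun r hr => (key r hr y hy).2.2) t ht⟩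

/-- The kernels are symmetric, since they represent the symmetric bilinear form of the cost on
optimal trajectories. -/
lemma RepresentsCostates.kernel_symm (h : RepresentsCostates S P₁ P₂)
    (hP₁ : IsC1Cube S.T P₁ P₁x P₁y P₁t) (hP₂ : IsC1Cube S.T P₂ P₂x P₂y P₂t) :
    ∀ x ∈ Icc (0 : ℝ) 1, ∀ y ∈ Icc (0 : ℝ) 1, ∀ t ∈ Icc 0 S.T,
      P₁ x y t = P₁ y x t ∧ P₂ x y t = P₂ y x t := by
  have key : ∀ t ∈ Ico 0 S.T, ∀ x ∈ Icc (0 : ℝ) 1, ∀ y ∈ Icc (0 : ℝ) 1,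
      P₁ x y t = P₁ y x t ∧ P₂ x y t = P₂ y x t := by
    intro t ht
    have ht' : t ∈ Icc 0 S.T := Ico_subset_Icc_self ht
    have hK₁ := hP₁.continuousOn_kernel ht'
    have hK₂ := hP₂.continuousOn_kernel ht'
    have rel : ∀ u₀ v₀ u₀' v₀' : L2,
        inner ℝ (kerL2 (fun x y => P₁ x y t) hK₁ u₀) u₀'
          + inner ℝ (kerL2 (fun x y => P₂ x y t) hK₂ v₀) v₀'
        = inner ℝ (kerL2 (fun x y => P₁ x y t) hK₁ u₀') u₀
          + inner ℝ (kerL2 (fun x y => P₂ x y t) hK₂ v₀') v₀ := fun u₀ v₀ u₀' v₀' => by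
      obtain ⟨u, v, U, hz, hc, hU⟩ := h.exists_optimal ht u₀ v₀
      obtain ⟨u', v', U', hz', hc', hU'⟩ := h.exists_optimal ht u₀' v₀'
      have e := hc.crossCost_of_extremal ht.2 hz hU hz'
      have e' := hc'.crossCost_of_extremal ht.2 hz' hU' hz
      rw [crossCost_comm, e] at e'
      simp only [applyKernel, hz.init_u, hz.init_v, hz'.init_u, hz'.init_v] at e'
      exact e'
    intro x hx y hy
    refine ⟨kernel_symm_of_op (K := fun x y => P₁ x y t) hK₁ (fun f g => ?_) x hx y hy,
      kernel_symm_of_op (K := fun x y => P₂ x y t) hK₂ (fun f g => ?_) x hx y hy⟩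
    · simpa using rel f 0 g 0
    · simpa using rel 0 f 0 g
  intro x hx y hy t ht
  exact ⟨sub_eq_zero.1 (eq_zero_on_Icc_of_Ico S.T_pos ((slice_t hP₁ hx hy).sub (slice_t hP₁ hy hx))
      (fun r hr => sub_eq_zero.2 (key r hr x hx y hy).1) t ht),
    sub_eq_zero.1 (eq_zero_on_Icc_of_Ico S.T_pos ((slice_t hP₂ hx hy).sub (slice_t hP₂ hy hx))
      (fun r hr => sub_eq_zero.2 (key r hr x hx y hy).2) t ht)⟩

lemma eqOn_zero_of_inner_add_eq_zero {f g : ℝ → ℝ} (hf : ContinuousOn f (Icc 0 1))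
    (hg : ContinuousOn g (Icc 0 1))
    (h : ∀ u v : L2, inner ℝ (toL2 f) u + inner ℝ (toL2 g) v = 0) :
    (∀ y ∈ Icc (0 : ℝ) 1, f y = 0) ∧ ∀ y ∈ Icc (0 : ℝ) 1, g y = 0 :=
  ⟨eqOn_zero_of_inner_eq_zero hf fun w => by simpa using h w 0,
    eqOn_zero_of_inner_eq_zero hg fun w => by simpa using h 0 w⟩

/-- The first co-state equation at the initial time of a trajectory, compared with the derivative
of `P₁ u` along it. -/
lemma RepresentsCostates.eq_fst (h : RepresentsCostates S P₁ P₂)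
    (hP₁ : IsC1Cube S.T P₁ P₁x P₁y P₁t) (hP₂ : IsC1Cube S.T P₂ P₂x P₂y P₂t)
    (h1 : ∀ x ∈ Icc (0 : ℝ) 1, ∀ t ∈ Icc 0 S.T, P₁ x 1 t = 0)
    (h0 : ∀ x ∈ Icc (0 : ℝ) 1, ∀ t ∈ Icc 0 S.T, P₁ x 0 t = 0)
    {x t : ℝ} (hx : x ∈ Icc (0 : ℝ) 1) (ht : t ∈ Ico 0 S.T) :
    (∀ y ∈ Icc (0 : ℝ) 1, P₁t x y t + S.ε₁ * P₁y x y t + (S.ε₁ * P₁x x y t + S.Q₁ x y) = 0) ∧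
    ∀ y ∈ Icc (0 : ℝ) 1, S.c₁ y * P₁ x y t + S.c₂ x * P₂ x y t = 0 := by
  have ht' : t ∈ Icc 0 S.T := Ico_subset_Icc_self ht
  have htt : t ∈ Icc t S.T := ⟨le_rfl, ht.2.le⟩
  have cx := cube_slice hP₁.cont_dx hx ht'
  have cQ := kernel_slice S.Q₁_weight.continuousOn hx
  have c1 := cube_slice hP₁.cont hx ht'
  have c2 := cube_slice hP₂.cont hx ht'
  have ct : ContinuousOn (fun y => P₁t x y t + S.ε₁ * P₁y x y t) (Icc 0 1) :=
    (cube_slice hP₁.cont_dt hx ht').add (continuousOn_const.mul (cube_slice hP₁.cont_dy hx ht'))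
  have cxQ : ContinuousOn (fun y => S.ε₁ * P₁x x y t + S.Q₁ x y) (Icc 0 1) :=
    (continuousOn_const.mul cx).add cQ
  have cc1 : ContinuousOn (fun y => S.c₁ y * P₁ x y t) (Icc 0 1) := S.c₁_cont.mul c1
  have cc2 : ContinuousOn (fun y => S.c₂ x * P₂ x y t) (Icc 0 1) := continuousOn_const.mul c2
  refine eqOn_zero_of_inner_add_eq_zero
    (f := fun y => P₁t x y t + S.ε₁ * P₁y x y t + (S.ε₁ * P₁x x y t + S.Q₁ x y))
    (g := fun y => S.c₁ y * P₁ x y t + S.c₂ x * P₂ x y t) (ct.add cxQ) (cc1.add cc2)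
    fun u₀ v₀ => ?_
  obtain ⟨u, v, U, hz, hc, hU⟩ := h.exists_optimal ht u₀ v₀
  have e := (uniqueDiffOn_Icc ht.2 t htt).eq_deriv _ (hc.eq₁ x hx t htt)
    (hz.hasDerivWithinAt_applyKernel_fst ht hP₁ h1 h0 hx htt)
  rw [hP₁.derivWithin_applyKernel u hx ht', applyKernel_eq_inner hP₁.cont_dx u hx ht',
    applyKernel_eq_inner hP₂.cont v hx ht', kernelOp_eq_inner cQ, hz.init_u, hz.init_v,
    real_inner_comm _ u₀, real_inner_comm _ v₀] at e
  rw [toL2_add ct cxQ, toL2_add (f := fun y => S.ε₁ * P₁x x y t) (continuousOn_const.mul cx) cQ,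
    toL2_add cc1 cc2, toL2_const_mul _ cx, toL2_const_mul _ c2]
  simp only [inner_add_left, inner_smul_left, conj_trivial]
  linear_combination -e

/-- The second co-state equation at the initial time of a trajectory, compared with the derivative
of `P₂ v` along it. -/
lemma RepresentsCostates.eq_snd (h : RepresentsCostates S P₁ P₂)
    (hP₁ : IsC1Cube S.T P₁ P₁x P₁y P₁t) (hP₂ : IsC1Cube S.T P₂ P₂x P₂y P₂t)
    (h0 : ∀ x ∈ Icc (0 : ℝ) 1, ∀ t ∈ Icc 0 S.T, P₂ x 0 t = 0)
    {x t : ℝ} (hx : x ∈ Icc (0 : ℝ) 1) (ht : t ∈ Ico 0 S.T) :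
    (∀ y ∈ Icc (0 : ℝ) 1, S.c₂ y * P₂ x y t + S.c₁ x * P₁ x y t = 0) ∧
    ∀ y ∈ Icc (0 : ℝ) 1, P₂t x y t - S.ε₂ * P₂y x y t
      - (S.ε₂ ^ 2 / S.R * P₂ x 1 t * P₂ 1 y t + S.ε₂ * P₂x x y t - S.Q₂ x y) = 0 := by
  have h01 : (1 : ℝ) ∈ Icc (0 : ℝ) 1 := by simp
  have ht' : t ∈ Icc 0 S.T := Ico_subset_Icc_self ht
  have htt : t ∈ Icc t S.T := ⟨le_rfl, ht.2.le⟩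
  have cx := cube_slice hP₂.cont_dx hx ht'
  have cQ := kernel_slice S.Q₂_weight.continuousOn hx
  have c1 := cube_slice hP₁.cont hx ht'
  have c2 := cube_slice hP₂.cont hx ht'
  have c21 := cube_slice hP₂.cont h01 ht'
  have ct : ContinuousOn (fun y => P₂t x y t - S.ε₂ * P₂y x y t) (Icc 0 1) :=
    (cube_slice hP₂.cont_dt hx ht').sub (continuousOn_const.mul (cube_slice hP₂.cont_dy hx ht'))
  have c3 : ContinuousOn (fun y => S.ε₂ ^ 2 / S.R * P₂ x 1 t * P₂ 1 y t) (Icc 0 1) :=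
    continuousOn_const.mul c21
  have c4 : ContinuousOn (fun y => S.ε₂ * P₂x x y t) (Icc 0 1) := continuousOn_const.mul cx
  have c34 : ContinuousOn (fun y => S.ε₂ ^ 2 / S.R * P₂ x 1 t * P₂ 1 y t + S.ε₂ * P₂x x y t)
      (Icc 0 1) := c3.add c4
  have c34Q : ContinuousOn (fun y => S.ε₂ ^ 2 / S.R * P₂ x 1 t * P₂ 1 y t + S.ε₂ * P₂x x y t
      - S.Q₂ x y) (Icc 0 1) := c34.sub cQ
  have cc1 : ContinuousOn (fun y => S.c₂ y * P₂ x y t) (Icc 0 1) := S.c₂_cont.mul c2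
  have cc2 : ContinuousOn (fun y => S.c₁ x * P₁ x y t) (Icc 0 1) := continuousOn_const.mul c1
  refine eqOn_zero_of_inner_add_eq_zero (f := fun y => S.c₂ y * P₂ x y t + S.c₁ x * P₁ x y t)
    (g := fun y => P₂t x y t - S.ε₂ * P₂y x y t
      - (S.ε₂ ^ 2 / S.R * P₂ x 1 t * P₂ 1 y t + S.ε₂ * P₂x x y t - S.Q₂ x y))
    (cc1.add cc2) (ct.sub c34Q) fun u₀ v₀ => ?_
  obtain ⟨u, v, U, hz, hc, hU⟩ := h.exists_optimal ht u₀ v₀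
  have e := (uniqueDiffOn_Icc ht.2 t htt).eq_deriv _ (hc.eq₂ x hx t htt)
    (hz.hasDerivWithinAt_applyKernel_snd ht hP₂ h0 hU hx htt)
  rw [hP₂.derivWithin_applyKernel v hx ht', applyKernel_eq_inner hP₂.cont_dx v hx ht',
    applyKernel_eq_inner hP₁.cont u hx ht', applyKernel_eq_inner hP₂.cont v h01 ht',
    kernelOp_eq_inner cQ, hz.init_u, hz.init_v,
    real_inner_comm _ u₀, real_inner_comm (toL2 fun y => P₂t x y t - S.ε₂ * P₂y x y t) v₀] at e
  rw [toL2_add cc1 cc2, toL2_sub ct c34Q, toL2_sub c34 cQ, toL2_add c3 c4,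
    toL2_const_mul _ cx, toL2_const_mul _ c1, toL2_const_mul _ c21]
  simp only [inner_add_left, inner_sub_left, inner_smul_left, conj_trivial]
  linear_combination -e

/-- The final conditions, from trajectories that start shortly before the final time. -/
lemma RepresentsCostates.final (h : RepresentsCostates S P₁ P₂)
    (hP₁ : IsC1Cube S.T P₁ P₁x P₁y P₁t) (hP₂ : IsC1Cube S.T P₂ P₂x P₂y P₂t) {x : ℝ}
    (hx : x ∈ Icc (0 : ℝ) 1) :
    (∀ y ∈ Icc (0 : ℝ) 1, P₁ x y S.T - S.Pf₁ x y = 0) ∧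
    ∀ y ∈ Icc (0 : ℝ) 1, P₂ x y S.T - S.Pf₂ x y = 0 := by
  have h01 : (1 : ℝ) ∈ Icc (0 : ℝ) 1 := by simp
  have hT : S.T ∈ Icc 0 S.T := ⟨S.T_pos.le, le_rfl⟩
  have c1 := cube_slice hP₁.cont hx hT
  have c2 := cube_slice hP₂.cont hx hT
  have f1 := kernel_slice S.Pf₁_weight.continuousOn hx
  have f2 := kernel_slice S.Pf₂_weight.continuousOn hx
  obtain ⟨M, hM⟩ := isCompact_Icc.exists_bound_of_continuousOn
    (continuousOn_toL2_slice (hP₂.slice h01).cont)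
  obtain ⟨C, hC, hb⟩ := exists_feedback_bound S ((S.ε₂ / S.R * M) ^ 2)
  have traj : ∀ (u₀ v₀ : L2), ∀ s ∈ Ico 0 S.T, ∃ (u v : ℝ → L2) (U : ℝ → ℝ),
      IsTrajectory S s u₀ v₀ u v U ∧
      (∀ t ∈ Icc s S.T, ‖u t‖ ≤ √(C * (‖u₀‖ ^ 2 + ‖v₀‖ ^ 2))) ∧
      (∀ t ∈ Icc s S.T, ‖v t‖ ≤ √(C * (‖u₀‖ ^ 2 + ‖v₀‖ ^ 2))) ∧
      inner ℝ (toL2 fun y => P₁ x y S.T - S.Pf₁ x y) (u S.T) = 0 ∧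
      inner ℝ (toL2 fun y => P₂ x y S.T - S.Pf₂ x y) (v S.T) = 0 := fun u₀ v₀ s hs => by
    obtain ⟨u, v, U, hz, hc, hU⟩ := h.exists_optimal hs u₀ v₀
    have hbound := hb hs hz (by
      filter_upwards [hU, ae_restrict_mem measurableSet_Icc] with t h1 ht
      have ht' : t ∈ Icc 0 S.T := ⟨hs.1.trans ht.1, ht.2⟩
      have h2 : |inner ℝ (toL2 fun y => P₂ 1 y t) (v t)| ≤ M * ‖v t‖ :=
        (abs_real_inner_le_norm _ _).trans
          (mul_le_mul_of_nonneg_right (hM t ht') (norm_nonneg _))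
      rw [h1, applyKernel_eq_inner hP₂.cont v h01 ht']
      calc (-(S.ε₂ / S.R) * inner ℝ (toL2 fun y => P₂ 1 y t) (v t)) ^ 2
          = (S.ε₂ / S.R) ^ 2 * |inner ℝ (toL2 fun y => P₂ 1 y t) (v t)| ^ 2 := by
            rw [sq_abs]; ring
        _ ≤ (S.ε₂ / S.R) ^ 2 * (M * ‖v t‖) ^ 2 := by gcongr
        _ = _ := by ring)
    refine ⟨u, v, U, hz, fun t ht => Real.le_sqrt_of_sq_le ?_, fun t ht => Real.le_sqrt_of_sq_le ?_,
      ?_, ?_⟩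
    · linarith [hbound t ht, sq_nonneg ‖v t‖]
    · linarith [hbound t ht, sq_nonneg ‖u t‖]
    · rw [toL2_sub c1 f1, inner_sub_left, ← applyKernel_eq_inner hP₁.cont u hx hT,
        hc.final₁ x hx, kernelOp_eq_inner f1, sub_self]
    · rw [toL2_sub c2 f2, inner_sub_left, ← applyKernel_eq_inner hP₂.cont v hx hT,
        hc.final₂ x hx, kernelOp_eq_inner f2, sub_self]
  refine eqOn_zero_of_inner_add_eq_zero (f := fun y => P₁ x y S.T - S.Pf₁ x y)
    (g := fun y => P₂ x y S.T - S.Pf₂ x y) (c1.sub f1) (c2.sub f2) fun u₀ v₀ => ?_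
  refine inner_eq_zero_of_terminal (S := S) (B := √(C * (‖u₀‖ ^ 2 + ‖v₀‖ ^ 2)))
    fun s hs => ?_
  obtain ⟨u, v, U, hz, b1, b2, e1, e2⟩ := traj u₀ v₀ s hs
  exact ⟨u, v, U, hz, b1, b2, by rw [e1, e2, add_zero]⟩

lemma RepresentsCostates.isRiccatiSolution (h : RepresentsCostates S P₁ P₂)
    (hP₁ : IsC1Cube S.T P₁ P₁x P₁y P₁t) (hP₂ : IsC1Cube S.T P₂ P₂x P₂y P₂t) :
    IsRiccatiSolution S P₁ P₂ := by
  have h01 : (1 : ℝ) ∈ Icc (0 : ℝ) 1 := by simp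
  have h00 : (0 : ℝ) ∈ Icc (0 : ℝ) 1 := by simp
  have left := h.left_zero hP₁ hP₂
  have symm := h.kernel_symm hP₁ hP₂
  have r11 : ∀ x ∈ Icc (0 : ℝ) 1, ∀ t ∈ Icc 0 S.T, P₁ x 1 t = 0 := fun x hx t ht => by
    rw [(symm x hx 1 h01 t ht).1, (left x hx t ht).1]
  have r10 : ∀ x ∈ Icc (0 : ℝ) 1, ∀ t ∈ Icc 0 S.T, P₁ x 0 t = 0 := fun x hx t ht => by
    rw [(symm x hx 0 h00 t ht).1, (left x hx t ht).2.1]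
  have r20 : ∀ x ∈ Icc (0 : ℝ) 1, ∀ t ∈ Icc 0 S.T, P₂ x 0 t = 0 := fun x hx t ht => by
    rw [(symm x hx 0 h00 t ht).2, (left x hx t ht).2.2]
  exact
  { eq₂ := fun x hx y hy t ht => by
      have hx' := Ioo_subset_Icc_self hx
      have hy' := Ioo_subset_Icc_self hy
      have e := (h.eq_snd hP₁ hP₂ r20 hx' (Ioo_subset_Ico_self ht)).2 y hy'
      rw [hP₂.deriv_t hx' hy' ht, hP₂.deriv_x hx hy' (Ioo_subset_Icc_self ht),
        hP₂.deriv_y hx' hy (Ioo_subset_Icc_self ht)]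
      linear_combination -e
    eq₁ := fun x hx y hy t ht => by
      have hx' := Ioo_subset_Icc_self hx
      have hy' := Ioo_subset_Icc_self hy
      have e := (h.eq_fst hP₁ hP₂ r11 r10 hx' (Ioo_subset_Ico_self ht)).1 y hy'
      rw [hP₁.deriv_t hx' hy' ht, hP₁.deriv_x hx hy' (Ioo_subset_Icc_self ht),
        hP₁.deriv_y hx' hy (Ioo_subset_Icc_self ht)]
      linear_combination -e
    algebraic := fun x hx y hy => eq_zero_on_Icc_of_Ico S.T_pos
      ((continuousOn_const.mul (slice_t hP₁ hx hy)).add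
        (continuousOn_const.mul (slice_t hP₂ hx hy)))
      fun t ht => (h.eq_fst hP₁ hP₂ r11 r10 hx ht).2 y hy
    algebraic' := fun x hx y hy => eq_zero_on_Icc_of_Ico S.T_pos
      ((continuousOn_const.mul (slice_t hP₁ hx hy)).add
        (continuousOn_const.mul (slice_t hP₂ hx hy)))
      fun t ht => by linear_combination (h.eq_snd hP₁ hP₂ r20 hx ht).1 y hy
    P₂_right_zero := r20
    P₁_right_one := r11
    P₁_right_zero := r10
    P₁_left_one := fun y hy t ht => (left y hy t ht).1
    P₁_left_zero := fun y hy t ht => (left y hy t ht).2.1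
    P₂_left_zero := fun y hy t ht => (left y hy t ht).2.2
    final₁ := fun x hx y hy => sub_eq_zero.1 ((h.final hP₁ hP₂ hx).1 y hy)
    final₂ := fun x hx y hy => sub_eq_zero.1 ((h.final hP₁ hP₂ hx).2 y hy) }

end Necessity

end HyperbolicLQR

end

open HyperbolicLQR
theorem theorem2 (S : Problem) (P₁ P₂ : ℝ → ℝ → ℝ → ℝ)
    (hP₁ : IsC1Kernel S P₁) (hP₂ : IsC1Kernel S P₂) :
    (RepresentsCostates S P₁ P₂ ↔ IsRiccatiSolution S P₁ P₂) ∧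
    (IsRiccatiSolution S P₁ P₂ →
      ∀ s ∈ Ico 0 S.T, ∀ (u₀ v₀ : L2) (u v : ℝ → L2) (U : ℝ → ℝ),
        IsTrajectory S s u₀ v₀ u v U →
          (IsOptimal S s u₀ v₀ u v U ↔
            ∀ᵐ t ∂(volume.restrict (Icc s S.T)),
              U t = -(S.ε₂ / S.R) * ∫ y, P₂ 1 y t * v t y ∂unitMeasure)) := by
  obtain ⟨P₁x, P₁y, P₁t, h₁⟩ := hP₁.exists_isC1Cube
  obtain ⟨P₂x, P₂y, P₂t, h₂⟩ := hP₂.exists_isC1Cube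
  exact ⟨⟨fun h => h.isRiccatiSolution h₁ h₂, fun h => h.representsCostates h₁ h₂⟩,
    fun h s hs u₀ v₀ u v U hz => h.isOptimal_iff h₁ h₂ hs hz⟩
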